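/- **Conventions.** All strings are over $\{0,1\}$. A family of functions or algorithms indexed by the security parameter $n$ is *efficient* if it is computed by (possibly non-uniform) Boolean circuits of size polynomial in $n$, with oracle gates where an oracle is available. A *polynomial-size quantum algorithm* is a sequence of quantum circuits, indexed by $n$, of polynomial size over the gates Hadamard, phase, $\pi/8$, CNOT, with quantum queries $|x,y\rangle\mapsto|x,y\oplus O(x)\rangle$ and, where stated, classical queries (the query register is measured first); its output is obtained by measuring. A function $\nu(n)$ is *negligible* if $n^c\nu(n)\to0$ for all $c$. "Quantum-accessible PRFs exist" means: there is an efficient $F:\{0,1\}^n\times\{0,1\}^n\to\{0,1\}^n$ (key, input) such that for every polynomial-size quantum $D$ with quantum oracle access, $|\Pr_k[D^{F(k,\cdot)}=1]-\Pr_O[D^{O}=1]|$ is negligible, $O$ being a random function. **Setting.** Let $(\mathcal F_1,\mathcal F_2)$ be a pair of trapdoor permutations with a common efficient randomized key generator $G(1^n)\to(\mathsf{pk},\mathsf{sk})$: for every generated key, $f_1(\mathsf{pk},\cdot)$ and $f_2(\mathsf{pk},\cdot)$ are permutations of the same set $X_n=\{0,1\}^{d(n)}$, inverted by $f_1^{-1}(\mathsf{sk},\cdot)$,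 $f_2^{-1}(\mathsf{sk},\cdot)$, and all these functions are efficient. The claw problem is: given $\mathsf{pk}$ from $G(1^n)$, output $(x_1,x_2)$ with $f_1(\mathsf{pk},x_1)=f_2(\mathsf{pk},x_2)$. The pair is claw-free against quantum adversaries if every polynomial-size quantum algorithm solves it with negligible probability. Let $\ell(n)$ be polynomially bounded. The FDH scheme for messages $m\in\{0,1\}^{\ell(n)}$ and a random oracle $O:\{0,1\}^{\ell(n)}\to X_n$ has key generator $G$, signatures $S^O(\mathsf{sk},m)=f_1^{-1}(\mathsf{sk},O(m))$, and accepts $\sigma$ iff $f_1(\mathsf{pk},\sigma)=O(m)$. Its quantum adversaries have quantum access to $O$ and classical access to the signing oracle; the advantage is the probability of outputting a valid signature on a message that was not signed; FDH is secure in the quantum random oracle model if every polynomial-size quantum adversary has negligible advantage. **The reduction.** For $p=p(n)\ge1$ let $O_c:\{0,1\}^{\ell(n)}\to X_n\times\{1,\dots,p\}$ be a random oracle and write $(a,b)=O_c(m)$. Put $\mathrm{INSTANCE}(\mathsf{pk})=\mathsf{pk}$, $\mathrm{START}(\mathsf{pk})=(\mathsf{pk},z)$ with state $z=\mathsf{pk}$;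 $\mathrm{RAND}^{O_c}(m,\mathsf{pk})=f_2(\mathsf{pk},a)$ if $b=1$ and $f_1(\mathsf{pk},a)$ otherwise; $\mathrm{SIGN}^{O_c}(m,\mathsf{pk})$ aborts if $b=1$ and returns $a$ otherwise; $\mathrm{FINISH}^{O_c}(m,\sigma,\mathsf{pk})=(\sigma,a)$. The reduction $B$ receives an instance of the claw problem, runs START, answers the random oracle and signing queries of a classical adversary $A$ by RAND and SIGN, and maps its output by FINISH. **History-free form.** Such a reduction is in *history-free form* for adversaries making at most $q(n)$ signing queries, with bounds $\alpha(n),\delta(n)$, if: (a) START, INSTANCE are efficient, and RAND, SIGN, FINISH are efficient given $O_c$; (b) $\mathrm{START}(\mathrm{INSTANCE}(\mathsf{pk}))=(\mathsf{pk},z)$ for some $z$, and for $\mathsf{pk}$ from $G(1^n)$ the distribution of $\mathrm{INSTANCE}(\mathsf{pk})$ is within negligible variational distance of the instances of the problem; (c) for every fixed state $z$ belonging to a generated key, the output distributions of every polynomial-size quantum algorithm with quantum access to $\mathrm{RAND}^{O_c}(\cdot,z)$ and to a random oracle have negligible variational distance; (d) SIGN aborts or returns a valid signature relative to $O=\mathrm{RAND}^{O_c}(\cdot,z)$,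 and, for any at most $q(n)$ messages, given that SIGN aborts on none of them, the joint distribution of $O$ and these signatures is negligibly close to that of $O$ and the signatures of the correct signing algorithm $S^O$; (e) for every (randomized, computationally unbounded) classical $A$ making at most $q(n)$ signing queries, no signing query aborts with probability at least $\alpha(n)$; (f) for every such $A$, $\Pr[\text{no abort, } A \text{ outputs a valid forgery } (m,\sigma)\text{, and the output of FINISH solves the problem}]\ge\delta(n)\cdot\Pr[\text{no abort and } A\text{ outputs a valid forgery}]$. It is *in history-free form* for $q$ if this holds for some $\alpha,\delta$ bounded below by inverse polynomials. **Theorem.** 1. For every $q$ and every polynomially bounded $p\ge1$, the reduction above satisfies (a)–(f) with $\alpha=(1-1/p)^{q}$ and $\delta=1/p$. 2. Let $q(n)\ge2$ be polynomially bounded. With $p=q$ the reduction is in history-free form for adversaries making at most $q$ signing queries, and $(1-1/q)^{q}\ge e^{-1}(1-1/q)$. 3. Suppose that quantum-accessible PRFs exist, and let $q(n)\ge2$ be polynomially bounded. For every polynomial-size quantum adversary $A$ against FDH making at most $q(n)$ signing queries there is a polynomial-size quantum algorithm $B$ for the claw problem and a negligible $\nu$ with $$\mathrm{Adv}_B(n)\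 \ge\ \frac1{q(n)}\Bigl(1-\frac1{q(n)}\Bigr)^{q(n)}\mathrm{Adv}_A(n)-\nu(n)\qquad\text{for all } n .$$ 4. If quantum-accessible PRFs exist and $(\mathcal F_1,\mathcal F_2)$ is claw-free against quantum adversaries, then FDH instantiated with $\mathcal F_1$ is secure in the quantum random oracle model. -/

import Mathlib

open scoped BigOperators

/-! Negligible functions and polynomial bounds -/

abbrev Bits (n : ℕ) : Type := Fin n → Bool

/-- `ε` tends to zero faster than every inverse polynomial. -/
def Negligible (ε : ℕ → ℝ) : Prop :=
  Asymptotics.SuperpolynomialDecay Filter.atTop (fun n : ℕ => (n : ℝ)) ε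

def PolyBounded (f : ℕ → ℕ) : Prop :=
  ∃ P : Polynomial ℕ, ∀ n, f n ≤ P.eval n

/-- `ε` is at least an inverse polynomial; in particular it is not negligible. -/
def Noticeable (ε : ℕ → ℝ) : Prop :=
  ∃ P : Polynomial ℕ, ∀ n, 0 < P.eval n ∧ (1 : ℝ) / ((P.eval n : ℕ) : ℝ) ≤ ε n

/-- The indicator of a proposition. The probability of an event `E` under a uniformly random
element of a finite type is written `𝔼 x, ind (E x)`. -/
noncomputable def ind (p : Prop) : ℝ := by
  classical exact if p then 1 else 0

def fstBits {a b : ℕ} (x : Bits (a + b)) : Bits a := fun i => x (Fin.castAdd b i)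

def sndBits {a b : ℕ} (x : Bits (a + b)) : Bits b := fun i => x (Fin.natAdd a i)

/-- The oracle that carries no information; circuits without an oracle are circuits with this
one. -/
def noOracle : Bits 0 → Bits 0 := id

/-! Classical circuits -/

/-- Gates of a Boolean circuit with oracle gates; wires are numbered in the order in which they
are created, the input wires first. -/
inductive ClassicalGate (a : ℕ) : Type
  | nand (i j : ℕ) : ClassicalGate a
  | query (x : Fin a → ℕ) : ClassicalGate a

/-- The values of all wires; every gate appends its output wires. -/
def ClassicalGate.wires {a b : ℕ} (O : Bits a → Bits b) :
    List (ClassicalGate a) → List Bool → List Bool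
  | [], w => w
  | .nand i j :: gs, w => wires O gs (w ++ [!(w.getD i false && w.getD j false)])
  | .query x :: gs, w => wires O gs (w ++ List.ofFn (O fun k => w.getD (x k) false))

/-- A Boolean circuit with `nIn` inputs, `nOut` outputs and oracle gates of type
`{0,1}^a → {0,1}^b`. -/
structure ClassicalCircuit (a b nIn nOut : ℕ) where
  gates : List (ClassicalGate a)
  out : Fin nOut → ℕ

def ClassicalCircuit.eval {a b nIn nOut : ℕ} (C : ClassicalCircuit a b nIn nOut)
    (O : Bits a → Bits b) (x : Bits nIn) : Bits nOut :=
  fun k => (ClassicalGate.wires O C.gates (List.ofFn x)).getD (C.out k) false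

def ClassicalCircuit.size {a b nIn nOut : ℕ} (C : ClassicalCircuit a b nIn nOut) : ℕ :=
  a + b + nIn + nOut + C.gates.length

/-- A family of functions computed by circuits of polynomial size. -/
def Efficient {a b : ℕ → ℕ} (f : ∀ n, Bits (a n) → Bits (b n)) : Prop :=
  ∃ C : ∀ n, ClassicalCircuit 0 0 (a n) (b n),
    PolyBounded (fun n => (C n).size) ∧ ∀ n x, (C n).eval noOracle x = f n x

/-- A family of oracle functions computed by oracle circuits of polynomial size. The oracle takes
values in `R n`, which the circuits read through the encoding `enc`. -/
def OracleEfficient {i o a b : ℕ → ℕ} {R : ℕ → Type} (enc : ∀ n, R n → Bits (o n))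
    (f : ∀ n, (Bits (i n) → R n) → Bits (a n) → Bits (b n)) : Prop :=
  ∃ C : ∀ n, ClassicalCircuit (i n) (o n) (a n) (b n),
    PolyBounded (fun n => (C n).size) ∧ ∀ n O x, (C n).eval (fun r => enc n (O r)) x = f n O x

/-- An optional string as a string: a flag followed by the string (zeros if there is none). -/
def encodeOption {k : ℕ} : Option (Bits k) → Bits (1 + k)
  | none => fun _ => false
  | some σ => Fin.append (fun _ => true) σ

/-! Quantum circuits -/

/-- Vectors in the space of `N` qubits, in the computational basis. -/
abbrev QState (N : ℕ) : Type := Bits N → ℂ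

/-- Hadamard, phase, `π/8` and controlled-not gates on `N` qubits. -/
inductive QGate (N : ℕ) : Type
  | hadamard (i : Fin N) : QGate N
  | phase (i : Fin N) : QGate N
  | piEighth (i : Fin N) : QGate N
  | cnot (c t : Fin N) (h : c ≠ t) : QGate N

noncomputable def QGate.apply {N : ℕ} : QGate N → QState N → QState N
  | .hadamard i, ψ => fun s =>
      (1 / (Real.sqrt 2 : ℂ)) * (ψ (Function.update s i false) +
        (if s i then -1 else 1) * ψ (Function.update s i true))
  | .phase i, ψ => fun s => (if s i then Complex.I else 1) * ψ s
  | .piEighth i, ψ => fun s =>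
      (if s i then Complex.exp (Complex.I * (Real.pi / 4 : ℝ)) else 1) * ψ s
  | .cnot c t _, ψ => fun s => ψ (Function.update s t (xor (s t) (s c)))

/-- Operations of a quantum circuit on `N` qubits that has quantum access to an oracle
`{0,1}^a → {0,1}^b` and classical access to an oracle `{0,1}^c → {0,1}^d`. The embedding says
which qubits form the query register and the (disjoint) answer register. -/
inductive QOp (N a b c d : ℕ) : Type
  | gate (g : QGate N) : QOp N a b c d
  | query (reg : Fin a ⊕ Fin b ↪ Fin N) : QOp N a b c d
  | classicalQuery (reg : Fin c ⊕ Fin d ↪ Fin N) : QOp N a b c d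

def QOp.isClassicalQuery {N a b c d : ℕ} : QOp N a b c d → Bool
  | .gate _ => false
  | .query _ => false
  | .classicalQuery _ => true

/-- The content of the query register in the basis state `s`. -/
def readQuery {N a b : ℕ} (reg : Fin a ⊕ Fin b ↪ Fin N) (s : Bits N) : Bits a :=
  fun k => s (reg (Sum.inl k))

/-- The map `(x, y) ↦ (x, y ⊕ O x)` on basis states. -/
def xorAnswer {N a b : ℕ} (O : Bits a → Bits b) (reg : Fin a ⊕ Fin b ↪ Fin N) (s : Bits N) :
    Bits N :=
  fun i => xor (s i) (decide (∃ j : Fin b, reg (Sum.inr j) = i ∧ O (readQuery reg s) j = true))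

/-- The unitary `|x, y⟩ ↦ |x, y ⊕ O x⟩`; the basis map is an involution. -/
def applyOracle {N a b : ℕ} (O : Bits a → Bits b) (reg : Fin a ⊕ Fin b ↪ Fin N) (ψ : QState N) :
    QState N :=
  fun s => ψ (xorAnswer O reg s)

/-- The (unnormalised) state after the query register has been measured with outcome `m`. -/
def projectQuery {N a b : ℕ} (reg : Fin a ⊕ Fin b ↪ Fin N) (m : Bits a) (ψ : QState N) :
    QState N :=
  fun s => if readQuery reg s = m then ψ s else 0

/-- The probability that running the operations on `ψ` and finally measuring all qubits leads to
an event `E`, which may depend on the list of all classical queries made and on the measured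
string. At a classical query the query register is measured first. States are not renormalised,
so that each branch carries its probability as its squared norm. -/
noncomputable def runProb {N a b c d : ℕ} (O : Bits a → Bits b) (S : Bits c → Bits d)
    (E : List (Bits c) → Bits N → Prop) :
    List (QOp N a b c d) → List (Bits c) → QState N → ℝ
  | [], τ, ψ => ∑ s, ind (E τ s) * ‖ψ s‖ ^ 2
  | .gate g :: ops, τ, ψ => runProb O S E ops τ (g.apply ψ)
  | .query reg :: ops, τ, ψ => runProb O S E ops τ (applyOracle O reg ψ)
  | .classicalQuery reg :: ops, τ, ψ =>
      ∑ m, runProb O S E ops (τ ++ [m]) (applyOracle S reg (projectQuery reg m ψ))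

/-- A quantum oracle circuit whose output is read from `nOut` of its qubits. -/
structure QCircuit (a b c d nOut : ℕ) where
  qubits : ℕ
  ops : List (QOp qubits a b c d)
  out : Fin nOut → Fin qubits

namespace QCircuit

variable {a b c d nOut : ℕ}

/-- The state `|x⟩|0…0⟩`. -/
def initState {nIn : ℕ} (N : ℕ) (x : Bits nIn) : QState N :=
  fun s => if s = (fun i : Fin N => if h : i.val < nIn then x ⟨i.val, h⟩ else false) then 1 else 0

/-- The probability that the list of classical queries and the output string satisfy `E` on the
classical input `x`. -/
noncomputable def prob (A : QCircuit a b c d nOut) (O : Bits a → Bits b) (S : Bits c → Bits d)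
    {nIn : ℕ} (x : Bits nIn) (E : List (Bits c) → Bits nOut → Prop) : ℝ :=
  runProb O S (fun τ s => E τ (fun k => s (A.out k))) A.ops [] (initState A.qubits x)

def size (A : QCircuit a b c d nOut) : ℕ := A.qubits + A.ops.length + nOut

/-- The number of classical queries. -/
def classicalQueries (A : QCircuit a b c d nOut) : ℕ := A.ops.countP QOp.isClassicalQuery

end QCircuit

/-! Pseudorandom functions -/

/-- `F` is a quantum-accessible pseudorandom function, with keys, inputs and outputs of
length `n`. -/
def IsQuantumPRF (F : ∀ n, Bits n → Bits n → Bits n) : Prop :=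
  Efficient (a := fun n => n + n) (b := fun n => n) (fun n x => F n (fstBits x) (sndBits x)) ∧
  ∀ D : ∀ n, QCircuit n n 0 0 1, PolyBounded (fun n => (D n).size) →
    Negligible fun n =>
      |(𝔼 k : Bits n, (D n).prob (F n k) noOracle (nIn := 0) Fin.elim0 (fun _ y => y 0 = true)) -
        (𝔼 O : Bits n → Bits n,
          (D n).prob O noOracle (nIn := 0) Fin.elim0 (fun _ y => y 0 = true))|

def QuantumPRFExists : Prop := ∃ F : ∀ n, Bits n → Bits n → Bits n, IsQuantumPRF F

/-! Problems -/

/-- A problem (with `α = 0`) whose challenger answers no queries: it tosses coins, sends an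
instance, and accepts or rejects the answer. -/
structure Problem where
  coinLen : ℕ → ℕ
  instLen : ℕ → ℕ
  ansLen : ℕ → ℕ
  inst : ∀ n, Bits (coinLen n) → Bits (instLen n)
  accept : ∀ n, Bits (coinLen n) → Bits (ansLen n) → Prop

/-- The advantage of a quantum solver. -/
noncomputable def Problem.advantage (P : Problem) {n : ℕ} (B : QCircuit 0 0 0 0 (P.ansLen n)) : ℝ :=
  𝔼 w : Bits (P.coinLen n), B.prob noOracle noOracle (P.inst n w) (fun _ y => P.accept n w y)

def Problem.HardForQuantum (P : Problem) : Prop :=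
  ∀ B : ∀ n, QCircuit 0 0 0 0 (P.ansLen n), PolyBounded (fun n => (B n).size) →
    Negligible fun n => P.advantage (B n)

/-! Signature schemes in the random oracle model -/

/-- A random oracle signature scheme with deterministic signing. -/
structure ROSignature where
  coinLen : ℕ → ℕ
  pkLen : ℕ → ℕ
  skLen : ℕ → ℕ
  msgLen : ℕ → ℕ
  hashLen : ℕ → ℕ
  sigLen : ℕ → ℕ
  gen : ∀ n, Bits (coinLen n) → Bits (pkLen n) × Bits (skLen n)
  sign : ∀ n, (Bits (msgLen n) → Bits (hashLen n)) → Bits (skLen n) → Bits (msgLen n) →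
    Bits (sigLen n)
  verify : ∀ n, (Bits (msgLen n) → Bits (hashLen n)) → Bits (pkLen n) → Bits (msgLen n) →
    Bits (sigLen n) → Prop

namespace ROSignature

/-- A quantum adversary: quantum access to the random oracle, classical access to the signing
oracle, and a message-signature pair as output. -/
abbrev QAdversary (S : ROSignature) (n : ℕ) : Type :=
  QCircuit (S.msgLen n) (S.hashLen n) (S.msgLen n) (S.sigLen n) (S.msgLen n + S.sigLen n)

/-- The probability that the adversary wins the existential forgery game under a chosen message
attack in the quantum-accessible random oracle model. -/
noncomputable def advantage (S : ROSignature) {n : ℕ} (A : S.QAdversary n) : ℝ :=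
  𝔼 r : Bits (S.coinLen n), 𝔼 O : Bits (S.msgLen n) → Bits (S.hashLen n),
    A.prob O (S.sign n O (S.gen n r).2) (S.gen n r).1
      (fun τ y => fstBits y ∉ τ ∧ S.verify n O (S.gen n r).1 (fstBits y) (sndBits y))

/-- Security in the quantum-accessible random oracle model. -/
def QuantumSecure (S : ROSignature) : Prop :=
  ∀ A : ∀ n, S.QAdversary n, PolyBounded (fun n => (A n).size) →
    Negligible fun n => S.advantage (A n)

end ROSignature

/-- A classical adversary with a given public key and given coins, as a decision tree: it makes
random oracle queries and signing queries and finally outputs a message and a signature. -/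
inductive Strategy (msg hash sig : ℕ) : Type
  | output (m : Bits msg) (σ : Bits sig) : Strategy msg hash sig
  | hash (r : Bits msg) (next : Bits hash → Strategy msg hash sig) : Strategy msg hash sig
  | sign (m : Bits msg) (next : Bits sig → Strategy msg hash sig) : Strategy msg hash sig

namespace Strategy

variable {msg hash sig : ℕ}

/-- At most `q` signing queries are made, whatever the answers are. -/
def SignBound : Strategy msg hash sig → ℕ → Prop
  | .output _ _, _ => True
  | .hash _ next, q => ∀ y, (next y).SignBound q
  | .sign _ _, 0 => False
  | .sign _ next, q + 1 => ∀ σ, (next σ).SignBound q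

/-- Run the adversary against simulated oracles, starting from the list `τ` of messages signed so
far. The result is the list of all signed messages with the output, or `none` if the simulated
signer aborts. -/
def run (rand : Bits msg → Bits hash) (sgn : Bits msg → Option (Bits sig)) :
    Strategy msg hash sig → List (Bits msg) → Option (List (Bits msg) × Bits msg × Bits sig)
  | .output m σ, τ => some (τ, m, σ)
  | .hash r next, τ => (next (rand r)).run rand sgn τ
  | .sign m next, τ =>
      match sgn m with
      | none => none
      | some σ => (next σ).run rand sgn (τ ++ [m])

end Strategy

/-! History-free reductions -/

/-- The algorithms of a reduction from forging for `S` to solving `P` that answers every query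
independently of the earlier ones. The algorithms `rand`, `sign` and `finish` share a random oracle
`{0,1}^roLen → RO`; `sign` may abort. -/
structure HFReduction (S : ROSignature) (P : Problem) where
  roLen : ℕ → ℕ
  RO : ℕ → Type
  [fintypeRO : ∀ n, Fintype (RO n)]
  [nonemptyRO : ∀ n, Nonempty (RO n)]
  encLen : ℕ → ℕ
  enc : ∀ n, RO n → Bits (encLen n)
  enc_injective : ∀ n, Function.Injective (enc n)
  stateLen : ℕ → ℕ
  start : ∀ n, Bits (P.instLen n) → Bits (S.pkLen n) × Bits (stateLen n)
  rand : ∀ n, (Bits (roLen n) → RO n) → Bits (S.msgLen n) → Bits (stateLen n) →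
    Bits (S.hashLen n)
  sign : ∀ n, (Bits (roLen n) → RO n) → Bits (S.msgLen n) → Bits (stateLen n) →
    Option (Bits (S.sigLen n))
  finish : ∀ n, (Bits (roLen n) → RO n) → Bits (S.msgLen n) → Bits (S.sigLen n) →
    Bits (stateLen n) → Bits (P.ansLen n)
  inst : ∀ n, Bits (S.pkLen n) → Bits (P.instLen n)

namespace HFReduction

attribute [instance] HFReduction.fintypeRO HFReduction.nonemptyRO

variable {S : ROSignature} {P : Problem}

/-- The random oracle that the reduction simulates. -/
def simOracle (R : HFReduction S P) {n : ℕ} (Oc : Bits (R.roLen n) → R.RO n)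
    (z : Bits (R.stateLen n)) : Bits (S.msgLen n) → Bits (S.hashLen n) :=
  fun r => R.rand n Oc r z

/-- The private state that belongs to a public key. -/
def stateOf (R : HFReduction S P) {n : ℕ} (pk : Bits (S.pkLen n)) : Bits (R.stateLen n) :=
  (R.start n (R.inst n pk)).2

/-- One run of the reduction, on the instance `x`, with a classical adversary. -/
def simulate (R : HFReduction S P) {n : ℕ}
    (A : Bits (S.pkLen n) → Strategy (S.msgLen n) (S.hashLen n) (S.sigLen n))
    (x : Bits (P.instLen n)) (Oc : Bits (R.roLen n) → R.RO n) :
    Option (List (Bits (S.msgLen n)) × Bits (S.msgLen n) × Bits (S.sigLen n)) :=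
  (A (R.start n x).1).run (R.simOracle Oc (R.start n x).2)
    (fun m => R.sign n Oc m (R.start n x).2) []

/-- The run does not abort, and the adversary outputs the valid forgery `(m, σ)`. -/
def Forges (R : HFReduction S P) {n : ℕ}
    (A : Bits (S.pkLen n) → Strategy (S.msgLen n) (S.hashLen n) (S.sigLen n))
    (x : Bits (P.instLen n)) (Oc : Bits (R.roLen n) → R.RO n)
    (m : Bits (S.msgLen n)) (σ : Bits (S.sigLen n)) : Prop :=
  ∃ τ, R.simulate A x Oc = some (τ, m, σ) ∧ m ∉ τ ∧
    S.verify n (R.simOracle Oc (R.start n x).2) (R.start n x).1 m σ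

/-- The reduction is in history-free form for adversaries that make at most `q` signing queries,
with probability at least `α` that no signing query aborts and probability at least `δ` that a
valid forgery leads to a solution of `P`. Classical adversaries are randomised by `k n` coins and
are not required to be efficient. -/
structure HistoryFreeWith (R : HFReduction S P) (q : ℕ → ℕ) (α δ : ℕ → ℝ) : Prop where
  start_efficient : Efficient (a := P.instLen) (b := fun n => S.pkLen n + R.stateLen n)
    (fun n x => Fin.append (R.start n x).1 (R.start n x).2)
  inst_efficient : Efficient R.inst
  rand_efficient : OracleEfficient (i := R.roLen) (a := fun n => S.msgLen n + R.stateLen n) R.enc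
    (fun n Oc x => R.rand n Oc (fstBits x) (sndBits x))
  sign_efficient : OracleEfficient (i := R.roLen) (a := fun n => S.msgLen n + R.stateLen n)
    (b := fun n => 1 + S.sigLen n) R.enc
    (fun n Oc x => encodeOption (R.sign n Oc (fstBits x) (sndBits x)))
  finish_efficient : OracleEfficient (i := R.roLen)
    (a := fun n => S.msgLen n + S.sigLen n + R.stateLen n) R.enc
    (fun n Oc x => R.finish n Oc (fstBits (fstBits x)) (sndBits (fstBits x)) (sndBits x))
  start_inst : ∀ n pk, (R.start n (R.inst n pk)).1 = pk
  /- `INSTANCE` of a random public key is distributed almost as in the problem. -/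
  inst_close : Negligible fun n => ∑ x : Bits (P.instLen n),
    |(𝔼 r : Bits (S.coinLen n), ind (R.inst n (S.gen n r).1 = x)) -
      𝔼 w : Bits (P.coinLen n), ind (P.inst n w = x)|
  /- For fixed state, the simulated oracle is quantum computationally indistinguishable from a
  random oracle: the output distributions have negligible variational distance. -/
  rand_indistinguishable : ∀ (k : ℕ → ℕ)
    (D : ∀ n, QCircuit (S.msgLen n) (S.hashLen n) 0 0 (k n)),
    PolyBounded (fun n => (D n).size) →
    ∃ ν : ℕ → ℝ, Negligible ν ∧ ∀ n (r : Bits (S.coinLen n)),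
      ∑ y : Bits (k n),
        |(𝔼 Oc : Bits (R.roLen n) → R.RO n,
            (D n).prob (R.simOracle Oc (R.stateOf (S.gen n r).1)) noOracle (nIn := 0) Fin.elim0
              (fun _ y' => y' = y)) -
          𝔼 O : Bits (S.msgLen n) → Bits (S.hashLen n),
            (D n).prob O noOracle (nIn := 0) Fin.elim0 (fun _ y' => y' = y)| ≤ ν n
  /- `SIGN` aborts or returns a valid signature relative to the simulated oracle. -/
  sign_valid : ∀ n (r : Bits (S.coinLen n)) (Oc : Bits (R.roLen n) → R.RO n)
    (m : Bits (S.msgLen n)) (σ : Bits (S.sigLen n)),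
    R.sign n Oc m (R.stateOf (S.gen n r).1) = some σ →
    S.verify n (R.simOracle Oc (R.stateOf (S.gen n r).1)) (S.gen n r).1 m σ
  /- Given that no signature on `ms` aborts, the simulated oracle together with these signatures
  is distributed almost like the simulated oracle `H` with the signatures computed from `H` by the
  correct signing algorithm (multiplied by the probability that none aborts). -/
  sign_close : ∃ ν : ℕ → ℝ, Negligible ν ∧ ∀ n (r : Bits (S.coinLen n)) (k : ℕ), k ≤ q n →
    ∀ ms : Fin k → Bits (S.msgLen n),
      ∑ H : Bits (S.msgLen n) → Bits (S.hashLen n), ∑ σs : Fin k → Bits (S.sigLen n),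
        |(𝔼 Oc : Bits (R.roLen n) → R.RO n,
            ind (R.simOracle Oc (R.stateOf (S.gen n r).1) = H ∧
              ∀ i, R.sign n Oc (ms i) (R.stateOf (S.gen n r).1) = some (σs i))) -
          (𝔼 Oc : Bits (R.roLen n) → R.RO n,
            ind (∀ i, R.sign n Oc (ms i) (R.stateOf (S.gen n r).1) ≠ none)) *
          (𝔼 Oc : Bits (R.roLen n) → R.RO n,
            ind (R.simOracle Oc (R.stateOf (S.gen n r).1) = H)) *
          ind (∀ i, σs i = S.sign n H (S.gen n r).2 (ms i))|
      ≤ ν n * 𝔼 Oc : Bits (R.roLen n) → R.RO n,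
          ind (∀ i, R.sign n Oc (ms i) (R.stateOf (S.gen n r).1) ≠ none)
  /- No signing query aborts with probability at least `α`. -/
  sign_no_abort : ∀ (n k : ℕ)
    (A : Bits (S.pkLen n) → Bits k → Strategy (S.msgLen n) (S.hashLen n) (S.sigLen n)),
    (∀ pk ω, (A pk ω).SignBound (q n)) →
    α n ≤ 𝔼 w : Bits (P.coinLen n), 𝔼 ω : Bits k, 𝔼 Oc : Bits (R.roLen n) → R.RO n,
      ind (R.simulate (fun pk => A pk ω) (P.inst n w) Oc ≠ none)
  /- Given a valid forgery, the challenger accepts with probability at least `δ`. -/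
  finish_accepts : ∀ (n k : ℕ)
    (A : Bits (S.pkLen n) → Bits k → Strategy (S.msgLen n) (S.hashLen n) (S.sigLen n)),
    (∀ pk ω, (A pk ω).SignBound (q n)) →
    δ n * (𝔼 w : Bits (P.coinLen n), 𝔼 ω : Bits k, 𝔼 Oc : Bits (R.roLen n) → R.RO n,
        ind (∃ m σ, R.Forges (fun pk => A pk ω) (P.inst n w) Oc m σ)) ≤
      𝔼 w : Bits (P.coinLen n), 𝔼 ω : Bits k, 𝔼 Oc : Bits (R.roLen n) → R.RO n,
        ind (∃ m σ, R.Forges (fun pk => A pk ω) (P.inst n w) Oc m σ ∧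
          P.accept n w (R.finish n Oc m σ (R.start n (P.inst n w)).2))

/-- The reduction is in history-free form for adversaries that make at most `q` signing queries. -/
def IsHistoryFree (R : HFReduction S P) (q : ℕ → ℕ) : Prop :=
  ∃ α δ : ℕ → ℝ, Noticeable α ∧ Noticeable δ ∧ R.HistoryFreeWith q α δ

end HFReduction

/-! Full domain hash from claw-free permutations -/

/-- A pair of trapdoor permutations of `{0,1}^domLen` with a common key generator. A left inverse
suffices, as the domain is finite. -/
structure TrapdoorPermutationPair where
  coinLen : ℕ → ℕ
  pkLen : ℕ → ℕ
  skLen : ℕ → ℕ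
  domLen : ℕ → ℕ
  gen : ∀ n, Bits (coinLen n) → Bits (pkLen n) × Bits (skLen n)
  f₁ : ∀ n, Bits (pkLen n) → Bits (domLen n) → Bits (domLen n)
  f₂ : ∀ n, Bits (pkLen n) → Bits (domLen n) → Bits (domLen n)
  inv₁ : ∀ n, Bits (skLen n) → Bits (domLen n) → Bits (domLen n)
  inv₂ : ∀ n, Bits (skLen n) → Bits (domLen n) → Bits (domLen n)
  inv₁_f₁ : ∀ n r x, inv₁ n (gen n r).2 (f₁ n (gen n r).1 x) = x
  inv₂_f₂ : ∀ n r x, inv₂ n (gen n r).2 (f₂ n (gen n r).1 x) = x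
  gen_efficient : Efficient (a := coinLen) (b := fun n => pkLen n + skLen n)
    (fun n r => Fin.append (gen n r).1 (gen n r).2)
  f₁_efficient : Efficient (a := fun n => pkLen n + domLen n) (b := domLen)
    (fun n x => f₁ n (fstBits x) (sndBits x))
  f₂_efficient : Efficient (a := fun n => pkLen n + domLen n) (b := domLen)
    (fun n x => f₂ n (fstBits x) (sndBits x))
  inv₁_efficient : Efficient (a := fun n => skLen n + domLen n) (b := domLen)
    (fun n x => inv₁ n (fstBits x) (sndBits x))
  inv₂_efficient : Efficient (a := fun n => skLen n + domLen n) (b := domLen)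
    (fun n x => inv₂ n (fstBits x) (sndBits x))

namespace TrapdoorPermutationPair

/-- Given the public key, find `(x₁, x₂)` with `f₁ pk x₁ = f₂ pk x₂`. -/
abbrev clawProblem (F : TrapdoorPermutationPair) : Problem where
  coinLen := F.coinLen
  instLen := F.pkLen
  ansLen := fun n => F.domLen n + F.domLen n
  inst := fun n w => (F.gen n w).1
  accept := fun n w y =>
    F.f₁ n (F.gen n w).1 (fstBits y) = F.f₂ n (F.gen n w).1 (sndBits y)

/-- The pair is claw-free against quantum adversaries. -/
def QuantumClawFree (F : TrapdoorPermutationPair) : Prop := F.clawProblem.HardForQuantum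

/-- Full domain hash with the first permutation, for messages of length `msgLen`. -/
abbrev fdh (F : TrapdoorPermutationPair) (msgLen : ℕ → ℕ) : ROSignature where
  coinLen := F.coinLen
  pkLen := F.pkLen
  skLen := F.skLen
  msgLen := msgLen
  hashLen := F.domLen
  sigLen := F.domLen
  gen := F.gen
  sign := fun n O sk m => F.inv₁ n sk (O m)
  verify := fun n O pk m σ => F.f₁ n pk σ = O m

end TrapdoorPermutationPair

/-- Encoding of a pair `(a, b)` by `a` followed by `b` in binary. -/
def encodePair {d p : ℕ} (x : Bits d × Fin p) : Bits (d + Nat.size p) :=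
  Fin.append x.1 (fun i => Nat.testBit x.2.val i.val)

theorem encodePair_injective {d p : ℕ} : Function.Injective (encodePair (d := d) (p := p)) := by
  rintro ⟨a, b⟩ ⟨a', b'⟩ h
  have h1 : a = a' := by
    funext i
    have := congrFun h (Fin.castAdd _ i)
    simpa [encodePair] using this
  have h2 : b = b' := by
    apply Fin.ext
    apply Nat.eq_of_testBit_eq
    intro i
    by_cases hi : i < Nat.size p
    · have := congrFun h (Fin.natAdd d ⟨i, hi⟩)
      rw [encodePair, encodePair, Fin.append_right, Fin.append_right] at this
      exact this
    · have hp : p < 2 ^ i :=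
        lt_of_lt_of_le (Nat.lt_size_self p) (Nat.pow_le_pow_right (by norm_num) (not_lt.mp hi))
      rw [Nat.testBit_lt_two_pow (lt_trans b.isLt hp), Nat.testBit_lt_two_pow (lt_trans b'.isLt hp)]
  rw [h1, h2]

namespace TrapdoorPermutationPair

/-- Coron's reduction in history-free shape. The shared random oracle returns a random domain
element `a` and a random `b` in `{1, …, p}`; here `b = 1` is the element `0` of `Fin p`. -/
abbrev coronReduction (F : TrapdoorPermutationPair) (msgLen p : ℕ → ℕ) (hp : ∀ n, 0 < p n) :
    HFReduction (F.fdh msgLen) F.clawProblem where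
  roLen := msgLen
  RO := fun n => Bits (F.domLen n) × Fin (p n)
  nonemptyRO := fun n => ⟨(fun _ => false, ⟨0, hp n⟩)⟩
  encLen := fun n => F.domLen n + Nat.size (p n)
  enc := fun _ => encodePair
  enc_injective := fun _ => encodePair_injective
  stateLen := F.pkLen
  start := fun _ pk => (pk, pk)
  rand := fun n Oc r pk =>
    if (Oc r).2.val = 0 then F.f₂ n pk (Oc r).1 else F.f₁ n pk (Oc r).1
  sign := fun _ Oc m _ => if (Oc m).2.val = 0 then none else some (Oc m).1
  finish := fun _ Oc m σ _ => Fin.append σ (Oc m).1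
  inst := fun _ pk => pk

end TrapdoorPermutationPair

/-!
The reduction programs the random oracle: at a message `m` it takes a random domain element `a` and
random coins, and answers `f₂ a` if the coins are bad (which has probability `ρ`), and `f₁ a`
otherwise. Since `f₁` and `f₂` are permutations, the map from the values of `a` and the coins to the
hash values and the coins is a bijection for each key (`expect_programmed`). Hence the simulated
oracle is exactly a random function, independent of the coins; a signature `a` is available where
the coins are good; and a forgery on a message with bad coins is a claw together with `a`. The
messages signed and the message of the forgery are determined by the hash values, so the coins at
these points are fresh, and this gives the bounds `(1 - ρ) ^ q` and `ρ` by induction on the run of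
the forger (`TrapdoorPermutationPair.coron_historyFreeWith`).

The same argument applies to a quantum forger, because the simulation does not depend on the history
of queries: for fixed hash values every branch of the measured signing queries satisfies the bound
(`mul_forge_le_expect_simProb`). What remains is to make the simulation efficient, where a
polynomial-size circuit cannot hold a random function.

* Every classical oracle circuit can be run reversibly by quantum gates, so a circuit with quantum
  and classical queries to a simulated oracle becomes a single circuit without them: compute the
  answer on fresh qubits, copy it, and uncompute. A classical query additionally copies the query to
  a fresh register that is never touched again, which has the effect of a measurement
  (`QCircuit.exists_simulation`). Classical circuits are handled through the composable fragments
  `Comp`, and the Toffoli gate is built from the Clifford and `π/8` gates.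
* The values `a` and the coins come from a pseudorandom function applied to the message. A
  distinguisher runs the simulation for a fixed public key and tests whether it finds a claw
  (`exists_distinguisher`); as circuits are non-uniform, the public key is hardwired
  (`QCircuit.exists_hardwired`) and security is uniform over all keys
  (`IsQuantumPRF.exists_negligible`). The best key of the pseudorandom function is hardwired in the
  claw finder.
* Random bits give only probabilities with a power of two as denominator, so `ρ = 1 / q` is not
  always available. Any `ρ` between `1 / (q + 1)` and `1 / q` is as good
  (`one_div_mul_pow_le`, `exists_coin`).
-/

/-! ### Composable classical circuits -/

/-- `f` is computed by at most `s` gates that can be appended to any circuit: whatever `len` wires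
exist already, the gates read the input from the given wires `p` and use a given wire `z` that
carries `false`. In contrast to whole circuits, such fragments compose without renumbering. -/
def Comp (i o : ℕ) {a b : ℕ} (s : ℕ) (f : (Bits i → Bits o) → Bits a → Bits b) : Prop :=
  ∀ (len z : ℕ) (p : Fin a → ℕ), z < len → (∀ k, p k < len) →
    ∃ (gs : List (ClassicalGate i)) (L : ℕ) (q : Fin b → ℕ), gs.length ≤ s ∧
      (∀ k, q k < len + L) ∧
      ∀ (O : Bits i → Bits o) (w : List Bool), w.length = len → w.getD z false = false →
        ∃ w' : List Bool, w'.length = L ∧ ClassicalGate.wires O gs w = w ++ w' ∧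
          ∀ k, (w ++ w').getD (q k) false = f O (fun k => w.getD (p k) false) k

theorem ClassicalGate.wires_append {a b : ℕ} (O : Bits a → Bits b)
    (gs gs' : List (ClassicalGate a)) (w : List Bool) :
    wires O (gs ++ gs') w = wires O gs' (wires O gs w) := by
  induction gs generalizing w with
  | nil => rfl
  | cons g gs ih => cases g <;> simp [wires, ih]

theorem List.getD_append_of_lt {w w' : List Bool} {k : ℕ} (h : k < w.length) :
    (w ++ w').getD k false = w.getD k false := by
  simp [List.getD_eq_getElem?_getD, List.getElem?_append_left h]

theorem fstBits_append {a b : ℕ} (u : Bits a) (v : Bits b) : fstBits (Fin.append u v) = u := by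
  funext k; exact Fin.append_left _ _ _

theorem sndBits_append {a b : ℕ} (u : Bits a) (v : Bits b) : sndBits (Fin.append u v) = v := by
  funext k; exact Fin.append_right _ _ _

namespace Comp

variable {i o a b c s s₁ s₂ : ℕ}

theorem mono {f : (Bits i → Bits o) → Bits a → Bits b} (h : Comp i o s₁ f) (hs : s₁ ≤ s₂) :
    Comp i o s₂ f := by
  intro len z p hz hp
  obtain ⟨gs, L, q, h1, h2, h3⟩ := h len z p hz hp
  exact ⟨gs, L, q, h1.trans hs, h2, h3⟩

/-- Rewiring costs no gates. -/
theorem wire (ρ : Fin b → Fin a) : Comp i o 0 (fun _ x k => x (ρ k)) := by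
  intro len z p hz hp
  refine ⟨[], 0, fun k => p (ρ k), le_rfl, fun k => hp _, fun O w hw hwz => ⟨[], rfl, ?_, ?_⟩⟩
  · simp [ClassicalGate.wires]
  · simp

theorem zero : Comp i o 0 (fun _ (_ : Bits a) (_ : Fin b) => false) := by
  intro len z p hz hp
  refine ⟨[], 0, fun k => z, le_rfl, fun k => hz, fun O w hw hwz => ⟨[], rfl, ?_, ?_⟩⟩
  · simp [ClassicalGate.wires]
  · simpa using fun _ => hwz

theorem comp {f : (Bits i → Bits o) → Bits a → Bits b} {g : (Bits i → Bits o) → Bits b → Bits c}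
    (hf : Comp i o s₁ f) (hg : Comp i o s₂ g) :
    Comp i o (s₁ + s₂) (fun O x => g O (f O x)) := by
  intro len z p hz hp
  obtain ⟨gs, L, q, h1, h2, h3⟩ := hf len z p hz hp
  obtain ⟨gs', L', q', h1', h2', h3'⟩ := hg (len + L) z q (by omega) h2
  refine ⟨gs ++ gs', L + L', q', by simp; omega, fun k => by have := h2' k; omega, ?_⟩
  intro O w hw hwz
  obtain ⟨w', e1, e2, e3⟩ := h3 O w hw hwz
  obtain ⟨w'', e1', e2', e3'⟩ := h3' O (w ++ w') (by simp [hw, e1])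
    (by rw [List.getD_append_of_lt (by omega), hwz])
  refine ⟨w' ++ w'', by simp [e1, e1'], ?_, ?_⟩
  · rw [ClassicalGate.wires_append, e2, e2', List.append_assoc]
  · intro k
    rw [← List.append_assoc, e3' k]
    congr 1
    funext k
    exact e3 k

theorem pair {f : (Bits i → Bits o) → Bits a → Bits b} {g : (Bits i → Bits o) → Bits a → Bits c}
    (hf : Comp i o s₁ f) (hg : Comp i o s₂ g) :
    Comp i o (s₁ + s₂) (fun O x => Fin.append (f O x) (g O x)) := by
  intro len z p hz hp
  obtain ⟨gs, L, q, h1, h2, h3⟩ := hf len z p hz hp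
  obtain ⟨gs', L', q', h1', h2', h3'⟩ := hg (len + L) z p (by omega)
    (fun k => (hp k).trans_le (by omega))
  refine ⟨gs ++ gs', L + L', Fin.append q q', by simp; omega, ?_, ?_⟩
  · intro k
    refine Fin.addCases (fun k => ?_) (fun k => ?_) k
    · rw [Fin.append_left]; have := h2 k; omega
    · rw [Fin.append_right]; have := h2' k; omega
  intro O w hw hwz
  obtain ⟨w', e1, e2, e3⟩ := h3 O w hw hwz
  obtain ⟨w'', e1', e2', e3'⟩ := h3' O (w ++ w') (by simp [hw, e1])
    (by rw [List.getD_append_of_lt (by omega), hwz])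
  refine ⟨w' ++ w'', by simp [e1, e1'], ?_, ?_⟩
  · rw [ClassicalGate.wires_append, e2, e2', List.append_assoc]
  · intro k
    rw [← List.append_assoc]
    refine Fin.addCases (fun k => ?_) (fun k => ?_) k
    · beta_reduce
      rw [Fin.append_left, Fin.append_left, List.getD_append_of_lt, e3 k]
      have := h2 k
      simp [hw, e1]; omega
    · beta_reduce
      rw [Fin.append_right, Fin.append_right, e3' k]
      congr 1
      funext k
      rw [List.getD_append_of_lt (by have := hp k; omega)]

theorem query : Comp i o 1 (fun O x => O x) := by
  intro len z p hz hp
  refine ⟨[.query p], o, fun k => len + k, le_rfl, fun k => by dsimp only; omega, ?_⟩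
  intro O w hw hwz
  refine ⟨List.ofFn (O fun k => w.getD (p k) false), by simp, by simp [ClassicalGate.wires], ?_⟩
  intro k
  beta_reduce
  rw [List.getD_eq_getElem?_getD, List.getElem?_append_right (by omega)]
  simp [hw]

theorem nand : Comp i o (a := 2) (b := 1) 1 (fun _ x _ => !(x 0 && x 1)) := by
  intro len z p hz hp
  refine ⟨[.nand (p 0) (p 1)], 1, fun _ => len, le_rfl, fun k => by dsimp only; omega, ?_⟩
  intro O w hw hwz
  refine ⟨[!(w.getD (p 0) false && w.getD (p 1) false)], rfl,
    by simp only [ClassicalGate.wires], ?_⟩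
  intro k
  beta_reduce
  rw [List.getD_eq_getElem?_getD, List.getElem?_append_right (by omega)]
  simp [hw]

theorem congr {f g : (Bits i → Bits o) → Bits a → Bits b} (h : Comp i o s f)
    (e : ∀ O x, f O x = g O x) : Comp i o s g := by
  have : f = g := by funext O x; exact e O x
  exact this ▸ h

/-- A gate without an oracle, relocated. -/
theorem relabel (gs : List (ClassicalGate 0)) :
    ∀ (len z : ℕ) (pos : List ℕ), z < len → (∀ p ∈ pos, p < len) →
    ∃ (gs' : List (ClassicalGate i)) (L : ℕ) (pos' : List ℕ), gs'.length ≤ gs.length ∧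
      (∀ p ∈ pos', p < len + L) ∧
      ∀ (O : Bits i → Bits o) (w : List Bool), w.length = len → w.getD z false = false →
        ∃ w' : List Bool, w'.length = L ∧ ClassicalGate.wires O gs' w = w ++ w' ∧
          pos'.map (fun p => (w ++ w').getD p false) =
            ClassicalGate.wires noOracle gs (pos.map fun p => w.getD p false) := by
  induction gs with
  | nil =>
    intro len z pos hz hp
    refine ⟨[], 0, pos, le_rfl, hp, fun O w hw hwz => ⟨[], rfl, ?_, ?_⟩⟩ <;>
      simp [ClassicalGate.wires]
  | cons g gs ih =>
    intro len z pos hz hp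
    cases g with
    | nand j k =>
      obtain ⟨gs', L, pos', h1, h2, h3⟩ := ih (len + 1) z (pos ++ [len]) (by omega) (by
        intro p hp'
        rcases List.mem_append.1 hp' with h | h
        · have := hp p h; omega
        · simp at h; omega)
      refine ⟨.nand (pos.getD j z) (pos.getD k z) :: gs', L + 1, pos', by simpa using h1,
        fun p hp => by have := h2 p hp; omega, ?_⟩
      intro O w hw hwz
      have key : ∀ j, w.getD (pos.getD j z) false =
          (pos.map fun p => w.getD p false).getD j false := by
        intro j
        have := (List.getD_map (n := j) (d := z) (l := pos) (f := fun p => w.getD p false)).symm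
        simpa only [hwz] using this
      obtain ⟨w', e1, e2, e3⟩ := h3 O
        (w ++ [!(w.getD (pos.getD j z) false && w.getD (pos.getD k z) false)])
        (by simp [hw]) (by rw [List.getD_append_of_lt (by omega), hwz])
      refine ⟨[!(w.getD (pos.getD j z) false && w.getD (pos.getD k z) false)] ++ w',
        by simp [e1], ?_, ?_⟩
      · rw [ClassicalGate.wires, e2, List.append_assoc]
      · rw [← List.append_assoc, e3, ClassicalGate.wires, List.map_append]
        congr 2
        · refine List.map_congr_left fun p hp' => ?_
          rw [List.getD_append_of_lt (by have := hp p hp'; omega)]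
        · rw [← key j, ← key k, ← hw]
          simp only [List.map_cons, List.map_nil]
          rw [List.getD_eq_getElem?_getD, List.getElem?_append_right le_rfl]
          simp
    | query x =>
      obtain ⟨gs', L, pos', h1, h2, h3⟩ := ih len z pos hz hp
      refine ⟨gs', L, pos', by simp; omega, h2, fun O w hw hwz => ?_⟩
      obtain ⟨w', e1, e2, e3⟩ := h3 O w hw hwz
      exact ⟨w', e1, e2, by rw [e3]; simp [ClassicalGate.wires]⟩

theorem of_circuit (C : ClassicalCircuit 0 0 a b) :
    Comp i o C.gates.length (fun _ x => C.eval noOracle x) := by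
  intro len z p hz hp
  obtain ⟨gs, L, pos, h1, h2, h3⟩ := relabel (i := i) (o := o) C.gates len z (List.ofFn p) hz (by
    intro q hq
    obtain ⟨k, rfl⟩ := (List.mem_ofFn' _ _).1 hq
    exact hp k)
  refine ⟨gs, L, fun k => pos.getD (C.out k) z, h1, ?_, ?_⟩
  · intro k
    beta_reduce
    rw [List.getD_eq_getElem?_getD]
    rcases lt_or_ge (C.out k) pos.length with h | h
    · rw [List.getElem?_eq_getElem h]
      exact h2 _ (List.getElem_mem h)
    · rw [List.getElem?_eq_none h]
      simp; omega
  · intro O w hw hwz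
    obtain ⟨w', e1, e2, e3⟩ := h3 O w hw hwz
    refine ⟨w', e1, e2, fun k => ?_⟩
    have := (List.getD_map (n := C.out k) (d := z) (l := pos)
      (f := fun p => (w ++ w').getD p false)).symm
    rw [List.getD_append_of_lt (k := z) (by omega), hwz] at this
    rw [this, e3, List.map_ofFn]
    rfl

/-- A fragment becomes a circuit once a wire carrying `false` has been produced. -/
theorem exists_circuit {f : (Bits i → Bits o) → Bits a → Bits b} (h : Comp i o s f) :
    ∃ C : ClassicalCircuit i o a b, C.gates.length ≤ s + 2 ∧ ∀ O x, C.eval O x = f O x := by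
  obtain ⟨gs, L, q, h1, h2, h3⟩ := h (a + 2) (a + 1) (fun k => k) (by omega) (fun k => by omega)
  refine ⟨⟨[.nand a a, .nand a a] ++ gs, q⟩, by simpa using h1, fun O x => ?_⟩
  have e : ClassicalGate.wires O [.nand a a, .nand a a] (List.ofFn x) =
      List.ofFn x ++ [true, false] := by
    simp [ClassicalGate.wires]
  obtain ⟨w', e1, e2, e3⟩ := h3 O (List.ofFn x ++ [true, false]) (by simp)
    (by simp)
  funext k
  unfold ClassicalCircuit.eval
  simp only [ClassicalGate.wires_append O _ gs]
  rw [e, e2, e3]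
  congr 1
  funext k
  rw [List.getD_append_of_lt (by simp)]
  simp

end Comp

/-- `f` is a single bit computed by a circuit fragment of at most `s` gates. -/
def BitComp (i o : ℕ) {a : ℕ} (s : ℕ) (f : (Bits i → Bits o) → Bits a → Bool) : Prop :=
  Comp i o (b := 1) s (fun O x _ => f O x)

namespace BitComp

variable {i o a b s s₁ s₂ s₃ : ℕ} {f g h : (Bits i → Bits o) → Bits a → Bool}

theorem mono (h : BitComp i o s₁ f) (hs : s₁ ≤ s₂) : BitComp i o s₂ f := Comp.mono h hs

theorem bit (k : Fin a) : BitComp i o 0 (fun _ x => x k) := Comp.wire (fun _ => k)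

theorem false : BitComp i o 0 (fun _ (_ : Bits a) => Bool.false) := Comp.zero

theorem congr (hf : BitComp i o s f) (e : ∀ O x, f O x = g O x) : BitComp i o s g :=
  Comp.congr hf fun O x => by funext _; exact e O x

theorem nand (hf : BitComp i o s₁ f) (hg : BitComp i o s₂ g) :
    BitComp i o (s₁ + s₂ + 1) (fun O x => !(f O x && g O x)) :=
  ((Comp.pair hf hg).comp Comp.nand).congr fun O x => by
    funext _
    have h0 : (0 : Fin (1 + 1)) = Fin.castAdd 1 0 := rfl
    have h1 : (1 : Fin (1 + 1)) = Fin.natAdd 1 0 := rfl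
    rw [h0, h1, Fin.append_left, Fin.append_right]

/-- Negation as `nand` with the constant `true`. -/
theorem not (hf : BitComp i o s f) : BitComp i o (s + 2) (fun O x => !f O x) :=
  (hf.nand (BitComp.false.nand BitComp.false)).congr (by simp)

theorem true : BitComp i o 1 (fun _ (_ : Bits a) => Bool.true) :=
  (BitComp.false.nand BitComp.false).congr (by simp)

theorem and (hf : BitComp i o s₁ f) (hg : BitComp i o s₂ g) :
    BitComp i o (s₁ + s₂ + 3) (fun O x => f O x && g O x) :=
  (hf.nand hg).not.congr (by simp)

theorem or (hf : BitComp i o s₁ f) (hg : BitComp i o s₂ g) :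
    BitComp i o (s₁ + s₂ + 5) (fun O x => f O x || g O x) :=
  ((hf.not.nand hg.not).mono (by omega)).congr (by simp)

theorem cond (hf : BitComp i o s₁ f) (hg : BitComp i o s₂ g) (hh : BitComp i o s₃ h) :
    BitComp i o (2 * s₁ + s₂ + s₃ + 13) (fun O x => bif f O x then g O x else h O x) :=
  (((hf.and hg).or (hf.not.and hh)).mono (by omega)).congr (by
    intro O x; cases f O x <;> simp)

theorem beq (hf : BitComp i o s₁ f) (hg : BitComp i o s₂ g) :
    BitComp i o (2 * s₁ + 2 * s₂ + 15) (fun O x => f O x == g O x) :=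
  (((hf.and hg).or (hf.not.and hg.not)).mono (by omega)).congr (by
    intro O x; cases f O x <;> cases g O x <;> rfl)

theorem const (v : Bool) : BitComp i o 1 (fun _ (_ : Bits a) => v) := by
  cases v
  · exact BitComp.false.mono (by omega)
  · exact BitComp.true

/-- A vector of bits computed bit by bit. -/
theorem pi {b : ℕ} {f : (Bits i → Bits o) → Bits a → Bits b}
    (hf : ∀ k, BitComp i o s (fun O x => f O x k)) : Comp i o (b * s) f := by
  induction b with
  | zero => exact (Comp.zero.mono (by omega)).congr fun O x => by funext k; exact k.elim0
  | succ b ih =>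
    have h1 := ih (f := fun O x k => f O x k.castSucc) (fun k => hf _)
    refine ((h1.pair (hf (Fin.last b))).mono (by rw [Nat.succ_mul])).congr fun O x => ?_
    funext k
    refine Fin.lastCases ?_ (fun k => ?_) k
    · exact Fin.append_right _ _ (0 : Fin 1)
    · exact Fin.append_left _ _ k

theorem all {b : ℕ} {f : (Bits i → Bits o) → Bits a → Bits b}
    (hf : ∀ k, BitComp i o s (fun O x => f O x k)) :
    BitComp i o (b * (s + 3) + 1) (fun O x => decide (∀ k, f O x k = Bool.true)) := by
  induction b with
  | zero => exact (BitComp.true.mono (by omega)).congr (by simp)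
  | succ b ih =>
    have h1 := ih (f := fun O x k => f O x k.succ) (fun k => hf _)
    refine (((hf 0).and h1).mono ?_).congr fun O x => ?_
    · rw [Nat.succ_mul]; omega
    · rw [Bool.eq_iff_iff]
      simp [Fin.forall_fin_succ]

end BitComp

namespace Comp

variable {i o a b c s s₁ s₂ : ℕ}

theorem const (v : Bits b) : Comp i o b (fun _ (_ : Bits a) => v) :=
  (BitComp.pi (s := 1) (f := fun _ (_ : Bits a) => v) fun k => BitComp.const (v k)).mono (by omega)

/-- Equality of two strings. -/
theorem decide_eq {f g : (Bits i → Bits o) → Bits a → Bits b} (hf : Comp i o s₁ f)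
    (hg : Comp i o s₂ g) :
    BitComp i o (s₁ + s₂ + (b * 18 + 1)) (fun O x => decide (f O x = g O x)) := by
  have h : BitComp i o (a := b + b) (b * 18 + 1) (fun _ y => decide (∀ k : Fin b,
      (y (Fin.castAdd b k) == y (Fin.natAdd b k)) = true)) :=
    BitComp.all (s := 15) (f := fun _ (y : Bits (b + b)) (k : Fin b) =>
      y (Fin.castAdd b k) == y (Fin.natAdd b k)) fun k => by
      simpa using (BitComp.bit (i := i) (o := o) (Fin.castAdd b k)).beq
        (BitComp.bit (Fin.natAdd b k))
  refine ((hf.pair hg).comp h).congr fun O x => ?_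
  funext _
  rw [Bool.eq_iff_iff]
  simp only [decide_eq_true_iff, beq_iff_eq, Fin.append_left, Fin.append_right, funext_iff]

/-- Choice between two strings. -/
theorem cond {f : (Bits i → Bits o) → Bits a → Bool} {g h : (Bits i → Bits o) → Bits a → Bits b}
    {s₃ : ℕ} (hf : BitComp i o s₁ f) (hg : Comp i o s₂ g) (hh : Comp i o s₃ h) :
    Comp i o (s₁ + (s₂ + s₃) + b * 13) (fun O x => bif f O x then g O x else h O x) := by
  have h1 : Comp i o (a := 1 + (b + b)) (b * 13) (fun _ y (k : Fin b) =>
      bif y (Fin.castAdd (b + b) 0) then y (Fin.natAdd 1 (Fin.castAdd b k))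
        else y (Fin.natAdd 1 (Fin.natAdd b k))) :=
    BitComp.pi (s := 13) fun k => by
      simpa using (BitComp.bit (i := i) (o := o) (Fin.castAdd (b + b) 0)).cond
        (BitComp.bit (Fin.natAdd 1 (Fin.castAdd b k))) (BitComp.bit (Fin.natAdd 1 (Fin.natAdd b k)))
  refine ((Comp.pair hf (hg.pair hh)).comp h1).congr fun O x => ?_
  funext k
  simp only [Fin.append_left, Fin.append_right]
  cases f O x <;> rfl

theorem comp_bit {f : (Bits i → Bits o) → Bits a → Bits b} {g : (Bits i → Bits o) → Bits b → Bool}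
    (hf : Comp i o s₁ f) (hg : BitComp i o s₂ g) :
    BitComp i o (s₁ + s₂) (fun O x => g O (f O x)) :=
  Comp.comp hf hg

end Comp

/-- For every `θ ≤ 2 ^ t` there is an easily computed predicate on `t` bits that holds for exactly
`θ` strings. The recursion follows the binary expansion of `θ`: prefixing a bit with `and` keeps
the count, prefixing it with `or` adds `2 ^ t`. -/
theorem exists_bitComp_card (t θ : ℕ) (h : θ ≤ 2 ^ t) :
    ∃ z : Bits t → Bool, (Finset.univ.filter fun x => z x = true).card = θ ∧
      ∀ i o, BitComp i o (5 * t + 1) (fun _ x => z x) := by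
  induction t generalizing θ with
  | zero =>
    refine ⟨fun _ => decide (θ = 1), ?_, fun i o => BitComp.const _⟩
    have : θ = 0 ∨ θ = 1 := by simp at h; omega
    rcases this with rfl | rfl <;> simp
  | succ t ih =>
    have count : ∀ P : Bool → Bits t → Bool,
        (Finset.univ.filter fun x : Bits (t + 1) => P (x 0) (fun k => x k.succ) = true).card =
          (Finset.univ.filter fun y => P true y = true).card +
            (Finset.univ.filter fun y => P false y = true).card := by
      intro P
      simp only [Finset.card_filter]
      rw [← (Fin.consEquiv (fun _ : Fin (t + 1) => Bool)).sum_comp, Fintype.sum_prod_type,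
        Fintype.sum_bool]
      simp [Fin.consEquiv]
    rcases le_or_gt θ (2 ^ t) with h' | h'
    · obtain ⟨z, hz, hc⟩ := ih θ h'
      refine ⟨fun x => x 0 && z (fun k => x k.succ), ?_, fun i o => ?_⟩
      · rw [count (fun b y => b && z y)]
        simpa using hz
      · exact ((BitComp.bit 0).and ((Comp.wire Fin.succ).comp_bit (hc i o))).mono (by omega)
    · obtain ⟨z, hz, hc⟩ := ih (θ - 2 ^ t) (by rw [pow_succ] at h; omega)
      refine ⟨fun x => x 0 || z (fun k => x k.succ), ?_, fun i o => ?_⟩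
      · rw [count (fun b y => b || z y)]
        simp only [Bool.true_or, Bool.false_or, hz, Finset.filter_true, Finset.card_univ]
        simp; omega
      · exact ((BitComp.bit 0).or ((Comp.wire Fin.succ).comp_bit (hc i o))).mono (by omega)

/-! ### Reversible gates from Hadamard, phase, `π/8` and controlled-not gates -/

namespace QGate

variable {N : ℕ}

/-- The action of a list of gates, the first gate being applied first. -/
noncomputable def applyList : List (QGate N) → QState N → QState N
  | [], ψ => ψ
  | g :: gs, ψ => applyList gs (g.apply ψ)

theorem applyList_append (gs gs' : List (QGate N)) (ψ : QState N) :
    applyList (gs ++ gs') ψ = applyList gs' (applyList gs ψ) := by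
  induction gs generalizing ψ with
  | nil => rfl
  | cons g gs ih => exact ih _

/-- The gates multiply every basis state `s` by `φ s`. -/
def IsDiagonal (gs : List (QGate N)) (φ : Bits N → ℂ) : Prop :=
  ∀ ψ s, applyList gs ψ s = φ s * ψ s

theorem IsDiagonal.append {gs gs' : List (QGate N)} {φ φ' : Bits N → ℂ} (h : IsDiagonal gs φ)
    (h' : IsDiagonal gs' φ') : IsDiagonal (gs ++ gs') (fun s => φ' s * φ s) := by
  intro ψ s
  rw [applyList_append, h', h, mul_assoc]

/-- Conjugation of a diagonal operation by a controlled-not gate. -/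
theorem IsDiagonal.conj_cnot {gs : List (QGate N)} {φ : Bits N → ℂ} (h : IsDiagonal gs φ)
    {c t : Fin N} (hct : c ≠ t) :
    IsDiagonal (.cnot c t hct :: gs ++ [.cnot c t hct])
      (fun s => φ (Function.update s t (xor (s t) (s c)))) := by
  intro ψ s
  rw [applyList_append]
  change applyList gs (apply (.cnot c t hct) ψ) (Function.update s t (xor (s t) (s c))) = _
  rw [h]
  simp [apply, hct]

/-- The eighth root of unity of the `π/8` gate. -/
noncomputable def omega8 : ℂ := Complex.exp (Complex.I * (Real.pi / 4 : ℝ))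

theorem omega8_pow_four : omega8 ^ 4 = -1 := by
  rw [omega8, ← Complex.exp_nat_mul, ← Complex.exp_pi_mul_I]
  congr 1
  push_cast
  ring

theorem isDiagonal_piEighth (t : Fin N) (k : ℕ) :
    IsDiagonal (List.replicate k (.piEighth t)) (fun s => if s t then omega8 ^ k else 1) := by
  induction k with
  | zero => intro ψ s; simp [applyList]
  | succ k ih =>
    intro ψ s
    rw [List.replicate_succ]
    change applyList _ (apply (.piEighth t) ψ) s = _
    rw [ih]
    simp only [apply]
    rw [← omega8]
    split_ifs <;> ring

/-- Conjugation by a Hadamard gate on `t` turns a phase flip controlled by `κ` and `t` into a bit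
flip of `t` controlled by `κ`. -/
theorem applyList_hadamard_conj {gs : List (QGate N)} {κ : Bits N → Bool} {t : Fin N}
    (hκ : ∀ s b, κ (Function.update s t b) = κ s)
    (h : IsDiagonal gs (fun s => if s t && κ s then -1 else 1)) (ψ : QState N) :
    applyList (.hadamard t :: gs ++ [.hadamard t]) ψ =
      fun s => ψ (Function.update s t (xor (s t) (κ s))) := by
  have hr : (1 / (Real.sqrt 2 : ℂ)) * (1 / (Real.sqrt 2 : ℂ)) = 1 / 2 := by
    rw [div_mul_div_comm, ← Complex.ofReal_mul, Real.mul_self_sqrt (by norm_num)]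
    norm_num
  funext s
  rw [applyList_append]
  change (1 / (Real.sqrt 2 : ℂ)) * (applyList gs (apply (.hadamard t) ψ) (Function.update s t false)
    + (if s t then -1 else 1) * applyList gs (apply (.hadamard t) ψ) (Function.update s t true)) = _
  rw [h, h]
  simp only [apply, hκ, Function.update_self, Function.update_idem]
  set r : ℂ := 1 / (Real.sqrt 2 : ℂ) with hrdef
  set u := ψ (Function.update s t false) with hu
  set v := ψ (Function.update s t true) with hv
  cases hs : s t <;> cases hk : κ s <;> simp [← hu, ← hv]
  · linear_combination 2 * u * hr
  · linear_combination 2 * v * hr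
  · linear_combination 2 * v * hr
  · linear_combination 2 * u * hr

/-- The bit flip: two phase gates between Hadamard gates. -/
theorem applyList_not (t : Fin N) (ψ : QState N) :
    applyList [.hadamard t, .phase t, .phase t, .hadamard t] ψ =
      fun s => ψ (Function.update s t (!s t)) := by
  have h : IsDiagonal [.phase t, .phase t]
      (fun s : Bits N => if s t && (fun _ => true) s then -1 else 1) := by
    intro ψ s
    simp only [applyList, apply]
    cases s t <;> simp [← mul_assoc]
  simpa using applyList_hadamard_conj (fun _ _ => rfl) h ψ

/-- A doubly controlled sign, by the identity
`4xyz = x + y + z - (x ⊕ y) - (x ⊕ z) - (y ⊕ z) + (x ⊕ y ⊕ z)`; the inverse of the `π/8` gate is its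
seventh power. -/
theorem exists_isDiagonal_ccz {x y t : Fin N} (hxy : x ≠ y) (hxt : x ≠ t) (hyt : y ≠ t) :
    ∃ gs : List (QGate N), gs.length ≤ 40 ∧
      IsDiagonal gs (fun s => if s t && (s x && s y) then -1 else 1) := by
  have d := fun k : ℕ => fun t : Fin N => isDiagonal_piEighth t k
  have h := ((((((d 1 x).append (d 1 y)).append (d 1 t)).append ((d 7 y).conj_cnot hxy)).append
    ((d 7 t).conj_cnot hxt)).append ((d 7 t).conj_cnot hyt)).append
    (((d 1 t).conj_cnot hyt).conj_cnot hxt)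
  refine ⟨_, ?_, fun ψ s => (h ψ s).trans ?_⟩
  · simp
  · have e := omega8_pow_four
    congr 1
    simp only [Function.update_self, Function.update_of_ne hyt, pow_one]
    cases s x <;> cases s y <;> cases s t <;> simp <;>
      first
      | linear_combination (omega8 ^ 12 - omega8 ^ 8 + omega8 ^ 4 - 1) * e
      | linear_combination e

theorem exists_applyList_toffoli {x y t : Fin N} (hxy : x ≠ y) (hxt : x ≠ t) (hyt : y ≠ t) :
    ∃ gs : List (QGate N), gs.length ≤ 42 ∧ ∀ ψ,
      applyList gs ψ = fun s => ψ (Function.update s t (xor (s t) (s x && s y))) := by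
  obtain ⟨gs, h1, h2⟩ := exists_isDiagonal_ccz hxy hxt hyt
  refine ⟨.hadamard t :: gs ++ [.hadamard t], by simp; omega, fun ψ => ?_⟩
  exact applyList_hadamard_conj (κ := fun s => s x && s y) (by simp [hxt, hyt]) h2 ψ

end QGate

theorem runProb_gates {N a b c d : ℕ} (O : Bits a → Bits b) (S : Bits c → Bits d)
    (E : List (Bits c) → Bits N → Prop) (gs : List (QGate N)) (ops : List (QOp N a b c d))
    (τ : List (Bits c)) (ψ : QState N) :
    runProb O S E (gs.map .gate ++ ops) τ ψ = runProb O S E ops τ (QGate.applyList gs ψ) := by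
  induction gs generalizing ψ with
  | nil => rfl
  | cons g gs ih => exact ih _

/-! ### Reversible circuits -/

/-- Operations of a reversible circuit with an oracle. The bits are numbered by natural numbers, so
that fresh bits are always at hand. -/
inductive RevOp (i o : ℕ) : Type
  | not (t : ℕ) : RevOp i o
  | cnot (c t : ℕ) : RevOp i o
  | toffoli (c c' t : ℕ) : RevOp i o
  | query (x : Fin i → ℕ) (y : Fin o → ℕ) : RevOp i o

namespace RevOp

variable {i o : ℕ}

/-- The effect on the contents of all bits. -/
def eval (g : Bits i → Bits o) : RevOp i o → (ℕ → Bool) → ℕ → Bool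
  | .not t, s => Function.update s t (!s t)
  | .cnot c t, s => Function.update s t (xor (s t) (s c))
  | .toffoli c c' t, s => Function.update s t (xor (s t) (s c && s c'))
  | .query x y, s => fun p => xor (s p) (decide (∃ j, y j = p ∧ g (fun k => s (x k)) j = true))

/-- The bits that an operation involves. -/
def Touches : RevOp i o → ℕ → Prop
  | .not t, p => p = t
  | .cnot c t, p => p = c ∨ p = t
  | .toffoli c c' t, p => p = c ∨ p = c' ∨ p = t
  | .query x y, p => (∃ k, x k = p) ∨ ∃ k, y k = p

/-- The bits involved in an operation are pairwise distinct. -/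
def Distinct : RevOp i o → Prop
  | .not _ => True
  | .cnot c t => c ≠ t
  | .toffoli c c' t => c ≠ c' ∧ c ≠ t ∧ c' ≠ t
  | .query x y => Function.Injective (Sum.elim x y)

/-- The operation can be carried out on the first `N` bits. -/
def Fits (N : ℕ) (r : RevOp i o) : Prop := r.Distinct ∧ ∀ p, r.Touches p → p < N

/-- The content of all bits after a list of operations. -/
def run (g : Bits i → Bits o) (L : List (RevOp i o)) (s : ℕ → Bool) : ℕ → Bool :=
  L.foldl (fun s r => r.eval g s) s

theorem eval_of_not_touches (g : Bits i → Bits o) {r : RevOp i o} {p : ℕ} (h : ¬ r.Touches p)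
    (s : ℕ → Bool) : r.eval g s p = s p := by
  cases r with
  | not t => exact Function.update_of_ne h _ _
  | cnot c t => exact Function.update_of_ne (fun e => h (Or.inr e)) _ _
  | toffoli c c' t => exact Function.update_of_ne (fun e => h (Or.inr (Or.inr e))) _ _
  | query x y =>
    have : ¬ ∃ j, y j = p ∧ g (fun k => s (x k)) j = true := fun ⟨j, hj, _⟩ => h (Or.inr ⟨j, hj⟩)
    simp [eval, this]

theorem eval_eval (g : Bits i → Bits o) {r : RevOp i o} (h : r.Distinct) (s : ℕ → Bool) :
    r.eval g (r.eval g s) = s := by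
  cases r with
  | not t => simp [eval]
  | cnot c t =>
    have h : c ≠ t := h
    simp [eval, h]
  | toffoli c c' t =>
    obtain ⟨_, h1, h2⟩ : c ≠ c' ∧ c ≠ t ∧ c' ≠ t := h
    simp [eval, h1, h2]
  | query x y =>
    have h : Function.Injective (Sum.elim x y) := h
    have hx : ∀ k, ¬ ∃ j, y j = x k ∧ g (fun k => s (x k)) j = true := by
      rintro k ⟨j, hj, _⟩
      have : (Sum.inr j : Fin i ⊕ Fin o) = Sum.inl k := h hj
      simp at this
    funext p
    simp [eval, hx]

theorem run_append (g : Bits i → Bits o) (L L' : List (RevOp i o)) (s : ℕ → Bool) :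
    run g (L ++ L') s = run g L' (run g L s) := List.foldl_append

theorem run_cons (g : Bits i → Bits o) (r : RevOp i o) (L : List (RevOp i o)) (s : ℕ → Bool) :
    run g (r :: L) s = run g L (r.eval g s) := rfl

theorem run_of_not_touches (g : Bits i → Bits o) {L : List (RevOp i o)} {p : ℕ}
    (h : ∀ r ∈ L, ¬ r.Touches p) (s : ℕ → Bool) : run g L s p = s p := by
  induction L generalizing s with
  | nil => rfl
  | cons r L ih =>
    rw [run_cons, ih (fun r' h' => h r' (List.mem_cons_of_mem _ h')),
      eval_of_not_touches g (h r List.mem_cons_self)]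

theorem run_reverse_run (g : Bits i → Bits o) {L : List (RevOp i o)} (h : ∀ r ∈ L, r.Distinct)
    (s : ℕ → Bool) : run g L.reverse (run g L s) = s := by
  induction L generalizing s with
  | nil => rfl
  | cons r L ih =>
    rw [List.reverse_cons, run_append, run_cons g r L, ih fun r' h' => h r' (List.mem_cons_of_mem _ h')]
    exact eval_eval g (h r List.mem_cons_self) s

/-- Flipping untouched bits commutes with a reversible circuit. -/
theorem run_xor (g : Bits i → Bits o) {L : List (RevOp i o)} {μ : ℕ → Bool}
    (h : ∀ r ∈ L, ∀ p, r.Touches p → μ p = false) (s : ℕ → Bool) :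
    run g L (fun p => xor (s p) (μ p)) = fun p => xor (run g L s p) (μ p) := by
  induction L generalizing s with
  | nil => rfl
  | cons r L ih =>
    have e : r.eval g (fun p => xor (s p) (μ p)) = fun p => xor (r.eval g s p) (μ p) := by
      have hr := h r List.mem_cons_self
      cases r with
      | not t =>
        have := hr t rfl
        funext p
        by_cases hp : p = t
        · subst hp; simp [eval, this]
        · simp [eval, hp]
      | cnot c t =>
        have h1 := hr t (Or.inr rfl)
        have h2 := hr c (Or.inl rfl)
        funext p
        by_cases hp : p = t
        · subst hp; simp [eval, h1, h2]
        · simp [eval, hp]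
      | toffoli c c' t =>
        have h1 := hr t (Or.inr (Or.inr rfl))
        have h2 := hr c (Or.inl rfl)
        have h3 := hr c' (Or.inr (Or.inl rfl))
        funext p
        by_cases hp : p = t
        · subst hp; simp [eval, h1, h2, h3]
        · simp [eval, hp]
      | query x y =>
        have h1 : ∀ k, μ (x k) = false := fun k => hr (x k) (Or.inl ⟨k, rfl⟩)
        funext p
        simp only [eval, h1, Bool.xor_false]
        rw [Bool.xor_assoc, Bool.xor_assoc, Bool.xor_comm (μ p)]
    rw [run_cons, e, ih (fun r' h' => h r' (List.mem_cons_of_mem _ h'))]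
    rfl

end RevOp

/-- The content of all bits when there are only `N` of them. -/
def extBits {N : ℕ} (s : Bits N) : ℕ → Bool := fun p => if h : p < N then s ⟨p, h⟩ else false

/-- The content of the first `N` bits. -/
def resBits (N : ℕ) (s : ℕ → Bool) : Bits N := fun k => s k

theorem resBits_extBits {N : ℕ} (s : Bits N) : resBits N (extBits s) = s := by
  funext k; simp [resBits, extBits]

theorem extBits_of_lt {N : ℕ} (s : Bits N) {p : ℕ} (h : p < N) : extBits s p = s ⟨p, h⟩ := by
  simp [extBits, h]

theorem extBits_of_le {N : ℕ} (s : Bits N) {p : ℕ} (h : N ≤ p) : extBits s p = false := by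
  simp [extBits, not_lt.2 h]

theorem extBits_resBits {N : ℕ} {s : ℕ → Bool} (h : ∀ p, N ≤ p → s p = false) :
    extBits (resBits N s) = s := by
  funext p
  simp only [extBits, resBits]
  split_ifs with hp
  · rfl
  · exact (h p (not_lt.1 hp)).symm

theorem extBits_injective {N : ℕ} : Function.Injective (extBits (N := N)) := fun s s' h => by
  rw [← resBits_extBits s, h, resBits_extBits]

namespace RevOp

variable {i o : ℕ}

theorem extBits_resBits_run (g : Bits i → Bits o) {N : ℕ} {L : List (RevOp i o)}
    (h : ∀ r ∈ L, r.Fits N) (s : Bits N) :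
    extBits (resBits N (run g L (extBits s))) = run g L (extBits s) := by
  refine extBits_resBits fun p hp => ?_
  rw [run_of_not_touches g fun r hr ht => absurd ((h r hr).2 p ht) (not_lt.2 hp)]
  simp [extBits, not_lt.2 hp]

/-- A reversible circuit as a permutation of the basis states. -/
def perm (g : Bits i → Bits o) {N : ℕ} {L : List (RevOp i o)} (h : ∀ r ∈ L, r.Fits N) :
    Equiv.Perm (Bits N) where
  toFun s := resBits N (run g L (extBits s))
  invFun s := resBits N (run g L.reverse (extBits s))
  left_inv s := by
    beta_reduce
    rw [extBits_resBits_run g h, run_reverse_run g fun r hr => (h r hr).1, resBits_extBits]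
  right_inv s := by
    have h' : ∀ r ∈ L.reverse, r.Fits N := fun r hr => h r (by simpa using hr)
    have := run_reverse_run g (fun r hr => (h' r hr).1) (extBits s)
    rw [List.reverse_reverse] at this
    beta_reduce
    rw [extBits_resBits_run g h', this, resBits_extBits]

theorem extBits_perm (g : Bits i → Bits o) {N : ℕ} {L : List (RevOp i o)}
    (h : ∀ r ∈ L, r.Fits N) (s : Bits N) : extBits (perm g h s) = run g L (extBits s) :=
  extBits_resBits_run g h s

theorem resBits_update {N : ℕ} (s : Bits N) {t : ℕ} (h : t < N) (b : Bool) :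
    resBits N (Function.update (extBits s) t b) = Function.update s ⟨t, h⟩ b := by
  funext p
  simp only [resBits, Function.update_apply, Fin.ext_iff, extBits_of_lt _ p.2]

/-- A single reversible operation as a quantum circuit. -/
theorem exists_qOps_eval {N : ℕ} (r : RevOp i o) (h : r.Fits N) :
    ∃ ops : List (QOp N i o 0 0), ops.length ≤ 42 ∧ ∀ g S E rest τ ψ,
      runProb g S E (ops ++ rest) τ ψ =
        runProb g S E rest τ (fun s => ψ (resBits N (r.eval g (extBits s)))) := by
  obtain ⟨h1, h2⟩ := h
  cases r with
  | not t =>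
    have ht : t < N := h2 t rfl
    refine ⟨List.map .gate [.hadamard ⟨t, ht⟩, .phase ⟨t, ht⟩, .phase ⟨t, ht⟩, .hadamard ⟨t, ht⟩],
      by simp, fun g S E rest τ ψ => ?_⟩
    rw [runProb_gates, QGate.applyList_not]
    congr 1
    funext s
    rw [eval, resBits_update s ht, extBits_of_lt s ht]
  | cnot c t =>
    have hct : c ≠ t := h1
    have hc : c < N := h2 c (Or.inl rfl)
    have ht : t < N := h2 t (Or.inr rfl)
    refine ⟨List.map .gate [.cnot ⟨c, hc⟩ ⟨t, ht⟩ (by simpa using hct)], by simp,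
      fun g S E rest τ ψ => ?_⟩
    rw [runProb_gates]
    simp only [QGate.applyList, QGate.apply]
    congr 1
    funext s
    rw [eval, resBits_update s ht, extBits_of_lt s ht, extBits_of_lt s hc]
  | toffoli c c' t =>
    obtain ⟨e1, e2, e3⟩ : c ≠ c' ∧ c ≠ t ∧ c' ≠ t := h1
    have hc : c < N := h2 c (Or.inl rfl)
    have hc' : c' < N := h2 c' (Or.inr (Or.inl rfl))
    have ht : t < N := h2 t (Or.inr (Or.inr rfl))
    obtain ⟨gs, hl, hgs⟩ := QGate.exists_applyList_toffoli (x := ⟨c, hc⟩) (y := ⟨c', hc'⟩)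
      (t := ⟨t, ht⟩) (by simpa using e1) (by simpa using e2) (by simpa using e3)
    refine ⟨gs.map .gate, by simpa using hl, fun g S E rest τ ψ => ?_⟩
    rw [runProb_gates, hgs]
    congr 1
    funext s
    rw [eval, resBits_update s ht, extBits_of_lt s ht, extBits_of_lt s hc, extBits_of_lt s hc']
  | query x y =>
    have hxy : Function.Injective (Sum.elim x y) := h1
    have hlt : ∀ j, Sum.elim x y j < N := by
      rintro (j | j)
      · exact h2 _ (Or.inl ⟨j, rfl⟩)
      · exact h2 _ (Or.inr ⟨j, rfl⟩)
    refine ⟨[.query ⟨fun j => ⟨Sum.elim x y j, hlt j⟩, fun j j' e => hxy (Fin.ext_iff.1 e)⟩],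
      by simp, fun g S E rest τ ψ => ?_⟩
    change runProb g S E rest τ (applyOracle g _ ψ) = _
    congr 1
    funext s
    rw [applyOracle]
    congr 1
    funext p
    have e : (fun k => extBits s (x k)) = fun k => s ⟨x k, hlt (Sum.inl k)⟩ :=
      funext fun k => extBits_of_lt s (hlt (Sum.inl k))
    simp only [xorAnswer, resBits, eval, extBits_of_lt s p.2, e, Fin.ext_iff]
    rfl

/-- A reversible circuit as a quantum circuit. -/
theorem exists_qOps {N : ℕ} (L : List (RevOp i o)) (h : ∀ r ∈ L, r.Fits N) :
    ∃ ops : List (QOp N i o 0 0), ops.length ≤ 42 * L.length ∧ ∀ g S E rest τ ψ,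
      runProb g S E (ops ++ rest) τ ψ =
        runProb g S E rest τ (fun s => ψ ((perm g h).symm s)) := by
  induction L with
  | nil =>
    refine ⟨[], by simp, fun g S E rest τ ψ => ?_⟩
    rw [List.nil_append]
    congr 1
    funext s
    congr 1
    exact (resBits_extBits s).symm
  | cons r L ih =>
    obtain ⟨ops, l1, e1⟩ := exists_qOps_eval r (h r List.mem_cons_self)
    obtain ⟨ops', l2, e2⟩ := ih fun r' h' => h r' (List.mem_cons_of_mem _ h')
    refine ⟨ops ++ ops', by simp; omega, fun g S E rest τ ψ => ?_⟩
    rw [List.append_assoc, e1, e2]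
    congr 1
    funext s
    congr 1
    refine Eq.symm ((Equiv.symm_apply_eq _).2 ?_)
    have h' : ∀ r' ∈ L, r'.Fits N := fun r' h' => h r' (List.mem_cons_of_mem _ h')
    apply extBits_injective
    have h1 : ∀ r' ∈ [r], r'.Fits N := fun r' hr' => h r' (by simp at hr'; simp [hr'])
    have e3 := extBits_resBits_run g h1 ((perm g h').symm s)
    rw [extBits_perm, run_cons]
    change extBits (resBits N (eval g r _)) = eval g r _ at e3
    rw [e3, eval_eval g (h r List.mem_cons_self).1, ← extBits_perm g h', Equiv.apply_symm_apply]

end RevOp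

namespace RevOp

variable {i o a b : ℕ}

/-- Add the bits at the positions `src` to the bits at the positions `tgt`. -/
def copy {m : ℕ} (src tgt : Fin m → ℕ) : List (RevOp i o) := List.ofFn fun j => cnot (src j) (tgt j)

theorem run_copy (g : Bits i → Bits o) {m : ℕ} {src tgt : Fin m → ℕ} (ht : Function.Injective tgt)
    (hst : ∀ j k, src j ≠ tgt k) (s : ℕ → Bool) :
    run g (copy src tgt) s = fun p => xor (s p) (decide (∃ j, tgt j = p ∧ s (src j) = true)) := by
  induction m generalizing s with
  | zero => funext p; simp [copy, run]
  | succ m ih =>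
    have e : (copy src tgt : List (RevOp i o)) = cnot (src 0) (tgt 0) ::
        copy (fun j => src j.succ) (fun j => tgt j.succ) := List.ofFn_succ
    rw [e, run_cons, ih (fun j k h => Fin.succ_injective _ (ht h)) (fun j k => hst _ _)]
    funext p
    have h1 : ∀ j : Fin m, eval g (cnot (src 0) (tgt 0)) s (src j.succ) = s (src j.succ) :=
      fun j => Function.update_of_ne (hst _ _) _ _
    simp only [h1, Fin.exists_fin_succ]
    by_cases hp : tgt 0 = p
    · subst hp
      have h2 : ∀ j : Fin m, tgt j.succ ≠ tgt 0 := fun j h => by simpa using ht h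
      simp [eval, h2]
    · simp [eval, Function.update_of_ne (Ne.symm hp), hp]

theorem length_copy {m : ℕ} (src tgt : Fin m → ℕ) :
    (copy src tgt : List (RevOp i o)).length = m := by simp [copy]

theorem copy_spec {m : ℕ} {src tgt : Fin m → ℕ} {P : ℕ → Prop} (hst : ∀ j k, src j ≠ tgt k)
    (h1 : ∀ j, P (src j)) (h2 : ∀ j, P (tgt j)) :
    ∀ r ∈ (copy src tgt : List (RevOp i o)), r.Distinct ∧ ∀ p, r.Touches p → P p := by
  intro r hr
  obtain ⟨j, rfl⟩ := (List.mem_ofFn' _ _).1 hr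
  refine ⟨hst j j, ?_⟩
  rintro p (rfl | rfl)
  · exact h1 j
  · exact h2 j

/-- A Boolean circuit made reversible: every gate first copies its operands to fresh bits, and
writes its result to fresh bits. The wires are found at the positions `pos`, the bit `z` is `false`,
and the bits from `f` on are fresh. -/
theorem exists_run_eq_wires (gs : List (ClassicalGate i)) :
    ∀ (pos : List ℕ) (z f : ℕ), z < f → (∀ p ∈ pos, p < f) →
    ∃ (L : List (RevOp i o)) (pos' : List ℕ), L.length ≤ (i + o + 4) * gs.length ∧
      (∀ p ∈ pos', p < f + (i + o + 3) * gs.length ∧ (p ∈ pos ∨ p = z ∨ f ≤ p)) ∧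
      (∀ r ∈ L, r.Distinct ∧ ∀ p, r.Touches p →
        p < f + (i + o + 3) * gs.length ∧ (p ∈ pos ∨ p = z ∨ f ≤ p)) ∧
      ∀ (g : Bits i → Bits o) (s : ℕ → Bool), s z = false → (∀ p, f ≤ p → s p = false) →
        (∀ p, p < f → run g L s p = s p) ∧
          pos'.map (run g L s) = ClassicalGate.wires g gs (pos.map s) := by
  induction gs with
  | nil =>
    intro pos z f hz hp
    exact ⟨[], pos, by simp, fun p h => ⟨by simpa using hp p h, Or.inl h⟩, by simp,
      fun g s _ _ => ⟨fun _ _ => rfl, rfl⟩⟩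
  | cons gate gs ih =>
    intro pos z f hz hp
    -- it suffices to treat the first gate, which uses the fresh bits below `f + (i + o + 3)`
    suffices h : ∃ (L : List (RevOp i o)) (new : List ℕ), L.length ≤ i + o + 4 ∧
        (∀ p ∈ new, p < f + (i + o + 3) ∧ f ≤ p) ∧
        (∀ r ∈ L, r.Distinct ∧ ∀ p, r.Touches p →
          p < f + (i + o + 3) ∧ (p ∈ pos ∨ p = z ∨ f ≤ p)) ∧
        ∀ (g : Bits i → Bits o) (s : ℕ → Bool), s z = false → (∀ p, f ≤ p → s p = false) →
          (∀ p, p < f → run g L s p = s p) ∧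
          ClassicalGate.wires g [gate] (pos.map s) = (pos ++ new).map (run g L s) by
      obtain ⟨L, new, h1, h2, h3, h4⟩ := h
      obtain ⟨L', pos', h1', h2', h3', h4'⟩ := ih (pos ++ new) z (f + (i + o + 3)) (by omega) (by
        intro p hp'
        rcases List.mem_append.1 hp' with h | h
        · have := hp p h; omega
        · exact (h2 p h).1)
      have hlen : (i + o + 3) * (gate :: gs).length = (i + o + 3) * gs.length + (i + o + 3) := by
        rw [List.length_cons, Nat.mul_succ]
      have mono : ∀ p, (p < f + (i + o + 3) + (i + o + 3) * gs.length ∧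
          (p ∈ pos ++ new ∨ p = z ∨ f + (i + o + 3) ≤ p)) →
          p < f + (i + o + 3) * (gate :: gs).length ∧ (p ∈ pos ∨ p = z ∨ f ≤ p) := by
        rintro p ⟨hlt, h⟩
        refine ⟨by omega, ?_⟩
        rcases h with h | h | h
        · rcases List.mem_append.1 h with h | h
          · exact Or.inl h
          · exact Or.inr (Or.inr (h2 p h).2)
        · exact Or.inr (Or.inl h)
        · exact Or.inr (Or.inr (by omega))
      refine ⟨L ++ L', pos', ?_, fun p hp => mono p (h2' p hp), ?_, ?_⟩
      · rw [List.length_append, List.length_cons, Nat.mul_succ]; omega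
      · intro r hr
        rcases List.mem_append.1 hr with hr | hr
        · refine ⟨(h3 r hr).1, fun p hp => ?_⟩
          obtain ⟨h5, h6⟩ := (h3 r hr).2 p hp
          exact ⟨by omega, h6⟩
        · exact ⟨(h3' r hr).1, fun p hp => mono p ((h3' r hr).2 p hp)⟩
      · intro g s hsz hs
        obtain ⟨e1, e2⟩ := h4 g s hsz hs
        obtain ⟨e1', e2'⟩ := h4' g (run g L s) (by rw [e1 z hz, hsz]) (by
          intro p hp
          rw [run_of_not_touches g fun r hr ht => ?_, hs p (by omega)]
          have := ((h3 r hr).2 p ht).1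
          omega)
        refine ⟨fun p hp => ?_, ?_⟩
        · rw [run_append, e1' p (by omega), e1 p hp]
        · rw [run_append, e2', ← e2]
          exact (ClassicalGate.wires_append g [gate] gs _).symm
    have hmem : ∀ k, pos.getD k z ∈ pos ∨ pos.getD k z = z := by
      intro k
      rw [List.getD_eq_getElem?_getD]
      rcases lt_or_ge k pos.length with h | h
      · rw [List.getElem?_eq_getElem h]; exact Or.inl (List.getElem_mem h)
      · rw [List.getElem?_eq_none h]; exact Or.inr rfl
    have hlt : ∀ k, pos.getD k z < f := by
      intro k
      rcases hmem k with h | h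
      · exact hp _ h
      · omega
    have hget : ∀ (s : ℕ → Bool), s z = false → ∀ k, (pos.map s).getD k false = s (pos.getD k z) := by
      intro s hs k
      have := List.getD_map (n := k) (d := z) (l := pos) (f := s)
      rwa [hs] at this
    cases gate with
    | nand j k =>
      refine ⟨[cnot (pos.getD j z) f, cnot (pos.getD k z) (f + 1), toffoli f (f + 1) (f + 2),
        not (f + 2)], [f + 2], by simp, by simp, ?_, ?_⟩
      · have hj := hlt j
        have hk := hlt k
        intro r hr
        simp only [List.mem_cons, List.not_mem_nil, or_false] at hr
        rcases hr with rfl | rfl | rfl | rfl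
        · refine ⟨hj.ne, ?_⟩
          rintro p (rfl | rfl)
          · exact ⟨by omega, (hmem j).imp_right Or.inl⟩
          · exact ⟨by omega, by simp⟩
        · refine ⟨(by omega : pos.getD k z ≠ f + 1), ?_⟩
          rintro p (rfl | rfl)
          · exact ⟨by omega, (hmem k).imp_right Or.inl⟩
          · exact ⟨by omega, by simp⟩
        · refine ⟨⟨by omega, by omega, by omega⟩, ?_⟩
          rintro p (rfl | rfl | rfl) <;> exact ⟨by omega, by simp⟩
        · refine ⟨trivial, ?_⟩
          rintro p rfl
          exact ⟨by omega, by simp⟩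
      · intro g s hsz hs
        have hj := hlt j
        have hk := hlt k
        have frame : ∀ p, p < f → run g [cnot (pos.getD j z) f, cnot (pos.getD k z) (f + 1),
            toffoli f (f + 1) (f + 2), not (f + 2)] s p = s p := by
          intro p hp
          have h1 : p ≠ f := by omega
          have h2 : p ≠ f + 1 := by omega
          have h3 : p ≠ f + 2 := by omega
          simp [run, eval, h1, h2, h3]
        refine ⟨frame, ?_⟩
        have hk' : pos.getD k z ≠ f := by omega
        rw [List.map_append, List.map_congr_left (fun p h => frame p (hp p h))]
        simp only [ClassicalGate.wires, hget s hsz]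
        simp [run, eval, hs f le_rfl, hs (f + 1), hs (f + 2), -List.getD_eq_getElem?_getD, hk']
    | query x =>
      have hst : ∀ (j k : Fin i), pos.getD (x j) z ≠ f + k := fun j k => by
        have := hlt (x j); omega
      have hinj : Function.Injective (fun k : Fin i => f + (k : ℕ)) := fun j k h => by
        dsimp only at h; exact Fin.ext (by omega)
      refine ⟨copy (fun k => pos.getD (x k) z) (fun k => f + k) ++
        [query (fun k => f + k) (fun k => f + i + k)], List.ofFn fun k : Fin o => f + i + k,
        by simp [length_copy]; omega, ?_, ?_, ?_⟩
      · intro p hp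
        obtain ⟨k, rfl⟩ := (List.mem_ofFn' _ _).1 hp
        dsimp only
        omega
      · intro r hr
        rcases List.mem_append.1 hr with hr | hr
        · refine copy_spec (P := fun p => p < f + (i + o + 3) ∧ (p ∈ pos ∨ p = z ∨ f ≤ p)) hst
            (fun j => ?_) (fun j => ?_) r hr
          · exact ⟨by have := hlt (x j); omega, (hmem (x j)).imp_right Or.inl⟩
          · exact ⟨by omega, by simp⟩
        · obtain rfl := List.mem_singleton.1 hr
          refine ⟨?_, ?_⟩
          · rintro (j | j) (k | k) h <;> simp at h ⊢ <;> first | exact Fin.ext (by omega) | omega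
          · rintro p (⟨k, rfl⟩ | ⟨k, rfl⟩) <;> exact ⟨by dsimp only; omega, by right; right; dsimp only; omega⟩
      · intro g s hsz hs
        have e := run_copy (o := o) g hinj hst s
        have hq : ∀ k : Fin i, run g (copy (o := o) (fun k => pos.getD (x k) z)
            (fun k : Fin i => f + (k : ℕ))) s (f + k) = s (pos.getD (x k) z) := by
          intro k
          rw [e]
          have : (∃ j : Fin i, f + (j : ℕ) = f + k ∧ s (pos.getD (x j) z) = true) ↔
              s (pos.getD (x k) z) = true :=
            ⟨fun ⟨j, h1, h2⟩ => by rwa [show j = k from Fin.ext (by omega)] at h2,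
              fun h => ⟨k, rfl, h⟩⟩
          simp only [this, hs (f + k) (by omega)]
          simp
        have frame : ∀ p, p < f → run g (copy (fun k => pos.getD (x k) z) (fun k => f + k) ++
            [query (fun k : Fin i => f + (k : ℕ)) (fun k : Fin o => f + i + k)]) s p = s p := by
          intro p hp
          have h1 : ¬ ∃ j : Fin i, f + (j : ℕ) = p ∧ s (pos.getD (x j) z) = true := by
            rintro ⟨j, h, _⟩; omega
          have h2 : ∀ u, ¬ ∃ j : Fin o, f + i + (j : ℕ) = p ∧ g u j = true := by
            rintro u ⟨j, h, _⟩; omega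
          rw [run_append, e]
          change xor (xor _ (decide _)) (decide _) = _
          simp only [h1, h2]
          simp
        refine ⟨frame, ?_⟩
        rw [List.map_append, List.map_congr_left (fun p h => frame p (hp p h))]
        simp only [ClassicalGate.wires, hget s hsz]
        congr 1
        rw [List.map_ofFn]
        congr 1
        funext k
        rw [Function.comp_apply, run_append]
        change _ = xor _ (decide _)
        simp only [hq]
        have h1 : run g (copy (o := o) (fun k => pos.getD (x k) z)
            (fun k : Fin i => f + (k : ℕ))) s (f + i + k) = false := by
          rw [e]
          have : ¬ ∃ j : Fin i, f + (j : ℕ) = f + i + k ∧ s (pos.getD (x j) z) = true := by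
            rintro ⟨j, h, _⟩; omega
          simp only [this, hs (f + i + k) (by omega)]
          rfl
        rw [h1]
        have : (∃ j : Fin o, f + i + (j : ℕ) = f + i + k ∧
            g (fun k => s (pos.getD (x k) z)) j = true) ↔
            g (fun k => s (pos.getD (x k) z)) k = true :=
          ⟨fun ⟨j, h1, h2⟩ => by rwa [show j = k from Fin.ext (by omega)] at h2,
            fun h => ⟨k, rfl, h⟩⟩
        simp only [this]
        simp

/-- A reversible circuit that leaves the output of a Boolean circuit in the bits `q`. -/
theorem exists_run_eq_eval (C : ClassicalCircuit i o a b) (src : Fin a → ℕ) (f : ℕ)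
    (hsrc : ∀ k, src k < f) :
    ∃ (L : List (RevOp i o)) (q : Fin b → ℕ), L.length ≤ (i + o + 4) * C.gates.length ∧
      (∀ k, q k < f + 1 + (i + o + 3) * C.gates.length ∧ ((∃ j, src j = q k) ∨ f ≤ q k)) ∧
      (∀ r ∈ L, r.Distinct ∧ ∀ p, r.Touches p →
        p < f + 1 + (i + o + 3) * C.gates.length ∧ ((∃ j, src j = p) ∨ f ≤ p)) ∧
      ∀ (g : Bits i → Bits o) (s : ℕ → Bool), (∀ p, f ≤ p → s p = false) →
        ∀ k, run g L s (q k) = C.eval g (fun k => s (src k)) k := by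
  -- the fresh bit `f` serves as the bit with value `false`
  obtain ⟨L, pos, h1, h2, h3, h4⟩ := exists_run_eq_wires (o := o) C.gates (List.ofFn src) f (f + 1)
    (by omega) (by
      intro p hp
      obtain ⟨k, rfl⟩ := (List.mem_ofFn' _ _).1 hp
      exact (hsrc k).trans (by omega))
  have mono : ∀ p, (p ∈ List.ofFn src ∨ p = f ∨ f + 1 ≤ p) → ((∃ j, src j = p) ∨ f ≤ p) := by
    rintro p (h | h | h)
    · exact Or.inl ((List.mem_ofFn' _ _).1 h)
    · exact Or.inr h.ge
    · exact Or.inr (by omega)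
  refine ⟨L, fun k => pos.getD (C.out k) f, h1, fun k => ?_, fun r hr => ⟨(h3 r hr).1, fun p hp =>
    ⟨((h3 r hr).2 p hp).1, mono p ((h3 r hr).2 p hp).2⟩⟩, fun g s hs k => ?_⟩
  · beta_reduce
    rw [List.getD_eq_getElem?_getD]
    rcases lt_or_ge (C.out k) pos.length with h | h
    · rw [List.getElem?_eq_getElem h]
      exact ⟨(h2 _ (List.getElem_mem h)).1, mono _ (h2 _ (List.getElem_mem h)).2⟩
    · rw [List.getElem?_eq_none h]
      exact ⟨by simp; omega, Or.inr le_rfl⟩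
  · obtain ⟨e1, e2⟩ := h4 g s (hs f le_rfl) (fun p hp => hs p (by omega))
    have := List.getD_map (n := C.out k) (d := f) (l := pos) (f := run g L s)
    rw [e1 f (by omega), hs f le_rfl] at this
    rw [← this, e2, List.map_ofFn]
    rfl

/-- A reversible circuit that adds the output of a Boolean circuit to the bits `tgt` and restores
all other bits: compute, copy the output, and undo the computation. -/
theorem exists_run_eq_xor (C : ClassicalCircuit i o a b) (src : Fin a → ℕ) (tgt : Fin b → ℕ)
    (f : ℕ) (hsrc : ∀ k, src k < f) (htgt : ∀ k, tgt k < f) (hinj : Function.Injective tgt)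
    (hst : ∀ j k, src j ≠ tgt k) :
    ∃ L : List (RevOp i o), L.length ≤ 2 * ((i + o + 4) * C.gates.length) + b ∧
      (∀ r ∈ L, r.Fits (f + 1 + (i + o + 3) * C.gates.length)) ∧
      ∀ (g : Bits i → Bits o) (s : ℕ → Bool), (∀ p, f ≤ p → s p = false) →
        run g L s = fun p =>
          xor (s p) (decide (∃ j, tgt j = p ∧ C.eval g (fun k => s (src k)) j = true)) := by
  obtain ⟨L, q, h1, h2, h3, h4⟩ := exists_run_eq_eval C src f hsrc
  have hne : ∀ p, ((∃ j, src j = p) ∨ f ≤ p) → ∀ k, p ≠ tgt k := by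
    rintro p (⟨j, rfl⟩ | h) k
    · exact hst j k
    · have := htgt k; omega
  have hqt : ∀ j k, q j ≠ tgt k := fun j => hne _ (h2 j).2
  refine ⟨L ++ copy q tgt ++ L.reverse, ?_, ?_, fun g s hs => ?_⟩
  · simp [length_copy]; omega
  · intro r hr
    simp only [List.mem_append, List.mem_reverse] at hr
    rcases hr with (hr | hr) | hr
    · exact ⟨(h3 r hr).1, fun p hp => ((h3 r hr).2 p hp).1⟩
    · exact copy_spec hqt (fun j => (h2 j).1) (fun j => (htgt j).trans_le (by omega)) r hr
    · exact ⟨(h3 r hr).1, fun p hp => ((h3 r hr).2 p hp).1⟩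
  · rw [run_append, run_append, run_copy g hinj hqt, run_xor g]
    · rw [run_reverse_run g fun r hr => (h3 r hr).1]
      simp only [h4 g s hs]
    · intro r hr p hp
      have := hne p ((h3 r (List.mem_reverse.1 hr)).2 p hp).2
      have h : ¬ ∃ j, tgt j = p ∧ run g L s (q j) = true := fun ⟨j, h, _⟩ => this j h.symm
      simp [h]

end RevOp

/-! ### Replacing the oracles of a quantum circuit by Boolean circuits -/

/-- The bits `l`, except that those from `base` on are replaced by the string `s`. -/
def placeBits (base : ℕ) {M : ℕ} (l : ℕ → Bool) (s : Bits M) : ℕ → Bool :=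
  fun p => if h : base ≤ p ∧ p < base + M then s ⟨p - base, by omega⟩ else l p

section placeBits

variable {base M : ℕ} {l : ℕ → Bool} {s : Bits M}

theorem placeBits_add (k : Fin M) : placeBits base l s (base + k) = s k := by
  simp [placeBits]

theorem placeBits_of_not {p : ℕ} (h : ¬ (base ≤ p ∧ p < base + M)) : placeBits base l s p = l p :=
  dif_neg h

theorem placeBits_update (k : Fin M) (b : Bool) :
    placeBits base l (Function.update s k b) =
      Function.update (placeBits base l s) (base + k) b := by
  funext p
  by_cases h : base ≤ p ∧ p < base + M
  · obtain ⟨k', rfl⟩ : ∃ k' : Fin M, p = base + k' := ⟨⟨p - base, by omega⟩, by simp; omega⟩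
    simp only [placeBits_add, Function.update_apply, Fin.ext_iff, Nat.add_left_cancel_iff]
  · have : p ≠ base + k := by omega
    rw [placeBits_of_not h, Function.update_of_ne this, placeBits_of_not h]

end placeBits

/-- The families `l` of bits describe the branches of a simulation of a circuit on `M` qubits: the
simulated qubits stand behind the input `x`, all bits from `f` on are fresh, and different branches
differ outside the simulated qubits. -/
structure IsLayout {nIn : ℕ} (x : Bits nIn) (M f : ℕ) {Λ : Type} (l : Λ → ℕ → Bool) : Prop where
  le : nIn + M ≤ f
  input : ∀ lam (k : Fin nIn), l lam k = x k
  fresh : ∀ lam p, f ≤ p → l lam p = false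
  off : ∀ lam p, nIn ≤ p → p < nIn + M → l lam p = false
  inj : Function.Injective l

/-- The state `ψ` is the superposition of the states `φ lam` of the simulated qubits, in the branches
`lam`. -/
structure Represents (nIn : ℕ) {N M : ℕ} {Λ : Type} (l : Λ → ℕ → Bool) (ψ : QState N)
    (φ : Λ → QState M) : Prop where
  amp : ∀ lam s, ψ (resBits N (placeBits nIn (l lam) s)) = φ lam s
  supp : ∀ t, ψ t ≠ 0 → ∃ lam, ∃ s : Bits M, extBits t = placeBits nIn (l lam) s

namespace IsLayout

variable {nIn M f N : ℕ} {x : Bits nIn} {Λ : Type} {l : Λ → ℕ → Bool}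

theorem mono {f' : ℕ} (h : IsLayout x M f l) (hf : f ≤ f') : IsLayout x M f' l where
  le := h.le.trans hf
  input := h.input
  fresh lam p hp := h.fresh lam p (hf.trans hp)
  off := h.off
  inj := h.inj

theorem placeBits_fresh (h : IsLayout x M f l) (lam : Λ) (s : Bits M) {p : ℕ} (hp : f ≤ p) :
    placeBits nIn (l lam) s p = false := by
  rw [placeBits_of_not (by have := h.le; omega), h.fresh lam p hp]

theorem extBits_resBits_placeBits (h : IsLayout x M f l) (hf : f ≤ N) (lam : Λ) (s : Bits M) :
    extBits (resBits N (placeBits nIn (l lam) s)) = placeBits nIn (l lam) s :=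
  extBits_resBits fun _ hp => h.placeBits_fresh lam s (hf.trans hp)

theorem placeBits_injective (h : IsLayout x M f l) :
    Function.Injective fun p : Λ × Bits M => placeBits nIn (l p.1) p.2 := by
  rintro ⟨lam, s⟩ ⟨lam', s'⟩ e
  dsimp only at e
  have h1 : s = s' := by
    funext k
    rw [← placeBits_add (base := nIn) (l := l lam) (s := s) k, e, placeBits_add]
  have h2 : l lam = l lam' := by
    funext p
    by_cases hp : nIn ≤ p ∧ p < nIn + M
    · rw [h.off lam p hp.1 hp.2, h.off lam' p hp.1 hp.2]
    · have := congrFun e p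
      rwa [placeBits_of_not hp, placeBits_of_not hp] at this
  rw [h1, h.inj h2]

theorem resBits_placeBits_injective (h : IsLayout x M f l) (hf : f ≤ N) :
    Function.Injective fun p : Λ × Bits M => resBits N (placeBits nIn (l p.1) p.2) := by
  intro p p' e
  apply h.placeBits_injective
  dsimp only at e ⊢
  rw [← h.extBits_resBits_placeBits hf, e, h.extBits_resBits_placeBits hf]

/-- Values of the input and of a simulated register. -/
theorem placeBits_append (h : IsLayout x M f l) (lam : Λ) (s : Bits M) {m : ℕ}
    (r : Fin m → Fin M) :
    (fun k => placeBits nIn (l lam) s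
      (Fin.append (fun j : Fin nIn => (j : ℕ)) (fun j => nIn + (r j : ℕ)) k)) =
      Fin.append x (fun j => s (r j)) := by
  funext k
  refine Fin.addCases (fun k => ?_) (fun k => ?_) k
  · rw [Fin.append_left, Fin.append_left, placeBits_of_not (by omega), h.input]
  · rw [Fin.append_right, Fin.append_right, placeBits_add]

end IsLayout

/-- Sums over all basis states reduce to sums over the branches. -/
theorem Represents.sum_eq {nIn M f N : ℕ} {x : Bits nIn} {Λ : Type} [Fintype Λ] {l : Λ → ℕ → Bool}
    {ψ : QState N} {φ : Λ → QState M} (hr : Represents nIn l ψ φ) (h : IsLayout x M f l)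
    (hf : f ≤ N) (w : Bits N → ℝ) :
    ∑ t, w t * ‖ψ t‖ ^ 2 =
      ∑ lam, ∑ s, w (resBits N (placeBits nIn (l lam) s)) * ‖φ lam s‖ ^ 2 := by
  rw [← Fintype.sum_prod_type']
  symm
  refine Fintype.sum_of_injective _ (h.resBits_placeBits_injective hf) _ _ (fun t ht => ?_)
    (fun p => ?_)
  · have : ψ t = 0 := by
      by_contra h0
      obtain ⟨lam, s, e⟩ := hr.supp t h0
      exact ht ⟨(lam, s), by dsimp only; rw [← e, resBits_extBits]⟩
    rw [this]; simp
  · rw [hr.amp]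

/-- A reversible circuit that acts on the simulated qubits as an involution. -/
theorem Represents.perm {nIn M f N i o : ℕ} {x : Bits nIn} {Λ : Type} {l : Λ → ℕ → Bool}
    {ψ : QState N} {φ : Λ → QState M} (hr : Represents nIn l ψ φ) (h : IsLayout x M f l)
    (hf : f ≤ N) (g : Bits i → Bits o) {L : List (RevOp i o)} (hL : ∀ r ∈ L, r.Fits N)
    {u : Bits M → Bits M} (hu : ∀ s, u (u s) = s)
    (e : ∀ lam s, RevOp.run g L (placeBits nIn (l lam) s) = placeBits nIn (l lam) (u s)) :
    Represents nIn l (fun t => ψ ((RevOp.perm g hL).symm t)) (fun lam s => φ lam (u s)) where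
  amp lam s := by
    rw [← hr.amp]
    congr 1
    refine (Equiv.symm_apply_eq _).2 (extBits_injective ?_)
    rw [RevOp.extBits_perm, h.extBits_resBits_placeBits hf, h.extBits_resBits_placeBits hf, e, hu]
  supp t ht := by
    obtain ⟨lam, s, h1⟩ := hr.supp _ ht
    refine ⟨lam, u s, ?_⟩
    rw [← e, ← h1, ← RevOp.extBits_perm g hL, Equiv.apply_symm_apply]

/-- The same gate on other qubits. -/
def QGate.map {M N : ℕ} (e : Fin M ↪ Fin N) : QGate M → QGate N
  | .hadamard i => .hadamard (e i)
  | .phase i => .phase (e i)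
  | .piEighth i => .piEighth (e i)
  | .cnot c t h => .cnot (e c) (e t) (fun h' => h (e.injective h'))

theorem Represents.gate {nIn M f N : ℕ} {x : Bits nIn} {Λ : Type} {l : Λ → ℕ → Bool}
    {ψ : QState N} {φ : Λ → QState M} (hr : Represents nIn l ψ φ) (h : IsLayout x M f l)
    (hf : f ≤ N) {e : Fin M ↪ Fin N} (he : ∀ k, (e k : ℕ) = nIn + k) (gate : QGate M) :
    Represents nIn l ((gate.map e).apply ψ) (fun lam => gate.apply (φ lam)) := by
  have h1 : ∀ lam s k, resBits N (placeBits nIn (l lam) s) (e k) = s k := by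
    intro lam s k
    simp only [resBits, he, placeBits_add]
  have h2 : ∀ lam s k b, Function.update (resBits N (placeBits nIn (l lam) s)) (e k) b =
      resBits N (placeBits nIn (l lam) (Function.update s k b)) := by
    intro lam s k b
    rw [placeBits_update, ← he, ← h.extBits_resBits_placeBits hf, RevOp.resBits_update _ (e k).2,
      resBits_extBits]
  -- a basis state that differs from the support in one simulated qubit is of the right form, too
  have h3 : ∀ t k b, ψ (Function.update t (e k) b) ≠ 0 →
      ∃ lam, ∃ s : Bits M, extBits t = placeBits nIn (l lam) s := by
    intro t k b ht
    obtain ⟨lam, s, h4⟩ := hr.supp _ ht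
    refine ⟨lam, Function.update s k (t (e k)), ?_⟩
    apply_fun resBits N at h4
    rw [resBits_extBits] at h4
    rw [← h.extBits_resBits_placeBits hf, ← h2, ← h4]
    simp
  cases gate with
  | hadamard i =>
    refine ⟨fun lam s => ?_, fun t ht => ?_⟩
    · simp only [QGate.map, QGate.apply, h1, h2, hr.amp]
    · by_contra hc
      have h4 := fun b => not_imp_comm.1 (h3 t i b) hc
      exact ht (by simp [QGate.map, QGate.apply, h4])
  | phase i =>
    refine ⟨fun lam s => ?_, fun t ht => ?_⟩
    · simp only [QGate.map, QGate.apply, h1, hr.amp]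
    · exact hr.supp t (right_ne_zero_of_mul ht)
  | piEighth i =>
    refine ⟨fun lam s => ?_, fun t ht => ?_⟩
    · simp only [QGate.map, QGate.apply, h1, hr.amp]
    · exact hr.supp t (right_ne_zero_of_mul ht)
  | cnot c t hct =>
    refine ⟨fun lam s => ?_, fun t' ht => ?_⟩
    · simp only [QGate.map, QGate.apply, h1, h2, hr.amp]
    · exact h3 t' t _ ht

theorem xorAnswer_xorAnswer {N a b : ℕ} (O : Bits a → Bits b) (reg : Fin a ⊕ Fin b ↪ Fin N)
    (s : Bits N) : xorAnswer O reg (xorAnswer O reg s) = s := by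
  have h : readQuery reg (xorAnswer O reg s) = readQuery reg s := by
    funext k
    simp [readQuery, xorAnswer]
  funext p
  simp only [xorAnswer] at h ⊢
  rw [h]
  simp

/-- An oracle query answered by a reversible version of a Boolean circuit. -/
theorem exists_represents_query {i o nIn a b M : ℕ} (C : ClassicalCircuit i o (nIn + a) b)
    (reg : Fin a ⊕ Fin b ↪ Fin M) (f N : ℕ) (hM : nIn + M ≤ f)
    (hN : f + 1 + (i + o + 3) * C.gates.length ≤ N) :
    ∃ ops : List (QOp N i o 0 0),
      ops.length ≤ 42 * (2 * ((i + o + 4) * C.gates.length) + b) ∧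
      ∀ (g : Bits i → Bits o) (x : Bits nIn) (Λ : Type) (l : Λ → ℕ → Bool) (ψ : QState N)
        (φ : Λ → QState M), IsLayout x M f l → Represents nIn l ψ φ →
        ∃ ψ' : QState N,
          Represents nIn l ψ'
            (fun lam => applyOracle (fun r => C.eval g (Fin.append x r)) reg (φ lam)) ∧
          ∀ S E rest τ, runProb g S E (ops ++ rest) τ ψ = runProb g S E rest τ ψ' := by
  obtain ⟨L, h1, h2, h3⟩ := RevOp.exists_run_eq_xor (o := o) C
    (Fin.append (fun j : Fin nIn => (j : ℕ)) (fun j => nIn + (reg (Sum.inl j) : ℕ)))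
    (fun j => nIn + (reg (Sum.inr j) : ℕ)) f
    (fun k => by
      refine Fin.addCases (fun k => ?_) (fun k => ?_) k
      · rw [Fin.append_left]; omega
      · rw [Fin.append_right]; omega)
    (fun k => by omega)
    (fun j k h => by
      simpa using reg.injective (Fin.ext (Nat.add_left_cancel h)))
    (fun j k => by
      refine Fin.addCases (fun j => ?_) (fun j => ?_) j
      · rw [Fin.append_left]; omega
      · rw [Fin.append_right]
        intro h
        simpa using reg.injective (Fin.ext (Nat.add_left_cancel h)))
  have hL : ∀ r ∈ L, r.Fits N := fun r hr => ⟨(h2 r hr).1, fun p hp => by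
    have := (h2 r hr).2 p hp; omega⟩
  obtain ⟨ops, h4, h5⟩ := RevOp.exists_qOps L hL
  refine ⟨ops, h4.trans (Nat.mul_le_mul_left _ h1), ?_⟩
  intro g x Λ l ψ φ hl hr
  refine ⟨_, ?_, fun S E rest τ => h5 g S E rest τ ψ⟩
  refine hr.perm hl (by omega) g hL (u := xorAnswer (fun r => C.eval g (Fin.append x r)) reg)
    (fun s => xorAnswer_xorAnswer _ _ _) (fun lam s => ?_)
  rw [h3 g _ fun p hp => hl.placeBits_fresh lam s hp, hl.placeBits_append lam s]
  funext p
  by_cases hp : nIn ≤ p ∧ p < nIn + M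
  · obtain ⟨k, rfl⟩ : ∃ k : Fin M, p = nIn + k := ⟨⟨p - nIn, by omega⟩, by simp; omega⟩
    rw [placeBits_add, placeBits_add, xorAnswer]
    simp only [Nat.add_left_cancel_iff, ← Fin.ext_iff]
    rfl
  · have : ¬ ∃ j : Fin b, nIn + (reg (Sum.inr j) : ℕ) = p ∧
        C.eval g (Fin.append x fun j => s (reg (Sum.inl j))) j = true := by
      rintro ⟨j, h, _⟩; omega
    rw [placeBits_of_not hp, placeBits_of_not hp]
    simp [this]

/-- The bits `l`, except that the string `m` has been written to the bits from `f` on. -/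
theorem IsLayout.log {nIn M f c : ℕ} {x : Bits nIn} {Λ : Type} {l : Λ → ℕ → Bool}
    (h : IsLayout x M f l) :
    IsLayout x M (f + c) (fun p : Λ × Bits c => placeBits f (l p.1) p.2) where
  le := h.le.trans (by omega)
  input p k := by
    have := h.le
    rw [placeBits_of_not (by omega), h.input]
  fresh p q hq := by
    have := h.le
    rw [placeBits_of_not (by omega), h.fresh _ _ (by omega)]
  off p q h1 h2 := by
    have := h.le
    rw [placeBits_of_not (by omega), h.off _ _ h1 h2]
  inj := by
    rintro ⟨lam, m⟩ ⟨lam', m'⟩ e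
    dsimp only at e
    have h1 : m = m' := by
      funext k
      rw [← placeBits_add (base := f) (l := l lam) (s := m) k, e, placeBits_add]
    have h2 : l lam = l lam' := by
      funext p
      by_cases hp : f ≤ p ∧ p < f + c
      · rw [h.fresh _ _ hp.1, h.fresh _ _ hp.1]
      · have := congrFun e p
        rwa [placeBits_of_not hp, placeBits_of_not hp] at this
    rw [h1, h.inj h2]

/-- Deferred measurement: copying the query register to fresh qubits splits every branch according
to the content of the register, as a measurement does. -/
theorem exists_represents_log {i o nIn c d M : ℕ} (reg : Fin c ⊕ Fin d ↪ Fin M) (f N : ℕ)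
    (hM : nIn + M ≤ f) (hN : f + c ≤ N) :
    ∃ ops : List (QOp N i o 0 0), ops.length ≤ 42 * c ∧
      ∀ (g : Bits i → Bits o) (x : Bits nIn) (Λ : Type) (l : Λ → ℕ → Bool) (ψ : QState N)
        (φ : Λ → QState M), IsLayout x M f l → Represents nIn l ψ φ →
        ∃ ψ' : QState N,
          Represents nIn (fun p : Λ × Bits c => placeBits f (l p.1) p.2) ψ'
            (fun p => projectQuery reg p.2 (φ p.1)) ∧
          ∀ S E rest τ, runProb g S E (ops ++ rest) τ ψ = runProb g S E rest τ ψ' := by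
  set src : Fin c → ℕ := fun k => nIn + (reg (Sum.inl k) : ℕ) with hsrc
  set tgt : Fin c → ℕ := fun k => f + (k : ℕ) with htgt
  have hst : ∀ j k, src j ≠ tgt k := fun j k => by simp only [hsrc, htgt]; omega
  have hinj : Function.Injective tgt := fun j k h => by
    simp only [htgt] at h; exact Fin.ext (by omega)
  have hL : ∀ r ∈ (RevOp.copy src tgt : List (RevOp i o)), r.Fits N :=
    RevOp.copy_spec hst (fun j => by simp only [hsrc]; omega) (fun j => by simp only [htgt]; omega)
  obtain ⟨ops, h4, h5⟩ := RevOp.exists_qOps _ hL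
  refine ⟨ops, h4.trans (by rw [RevOp.length_copy]), ?_⟩
  intro g x Λ l ψ φ hl hr
  refine ⟨_, ?_, fun S E rest τ => h5 g S E rest τ ψ⟩
  have hl' := hl.log (c := c)
  -- the effect of the copy on a branch with an arbitrary log
  have key : ∀ lam (m : Bits c) s,
      RevOp.run g (RevOp.copy src tgt) (placeBits nIn (placeBits f (l lam) m) s) =
        placeBits nIn (placeBits f (l lam) fun k => xor (m k) (readQuery reg s k)) s := by
    intro lam m s
    rw [RevOp.run_copy g hinj hst]
    funext p
    have h1 : ∀ j, placeBits nIn (placeBits f (l lam) m) s (src j) = readQuery reg s j :=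
      fun j => placeBits_add _
    simp only [h1]
    by_cases hp : f ≤ p ∧ p < f + c
    · obtain ⟨k, rfl⟩ : ∃ k : Fin c, p = f + k := ⟨⟨p - f, by omega⟩, by simp; omega⟩
      have h2 : (∃ j, tgt j = f + k ∧ readQuery reg s j = true) ↔ readQuery reg s k = true :=
        ⟨fun ⟨j, h1, h2⟩ => by rwa [hinj (a₁ := j) (a₂ := k) h1] at h2, fun h => ⟨k, rfl, h⟩⟩
      rw [placeBits_of_not (base := nIn) (M := M) (p := f + k) (by omega),
        placeBits_of_not (base := nIn) (M := M) (p := f + k) (by omega), placeBits_add,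
        placeBits_add]
      simp only [h2]
      simp
    · have h2 : ¬ ∃ j, tgt j = p ∧ readQuery reg s j = true := by
        rintro ⟨j, h, _⟩; simp only [htgt] at h; omega
      simp only [h2]
      simp only [placeBits, hp]
      simp
  have zero : ∀ lam, placeBits f (l lam) (fun _ : Fin c => false) = l lam := by
    intro lam
    funext p
    by_cases hp : f ≤ p ∧ p < f + c
    · simp [placeBits, hl.fresh lam p hp.1]
    · rw [placeBits_of_not hp]
  constructor
  · rintro ⟨lam, m⟩ s
    have e : (RevOp.perm g hL).symm (resBits N (placeBits nIn (placeBits f (l lam) m) s)) =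
        resBits N (placeBits nIn (placeBits f (l lam) fun k => xor (m k) (readQuery reg s k)) s) := by
      refine (Equiv.symm_apply_eq _).2 (extBits_injective ?_)
      rw [RevOp.extBits_perm, hl'.extBits_resBits_placeBits hN (lam, m) s,
        hl'.extBits_resBits_placeBits hN (lam, fun k => xor (m k) (readQuery reg s k)) s, key]
      simp
    dsimp only
    rw [e, projectQuery]
    split_ifs with hm
    · have : (fun k => xor (m k) (readQuery reg s k)) = fun _ => false := by
        funext k; rw [hm]; simp
      rw [this, zero, hr.amp]
    · by_contra h0
      obtain ⟨lam', s', h6⟩ := hr.supp _ h0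
      rw [hl'.extBits_resBits_placeBits hN (lam, fun k => xor (m k) (readQuery reg s k)) s,
        ← zero lam'] at h6
      have h7 := hl'.placeBits_injective (a₁ := ((lam, fun k => xor (m k) (readQuery reg s k)), s))
        (a₂ := ((lam', fun _ => false), s')) h6
      simp only [Prod.mk.injEq] at h7
      refine hm ?_
      funext k
      have := congrFun h7.1.2 k
      revert this
      cases m k <;> cases readQuery reg s k <;> simp
  · intro t ht
    obtain ⟨lam, s, h6⟩ := hr.supp _ ht
    refine ⟨(lam, readQuery reg s), s, ?_⟩
    have h7 := key lam (fun _ => false) s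
    rw [zero, ← h6, ← RevOp.extBits_perm g hL, Equiv.apply_symm_apply] at h7
    rw [h7]
    simp

/-- The operations of a circuit with oracles computed by Boolean circuits, simulated with a single
quantum oracle. The number of fresh qubits in use grows with every classical query. The
probabilities of the simulated circuit arise in the sum over the branches at the end, whatever
operations `rest` realise the final measurement. -/
theorem exists_simulation {i o nIn a b c d M : ℕ} (CO : ClassicalCircuit i o (nIn + a) b)
    (CS : ClassicalCircuit i o (nIn + c) d) (N : ℕ) (ops : List (QOp M a b c d)) :
    ∀ f : ℕ, nIn + M ≤ f →
    f + c * ops.length + 1 + (i + o + 3) * (CO.gates.length + CS.gates.length) ≤ N →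
    ∃ ops' : List (QOp N i o 0 0), ops'.length ≤ 42 * (2 * ((i + o + 4) *
        (CO.gates.length + CS.gates.length)) + b + c + d + 1) * ops.length ∧
      ∀ (g : Bits i → Bits o) (S : Bits 0 → Bits 0) (E : Bits M → Prop)
        (E' : List (Bits 0) → Bits N → Prop) (x : Bits nIn) (rest : List (QOp N i o 0 0))
        (τ' : List (Bits 0)),
        (∀ (Λ : Type) (_ : Fintype Λ) (l : Λ → ℕ → Bool) (ψ : QState N) (φ : Λ → QState M),
          IsLayout x M (f + c * ops.length) l → Represents nIn l ψ φ →
            runProb g S E' rest τ' ψ = ∑ lam, ∑ s, ind (E s) * ‖φ lam s‖ ^ 2) →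
        ∀ (Λ : Type) (_ : Fintype Λ) (l : Λ → ℕ → Bool) (ψ : QState N) (φ : Λ → QState M)
          (τ : List (Bits c)),
          IsLayout x M f l → Represents nIn l ψ φ →
            runProb g S E' (ops' ++ rest) τ' ψ = ∑ lam, runProb
              (fun r => CO.eval g (Fin.append x r)) (fun r => CS.eval g (Fin.append x r))
              (fun _ s => E s) ops τ (φ lam) := by
  induction ops with
  | nil =>
    intro f hM hN
    refine ⟨[], by simp, fun g S E E' x rest τ' hrest Λ _ l ψ φ τ hl hr => ?_⟩
    exact hrest Λ _ l ψ φ hl hr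
  | cons op ops ih =>
    intro f hM hN
    have hlen : c * (op :: ops).length = c * ops.length + c := by
      rw [List.length_cons, Nat.mul_succ]
    have hK : ∀ {T n m : ℕ}, n ≤ T → m ≤ T * ops.length → n + m ≤ T * (op :: ops).length := by
      intro T n m h1 h2
      rw [List.length_cons, Nat.mul_succ]; omega
    rw [Nat.mul_add] at hN
    cases op with
    | gate gt =>
      obtain ⟨ops', h1, h2⟩ := ih f hM (by rw [Nat.mul_add]; omega)
      have hlt : ∀ k : Fin M, nIn + (k : ℕ) < N := fun k => by omega
      refine ⟨.gate (gt.map ⟨fun k => ⟨nIn + k, hlt k⟩, fun k k' h => by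
        simpa [Fin.ext_iff] using h⟩) :: ops', ?_, ?_⟩
      · rw [List.length_cons (as := ops'), Nat.add_comm]
        exact hK (by omega) h1
      intro g S E E' x rest τ' hrest Λ _ l ψ φ τ hl hr
      exact h2 g S E E' x rest τ' (fun Λ _ l ψ φ hl hr => hrest Λ _ l ψ φ (hl.mono (by omega)) hr)
        Λ _ l _ (fun lam => gt.apply (φ lam)) τ hl (hr.gate hl (by omega) (fun k => rfl) gt)
    | query reg =>
      obtain ⟨ops', h1, h2⟩ := ih f hM (by rw [Nat.mul_add]; omega)
      obtain ⟨ops₁, h3, h4⟩ := exists_represents_query CO reg f N hM (by omega)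
      refine ⟨ops₁ ++ ops', ?_, ?_⟩
      · rw [List.length_append]
        exact hK (h3.trans (Nat.mul_le_mul_left _ (by rw [Nat.mul_add (i + o + 4)]; omega))) h1
      intro g S E E' x rest τ' hrest Λ _ l ψ φ τ hl hr
      obtain ⟨ψ', h5, h6⟩ := h4 g x Λ l ψ φ hl hr
      rw [List.append_assoc, h6]
      exact h2 g S E E' x rest τ' (fun Λ _ l ψ φ hl hr => hrest Λ _ l ψ φ (hl.mono (by omega)) hr)
        Λ _ l ψ' _ τ hl h5
    | classicalQuery reg =>
      obtain ⟨ops', h1, h2⟩ := ih (f + c) (by omega) (by rw [Nat.mul_add]; omega)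
      obtain ⟨ops₀, h7, h8⟩ := exists_represents_log (i := i) (o := o) reg f N hM (by omega)
      obtain ⟨ops₁, h3, h4⟩ := exists_represents_query CS reg (f + c) N (by omega) (by omega)
      refine ⟨ops₀ ++ (ops₁ ++ ops'), ?_, ?_⟩
      · rw [List.length_append, List.length_append, ← Nat.add_assoc]
        refine hK ((Nat.add_le_add h7 h3).trans ?_) h1
        rw [← Nat.mul_add]
        exact Nat.mul_le_mul_left _ (by rw [Nat.mul_add (i + o + 4)]; omega)
      intro g S E E' x rest τ' hrest Λ _ l ψ φ τ hl hr
      obtain ⟨ψ₀, h9, h10⟩ := h8 g x Λ l ψ φ hl hr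
      obtain ⟨ψ', h5, h6⟩ := h4 g x (Λ × Bits c) _ ψ₀ _ hl.log h9
      rw [List.append_assoc, List.append_assoc, h10, h6]
      -- the transcript of the simulated circuit plays no role for the event `E`
      have hτ : ∀ (ops : List (QOp M a b c d)) (τ₁ τ₂ : List (Bits c)) (ψ : QState M),
          runProb (fun r => CO.eval g (Fin.append x r)) (fun r => CS.eval g (Fin.append x r))
            (fun _ s => E s) ops τ₁ ψ =
          runProb (fun r => CO.eval g (Fin.append x r)) (fun r => CS.eval g (Fin.append x r))
            (fun _ s => E s) ops τ₂ ψ := by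
        intro ops
        induction ops with
        | nil => intro _ _ _; rfl
        | cons op ops ih =>
          intro τ₁ τ₂ ψ
          cases op with
          | gate gt => exact ih _ _ _
          | query reg => exact ih _ _ _
          | classicalQuery reg => exact Finset.sum_congr rfl fun m _ => ih _ _ _
      rw [h2 g S E E' x rest τ' (fun Λ _ l ψ φ hl hr => hrest Λ _ l ψ φ (hl.mono (by omega)) hr)
        (Λ × Bits c) inferInstance _ ψ' _ τ hl.log h5, Fintype.sum_prod_type]
      refine Finset.sum_congr rfl fun lam _ => Finset.sum_congr rfl fun m _ => hτ _ _ _ _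

/-- The initial state, after the input has been copied to the simulated qubits. -/
theorem exists_represents_init {i o : ℕ} (nIn M N : ℕ) (hN : nIn + M ≤ N) :
    ∃ ops : List (QOp N i o 0 0), ops.length ≤ 42 * M ∧
      ∀ (g : Bits i → Bits o) (x : Bits nIn), ∃ (l : Unit → ℕ → Bool) (ψ' : QState N),
        IsLayout x M (nIn + M) l ∧
        Represents nIn l ψ' (fun _ => QCircuit.initState M x) ∧
          ∀ S E rest τ, runProb g S E (ops ++ rest) τ (QCircuit.initState N x) =
            runProb g S E rest τ ψ' := by
  set src : Fin (min nIn M) → ℕ := fun k => k with hsrc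
  set tgt : Fin (min nIn M) → ℕ := fun k => nIn + k with htgt
  have hst : ∀ j k, src j ≠ tgt k := fun j k => by simp only [hsrc, htgt]; omega
  have hinj : Function.Injective tgt := fun j k h => by
    simp only [htgt] at h; exact Fin.ext (by omega)
  have hL : ∀ r ∈ (RevOp.copy src tgt : List (RevOp i o)), r.Fits N :=
    RevOp.copy_spec hst (fun j => by simp only [hsrc]; omega) (fun j => by simp only [htgt]; omega)
  obtain ⟨ops, h4, h5⟩ := RevOp.exists_qOps _ hL
  refine ⟨ops, h4.trans (by rw [RevOp.length_copy]; omega), fun g x => ?_⟩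
  have hl : IsLayout x M (nIn + M) (fun _ : Unit => extBits x) := by
    refine ⟨le_rfl, fun _ k => ?_, fun _ p hp => ?_, fun _ p h1 h2 => ?_, fun _ _ _ => rfl⟩
    · exact extBits_of_lt x k.2
    · exact extBits_of_le x (by omega)
    · exact extBits_of_le x h1
  -- the basis states on which the two initial states are concentrated
  set t₀ : Bits N := fun k => if h : k.val < nIn then x ⟨k.val, h⟩ else false with ht₀
  set s₀ : Bits M := fun k => if h : k.val < nIn then x ⟨k.val, h⟩ else false with hs₀
  have e₀ : extBits t₀ = extBits x := by
    funext p
    by_cases hp : p < nIn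
    · rw [extBits_of_lt t₀ (by omega), extBits_of_lt x hp, ht₀]
      simp [hp]
    · rw [extBits_of_le x (by omega)]
      by_cases hp' : p < N
      · rw [extBits_of_lt t₀ hp', ht₀]
        simp [hp]
      · exact extBits_of_le t₀ (by omega)
  have key : extBits (RevOp.perm g hL t₀) = placeBits nIn (extBits x) s₀ := by
    rw [RevOp.extBits_perm, RevOp.run_copy g hinj hst, e₀]
    funext p
    by_cases hp : nIn ≤ p ∧ p < nIn + M
    · obtain ⟨k, rfl⟩ : ∃ k : Fin M, p = nIn + k := ⟨⟨p - nIn, by omega⟩, by simp; omega⟩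
      rw [placeBits_add, extBits_of_le x (by omega), hs₀]
      by_cases hk : k.val < nIn
      · have h2 : (∃ j, tgt j = nIn + k ∧ extBits x (src j) = true) ↔ x ⟨k, hk⟩ = true := by
          refine ⟨fun ⟨j, h1, h2⟩ => ?_, fun h => ⟨⟨k, by omega⟩, rfl, ?_⟩⟩
          · simp only [htgt, Nat.add_left_cancel_iff] at h1
            simp only [hsrc, h1] at h2
            rwa [extBits_of_lt x hk] at h2
          · simp only [hsrc]
            rwa [extBits_of_lt x hk]
        simp [h2, hk]
      · have h2 : ¬ ∃ j, tgt j = nIn + k ∧ extBits x (src j) = true := by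
          rintro ⟨j, h, _⟩
          simp only [htgt] at h
          have := j.2
          omega
        simp [h2, hk]
    · have h2 : ¬ ∃ j, tgt j = p ∧ extBits x (src j) = true := by
        rintro ⟨j, h, _⟩
        simp only [htgt] at h
        have := j.2
        omega
      rw [placeBits_of_not hp]
      simp [h2]
  refine ⟨_, _, hl, ?_, fun S E rest τ => h5 g S E rest τ _⟩
  constructor
  · intro _ s
    have : (RevOp.perm g hL).symm (resBits N (placeBits nIn (extBits x) s)) = t₀ ↔ s = s₀ := by
      rw [Equiv.symm_apply_eq]
      constructor
      · intro h
        have h' := congrArg extBits h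
        rw [key, hl.extBits_resBits_placeBits hN ()] at h'
        exact congrArg Prod.snd (hl.placeBits_injective (a₁ := ((), s)) (a₂ := ((), s₀)) h')
      · rintro rfl
        apply extBits_injective
        rw [key, hl.extBits_resBits_placeBits hN ()]
    simp only [QCircuit.initState]
    rw [← ht₀, ← hs₀]
    simp only [this]
  · intro t ht
    refine ⟨(), s₀, ?_⟩
    have : (RevOp.perm g hL).symm t = t₀ := by
      by_contra h
      exact ht (if_neg h)
    rw [Equiv.symm_apply_eq] at this
    rw [this, key]

/-- Replacing oracles: a quantum circuit whose quantum and classical oracles, and whose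
postprocessing, are computed by Boolean circuits from its input and from an oracle `g`, becomes a
quantum circuit of polynomial size with `g` as its only oracle. -/
theorem QCircuit.exists_simulation {i o nIn a b c d k k' : ℕ} (A : QCircuit a b c d k)
    (CO : ClassicalCircuit i o (nIn + a) b) (CS : ClassicalCircuit i o (nIn + c) d)
    (CP : ClassicalCircuit i o (nIn + k) k') :
    ∃ B : QCircuit i o 0 0 k', B.size ≤ 1000 * (A.size + CO.size + CS.size + CP.size + 1) ^ 3 ∧
      ∀ (g : Bits i → Bits o) (x : Bits nIn) (E : Bits k' → Prop),
        B.prob g noOracle x (fun _ y => E y) =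
          A.prob (fun r => CO.eval g (Fin.append x r)) (fun r => CS.eval g (Fin.append x r)) x
            (fun _ y => E (CP.eval g (Fin.append x y))) := by
  set M := A.qubits with hMdef
  set f := nIn + M + c * A.ops.length with hf
  obtain ⟨L, q, h1, h2, h3, h4⟩ := RevOp.exists_run_eq_eval CP
    (Fin.append (fun j : Fin nIn => (j : ℕ)) (fun j => nIn + (A.out j : ℕ))) f (fun j => by
      refine Fin.addCases (fun j => ?_) (fun j => ?_) j
      · rw [Fin.append_left]; omega
      · rw [Fin.append_right]; omega)
  set N := f + 1 + (i + o + 3) * (CO.gates.length + CS.gates.length) +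
    (i + o + 3) * CP.gates.length with hN
  have hL : ∀ r ∈ L, r.Fits N := fun r hr => ⟨(h3 r hr).1, fun p hp => by
    have := ((h3 r hr).2 p hp).1; omega⟩
  have hq : ∀ j, q j < N := fun j => by have := (h2 j).1; omega
  obtain ⟨ops₀, h5, h6⟩ := exists_represents_init (i := i) (o := o) nIn M N (by omega)
  obtain ⟨ops₁, h7, h8⟩ := _root_.exists_simulation CO CS N A.ops (nIn + M) le_rfl (by omega)
  obtain ⟨ops₂, h9, h10⟩ := RevOp.exists_qOps L hL
  refine ⟨⟨N, ops₀ ++ (ops₁ ++ ops₂), fun j => ⟨q j, hq j⟩⟩, ?_, fun g x E => ?_⟩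
  · set u := A.size + CO.size + CS.size + CP.size + 1 with hu
    simp only [QCircuit.size, ClassicalCircuit.size] at hu
    simp only [QCircuit.size, List.length_append]
    have t1 : c * A.ops.length ≤ u * u := Nat.mul_le_mul (by omega) (by omega)
    have t2 : (i + o + 4) * (CO.gates.length + CS.gates.length) ≤ 4 * u * u :=
      Nat.mul_le_mul (by omega) (by omega)
    have t3 : (i + o + 4) * CP.gates.length ≤ 4 * u * u := Nat.mul_le_mul (by omega) (by omega)
    have t4 : 42 * (2 * ((i + o + 4) * (CO.gates.length + CS.gates.length)) + b + c + d + 1) *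
        A.ops.length ≤ 42 * (2 * (4 * u * u) + u) * u :=
      Nat.mul_le_mul (Nat.mul_le_mul_left _ (by omega)) (by omega)
    have t5 : (i + o + 3) * (CO.gates.length + CS.gates.length) ≤ 4 * u * u :=
      (Nat.mul_le_mul_right _ (by omega)).trans t2
    have t6 : (i + o + 3) * CP.gates.length ≤ 4 * u * u :=
      (Nat.mul_le_mul_right _ (by omega)).trans t3
    have u1 : u * u ≤ u ^ 3 := by
      rw [← pow_two]; exact Nat.pow_le_pow_right (by omega) (by omega)
    have u2 : u ≤ u ^ 3 := Nat.le_self_pow (by omega) u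
    have u3 : 42 * (2 * (4 * u * u) + u) * u = 336 * u ^ 3 + 42 * (u * u) := by ring
    have u4 : 4 * u * u = 4 * (u * u) := by ring
    omega
  · obtain ⟨l, ψ, hl, hr, e⟩ := h6 g x
    unfold QCircuit.prob
    dsimp only
    rw [e]
    have hrest : ∀ (Λ : Type) (_ : Fintype Λ) (l : Λ → ℕ → Bool) (ψ : QState N) (φ : Λ → QState M),
        IsLayout x M f l → Represents nIn l ψ φ →
          runProb g noOracle (fun _ s => E fun j => s ⟨q j, hq j⟩) ops₂ [] ψ =
            ∑ lam, ∑ s, ind (E (CP.eval g (Fin.append x fun j => s (A.out j)))) *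
              ‖φ lam s‖ ^ 2 := by
      intro Λ _ l ψ φ hl hr
      have := h10 g noOracle (fun _ s => E fun j => s ⟨q j, hq j⟩) [] [] ψ
      rw [List.append_nil] at this
      rw [this, runProb, ← Equiv.sum_comp (RevOp.perm g hL)]
      simp only [Equiv.symm_apply_apply]
      rw [hr.sum_eq hl (by omega) fun t => ind (E fun j => RevOp.perm g hL t ⟨q j, hq j⟩)]
      refine Finset.sum_congr rfl fun lam _ => Finset.sum_congr rfl fun s _ => ?_
      congr 4
      funext j
      rw [← extBits_of_lt (RevOp.perm g hL _) (hq j), RevOp.extBits_perm,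
        hl.extBits_resBits_placeBits (by omega), h4 g _ fun p hp => hl.placeBits_fresh lam s hp,
        hl.placeBits_append]
    rw [h8 g noOracle (fun s => E (CP.eval g (Fin.append x fun j => s (A.out j)))) _ x ops₂ []
      hrest Unit inferInstance l ψ _ [] hl hr]
    exact Fintype.sum_unique _

/-- The input of a quantum circuit can be built into the circuit, by bit flips. -/
theorem QCircuit.exists_hardwired {i o nIn k : ℕ} (A : QCircuit i o 0 0 k) (x : Bits nIn) :
    ∃ B : QCircuit i o 0 0 k, B.size ≤ 43 * A.size ∧ ∀ g S E,
      B.prob g S (nIn := 0) Fin.elim0 E = A.prob g S x E := by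
  have h : ∀ m ≤ A.qubits, ∃ L : List (RevOp i o), L.length ≤ m ∧ (∀ r ∈ L, r.Fits A.qubits) ∧
      ∀ g, RevOp.run g L (fun _ => false) = fun p => decide (p < m) && extBits x p := by
    intro m
    induction m with
    | zero => intro _; exact ⟨[], le_rfl, by simp, fun g => by funext p; simp [RevOp.run]⟩
    | succ m ih =>
      intro hm
      obtain ⟨L, h1, h2, h3⟩ := ih (by omega)
      refine ⟨L ++ if extBits x m then [.not m] else [], ?_, ?_, fun g => ?_⟩
      · split_ifs <;> simp <;> omega
      · intro r hr
        rcases List.mem_append.1 hr with hr | hr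
        · exact h2 r hr
        · split_ifs at hr
          · obtain rfl := List.mem_singleton.1 hr
            exact ⟨trivial, fun p hp => by have : p = m := hp; omega⟩
          · simp at hr
      · rw [RevOp.run_append, h3]
        funext p
        by_cases hp : p = m
        · subst hp
          split_ifs with hx <;> simp [RevOp.run, RevOp.eval, hx]
        · have h4 : (p < m + 1) ↔ p < m := by omega
          split_ifs with hx <;> simp [RevOp.run, RevOp.eval, hp, h4]
  obtain ⟨L, h1, h2, h3⟩ := h A.qubits le_rfl
  obtain ⟨ops, h4, h5⟩ := RevOp.exists_qOps L h2
  refine ⟨⟨A.qubits, ops ++ A.ops, A.out⟩, ?_, fun g S E => ?_⟩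
  · simp only [QCircuit.size, List.length_append]; omega
  · unfold QCircuit.prob
    dsimp only
    rw [h5]
    congr 1
    funext s
    have e : (RevOp.perm g h2).symm s = (fun _ => false) ↔
        s = fun j : Fin A.qubits => if h : j.val < nIn then x ⟨j.val, h⟩ else false := by
      rw [Equiv.symm_apply_eq]
      have : RevOp.perm g h2 (fun _ => false) =
          fun j : Fin A.qubits => if h : j.val < nIn then x ⟨j.val, h⟩ else false := by
        have h0 : extBits (fun _ : Fin A.qubits => false) = fun _ => false := by
          funext p; simp [extBits]
        apply extBits_injective
        rw [RevOp.extBits_perm, h0, h3]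
        funext p
        by_cases hp : p < A.qubits
        · rw [extBits_of_lt _ hp]; simp [hp, extBits]
        · rw [extBits_of_le _ (not_lt.1 hp)]; simp [hp]
      rw [this]
    simp only [initState, Nat.not_lt_zero, dite_false, e]

/-! ### Averages over programmed random oracles -/

theorem ind_of_true {P : Prop} (h : P) : ind P = 1 := if_pos h

theorem ind_of_false {P : Prop} (h : ¬ P) : ind P = 0 := if_neg h

theorem ind_nonneg (P : Prop) : 0 ≤ ind P := by
  by_cases h : P
  · rw [ind_of_true h]; norm_num
  · rw [ind_of_false h]

theorem ind_le_one (P : Prop) : ind P ≤ 1 := by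
  by_cases h : P
  · rw [ind_of_true h]
  · rw [ind_of_false h]; norm_num

theorem ind_mono {P Q : Prop} (h : P → Q) : ind P ≤ ind Q := by
  by_cases hP : P
  · rw [ind_of_true hP, ind_of_true (h hP)]
  · rw [ind_of_false hP]; exact ind_nonneg Q

theorem ind_and (P Q : Prop) : ind (P ∧ Q) = ind P * ind Q := by
  by_cases hP : P
  · by_cases hQ : Q
    · rw [ind_of_true hP, ind_of_true hQ, ind_of_true ⟨hP, hQ⟩, mul_one]
    · rw [ind_of_false hQ, ind_of_false fun h => hQ h.2, mul_zero]
  · rw [ind_of_false hP, ind_of_false fun h => hP h.1, zero_mul]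

theorem ind_not (P : Prop) : ind (¬ P) = 1 - ind P := by
  by_cases hP : P
  · rw [ind_of_true hP, ind_of_false fun h => h hP, sub_self]
  · rw [ind_of_false hP, ind_of_true hP, sub_zero]

theorem ind_forall_mem {X : Type*} [Fintype X] (T : Finset X) (P : X → Prop) :
    ind (∀ x ∈ T, P x) = ∏ x, ind (x ∈ T → P x) := by
  by_cases h : ∀ x ∈ T, P x
  · rw [ind_of_true h]
    exact (Finset.prod_eq_one fun x _ => ind_of_true (h x)).symm
  · rw [ind_of_false h]
    push Not at h
    obtain ⟨x, hx, hP⟩ := h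
    exact (Finset.prod_eq_zero (Finset.mem_univ x) (ind_of_false fun h => hP (h hx))).symm

section Expect

variable {X Y D C : Type*} [Fintype X] [Fintype Y] [Fintype D] [Fintype C]

theorem expect_prod (f : X × Y → ℝ) : 𝔼 p, f p = 𝔼 x, 𝔼 y, f (x, y) := by
  rw [← Finset.univ_product_univ, Finset.expect_product]

theorem expect_mono {f g : X → ℝ} (h : ∀ x, f x ≤ g x) : 𝔼 x, f x ≤ 𝔼 x, g x :=
  Finset.expect_le_expect fun x _ => h x

theorem expect_const' [Nonempty X] (c : ℝ) : 𝔼 _x : X, c = c := Fintype.expect_const c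

/-- The values of a random function are independent. -/
theorem expect_prod_apply [DecidableEq X] (w : X → C → ℝ) :
    𝔼 c : X → C, ∏ x, w x (c x) = ∏ x, 𝔼 y, w x y := by
  simp only [Fintype.expect_eq_sum_div_card]
  rw [Finset.prod_div_distrib, Finset.prod_univ_sum]
  simp

/-- If every point `x` is sent to `f₂ a` or `f₁ a`, according to a coin, with random `a`, the
resulting function is a uniformly random function that is independent of the coins. -/
theorem expect_programmed [DecidableEq X] {f₁ f₂ : D → D} (h₁ : Function.Injective f₁)
    (h₂ : Function.Injective f₂) (z : C → Bool) (Φ : (X → D) → (X → C) → ℝ) :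
    𝔼 u : X → D × C, Φ (fun x => bif z (u x).2 then f₂ (u x).1 else f₁ (u x).1)
      (fun x => (u x).2) = 𝔼 H : X → D, 𝔼 c : X → C, Φ H c := by
  rw [← expect_prod (fun p : (X → D) × (X → C) => Φ p.1 p.2)]
  refine Fintype.expect_bijective (fun u => (fun x => bif z (u x).2 then f₂ (u x).1 else f₁ (u x).1,
    fun x => (u x).2)) ?_ _ _ fun _ => rfl
  constructor
  · intro u u' h
    simp only [Prod.mk.injEq] at h
    funext x
    have e2 := congrFun h.2 x
    have e1 := congrFun h.1 x
    rw [e2] at e1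
    refine Prod.ext ?_ e2
    cases hz : z (u' x).2 <;> rw [hz] at e1
    · exact h₁ e1
    · exact h₂ e1
  · rintro ⟨H, c⟩
    have s₁ := Finite.surjective_of_injective h₁
    have s₂ := Finite.surjective_of_injective h₂
    refine ⟨fun x => (bif z (c x) then Function.surjInv s₂ (H x) else Function.surjInv s₁ (H x),
      c x), ?_⟩
    refine Prod.ext (funext fun x => ?_) rfl
    change (bif z (c x) then f₂ (bif z (c x) then _ else _) else f₁ (bif z (c x) then _ else _)) = _
    cases z (c x)
    · exact Function.surjInv_eq s₁ _
    · exact Function.surjInv_eq s₂ _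

variable [Nonempty C]

/-- The probability that random coins do not have the property `z` at the points of `T`. -/
theorem expect_ind_forall_not [DecidableEq X] (z : C → Prop) (T : Finset X) :
    𝔼 c : X → C, ind (∀ x ∈ T, ¬ z (c x)) = (1 - 𝔼 y, ind (z y)) ^ T.card := by
  simp only [ind_forall_mem T]
  rw [expect_prod_apply fun x y => ind (x ∈ T → ¬ z y), ← Finset.prod_const,
    ← Finset.prod_subset (Finset.subset_univ T)]
  · refine Finset.prod_congr rfl fun x hx => ?_
    simp only [hx, true_imp_iff, ind_not, Finset.expect_sub_distrib, expect_const']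
  · intro x _ hx
    simp only [hx, false_imp_iff, ind_of_true trivial, expect_const']

theorem expect_ind_forall_not_and [DecidableEq X] (z : C → Prop) {T : Finset X} {m : X}
    (hm : m ∉ T) :
    𝔼 c : X → C, ind ((∀ x ∈ T, ¬ z (c x)) ∧ z (c m)) =
      (1 - 𝔼 y, ind (z y)) ^ T.card * 𝔼 y, ind (z y) := by
  have h1 := expect_ind_forall_not z (insert m T)
  rw [Finset.card_insert_of_notMem hm] at h1
  have h2 := expect_ind_forall_not z T
  have h3 : ∀ c : X → C, ind ((∀ x ∈ T, ¬ z (c x)) ∧ z (c m)) =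
      ind (∀ x ∈ T, ¬ z (c x)) - ind (∀ x ∈ insert m T, ¬ z (c x)) := by
    intro c
    have h4 : (∀ x ∈ insert m T, ¬ z (c x)) ↔ (∀ x ∈ T, ¬ z (c x)) ∧ ¬ z (c m) := by
      rw [Finset.forall_mem_insert, and_comm]
    rw [show ind (∀ x ∈ insert m T, ¬ z (c x)) = _ from congrArg ind (propext h4), ind_and,
      ind_and, ind_not]
    ring
  simp only [h3, Finset.expect_sub_distrib, h1, h2]
  ring

theorem expect_ind_mem_unitInterval (z : C → Prop) :
    0 ≤ 𝔼 y, ind (z y) ∧ 𝔼 y, ind (z y) ≤ 1 :=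
  ⟨Finset.expect_nonneg fun _ _ => ind_nonneg _,
    (expect_mono fun _ => ind_le_one _).trans_eq (expect_const' 1)⟩

theorem le_expect_ind_forall_not [DecidableEq X] (z : C → Prop) {τ : List X} {q : ℕ}
    (hτ : τ.length ≤ q) :
    (1 - 𝔼 y, ind (z y)) ^ q ≤ 𝔼 c : X → C, ind (∀ x ∈ τ, ¬ z (c x)) := by
  have h := expect_ind_forall_not z τ.toFinset
  simp only [List.mem_toFinset] at h
  rw [h]
  obtain ⟨h0, h1⟩ := expect_ind_mem_unitInterval z
  exact pow_le_pow_of_le_one (by linarith) (by linarith) (τ.toFinset_card_le.trans hτ)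

theorem expect_ind_forall_not_and_list [DecidableEq X] (z : C → Prop) {τ : List X} {m : X}
    (hm : m ∉ τ) :
    𝔼 c : X → C, ind ((∀ x ∈ τ, ¬ z (c x)) ∧ z (c m)) =
      (𝔼 c : X → C, ind (∀ x ∈ τ, ¬ z (c x))) * 𝔼 y, ind (z y) := by
  have h := expect_ind_forall_not z τ.toFinset
  have h' := expect_ind_forall_not_and z (T := τ.toFinset) (by simpa using hm)
  simp only [List.mem_toFinset] at h h'
  rw [h, h']

/-- The restriction of a random function to a subset of its domain is a random function. -/
theorem expect_comp_injective {X' : Type*} [Fintype X'] [DecidableEq X] [DecidableEq X']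
    {ι : X → X'} (hι : Function.Injective ι) (Φ : (X → C) → ℝ) :
    𝔼 g : X' → C, Φ (fun x => g (ι x)) = 𝔼 h : X → C, Φ h := by
  classical
  let e₁ : (X' → C) ≃ ({x // x ∈ Set.range ι} → C) × ({x // x ∉ Set.range ι} → C) :=
    Equiv.piEquivPiSubtypeProd (fun x => x ∈ Set.range ι) fun _ => C
  let e₂ : ({x // x ∈ Set.range ι} → C) ≃ (X → C) :=
    Equiv.arrowCongr (Equiv.ofInjective ι hι).symm (Equiv.refl C)
  rw [Fintype.expect_equiv (e₁.trans (e₂.prodCongr (Equiv.refl _)))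
    (fun g : X' → C => Φ (fun x => g (ι x))) (fun p => Φ p.1) fun g => rfl, expect_prod]
  simp only [expect_const']

end Expect

/-! ### The reduction against classical adversaries -/

/-- Against a signer that aborts on some messages and otherwise answers like `sg`, an adversary
behaves as against `sg`, unless one of its signing queries aborts. -/
theorem Strategy.exists_run_eq {msg hash sig : ℕ} (H : Bits msg → Bits hash)
    (sg : Bits msg → Bits sig) (A : Strategy msg hash sig) :
    ∃ (τ' : List (Bits msg)) (m : Bits msg) (σ : Bits sig),
      (∀ q, A.SignBound q → τ'.length ≤ q) ∧
      ∀ (bad : Bits msg → Bool) (τ : List (Bits msg)),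
        ((∀ x ∈ τ', bad x = false) →
          A.run H (fun x => bif bad x then none else some (sg x)) τ = some (τ ++ τ', m, σ)) ∧
        ((¬ ∀ x ∈ τ', bad x = false) →
          A.run H (fun x => bif bad x then none else some (sg x)) τ = none) := by
  induction A with
  | output m σ =>
    exact ⟨[], m, σ, fun _ _ => by simp, fun bad τ => ⟨fun _ => by simp [run], fun h => by simp at h⟩⟩
  | hash r next ih =>
    obtain ⟨τ', m, σ, h1, h2⟩ := ih (H r)
    exact ⟨τ', m, σ, fun q hq => h1 q (hq _), h2⟩
  | sign x next ih =>
    obtain ⟨τ', m, σ, h1, h2⟩ := ih (sg x)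
    refine ⟨x :: τ', m, σ, fun q hq => ?_, fun bad τ => ?_⟩
    · cases q with
      | zero => exact hq.elim
      | succ q => exact Nat.succ_le_succ (h1 q (hq _))
    · obtain ⟨h3, h4⟩ := h2 bad (τ ++ [x])
      constructor
      · intro h
        have hx : bad x = false := h x List.mem_cons_self
        simp only [run, hx, cond_false]
        rw [h3 fun y hy => h y (List.mem_cons_of_mem _ hy)]
        simp
      · intro h
        cases hx : bad x
        · simp only [run, hx, cond_false]
          exact h4 fun h' => h (by simpa [hx] using h')
        · simp only [run, hx, cond_true]

/-- The coin that makes the simulated signer abort. -/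
def badCoin {p : ℕ} (b : Fin p) : Bool := decide (b.val = 0)

theorem badCoin_eq_true {p : ℕ} {b : Fin p} : badCoin b = true ↔ b.val = 0 := by simp [badCoin]

theorem expect_fin_val_eq_zero {p : ℕ} (hp : 0 < p) :
    𝔼 b : Fin p, ind (b.val = 0) = 1 / (p : ℝ) := by
  rw [Fintype.expect_eq_sum_div_card, Fintype.card_fin,
    Finset.sum_eq_single (⟨0, hp⟩ : Fin p) (fun b _ hb => ind_of_false fun h => hb (Fin.ext h))
      (by simp), ind_of_true rfl]

namespace TrapdoorPermutationPair

variable (F : TrapdoorPermutationPair)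

theorem f₁_injective (n : ℕ) (r : Bits (F.coinLen n)) :
    Function.Injective (F.f₁ n (F.gen n r).1) :=
  Function.LeftInverse.injective (F.inv₁_f₁ n r)

theorem f₂_injective (n : ℕ) (r : Bits (F.coinLen n)) :
    Function.Injective (F.f₂ n (F.gen n r).1) :=
  Function.LeftInverse.injective (F.inv₂_f₂ n r)

variable {F} {msgLen p : ℕ → ℕ} {hp : ∀ n, 0 < p n} {n : ℕ}

theorem simOracle_coron (Oc : Bits (msgLen n) → Bits (F.domLen n) × Fin (p n))
    (pk : Bits (F.pkLen n)) :
    (F.coronReduction msgLen p hp).simOracle Oc pk = fun x =>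
      bif badCoin (Oc x).2 then F.f₂ n pk (Oc x).1 else F.f₁ n pk (Oc x).1 := by
  funext x
  by_cases h : (Oc x).2.val = 0 <;> simp [HFReduction.simOracle, badCoin, h]

/-- The simulated signatures, as a function of the simulated oracle and the coins. -/
theorem sign_coron (r : Bits (F.coinLen n))
    (Oc : Bits (msgLen n) → Bits (F.domLen n) × Fin (p n)) :
    (fun m => (F.coronReduction msgLen p hp).sign n Oc m (F.gen n r).1) = fun m =>
      bif badCoin (Oc m).2 then none else some (F.inv₁ n (F.gen n r).2
        (bif badCoin (Oc m).2 then F.f₂ n (F.gen n r).1 (Oc m).1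
          else F.f₁ n (F.gen n r).1 (Oc m).1)) := by
  funext m
  by_cases h : (Oc m).2.val = 0 <;> simp [badCoin, h, F.inv₁_f₁]

/-- The simulated oracle is uniformly random and independent of the coins. -/
theorem expect_coron (r : Bits (F.coinLen n))
    (Φ : (Bits (msgLen n) → Bits (F.domLen n)) → (Bits (msgLen n) → Fin (p n)) → ℝ) :
    𝔼 Oc : Bits (msgLen n) → Bits (F.domLen n) × Fin (p n),
      Φ ((F.coronReduction msgLen p hp).simOracle Oc (F.gen n r).1) (fun x => (Oc x).2) =
    𝔼 H, 𝔼 c, Φ H c := by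
  rw [← expect_programmed (F.f₁_injective n r) (F.f₂_injective n r) badCoin Φ]
  refine Finset.expect_congr rfl fun Oc _ => ?_
  rw [simOracle_coron]

theorem expect_badCoin (hp : 0 < p n) : 𝔼 b : Fin (p n), ind (badCoin b = true) = 1 / (p n : ℝ) := by
  simp only [badCoin_eq_true, expect_fin_val_eq_zero hp]

theorem coron_sign_close (r : Bits (F.coinLen n)) {k : ℕ} (ms : Fin k → Bits (msgLen n))
    (H : Bits (msgLen n) → Bits (F.domLen n)) (σs : Fin k → Bits (F.domLen n)) :
    (𝔼 Oc : Bits (msgLen n) → Bits (F.domLen n) × Fin (p n),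
      ind ((F.coronReduction msgLen p hp).simOracle Oc (F.gen n r).1 = H ∧
        ∀ i, (F.coronReduction msgLen p hp).sign n Oc (ms i) (F.gen n r).1 = some (σs i))) =
    (𝔼 Oc : Bits (msgLen n) → Bits (F.domLen n) × Fin (p n),
      ind (∀ i, (F.coronReduction msgLen p hp).sign n Oc (ms i) (F.gen n r).1 ≠ none)) *
    (𝔼 Oc : Bits (msgLen n) → Bits (F.domLen n) × Fin (p n),
      ind ((F.coronReduction msgLen p hp).simOracle Oc (F.gen n r).1 = H)) *
    ind (∀ i, σs i = F.inv₁ n (F.gen n r).2 (H (ms i))) := by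
  have : Nonempty (Fin (p n)) := ⟨⟨0, hp n⟩⟩
  have e1 : ∀ Oc : Bits (msgLen n) → Bits (F.domLen n) × Fin (p n),
      ind ((F.coronReduction msgLen p hp).simOracle Oc (F.gen n r).1 = H ∧
        ∀ i, (F.coronReduction msgLen p hp).sign n Oc (ms i) (F.gen n r).1 = some (σs i)) =
      ind ((F.coronReduction msgLen p hp).simOracle Oc (F.gen n r).1 = H) *
        (ind (∀ i, badCoin (Oc (ms i)).2 = false) *
          ind (∀ i, σs i = F.inv₁ n (F.gen n r).2 (H (ms i)))) := by
    intro Oc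
    rw [← ind_and, ← ind_and]
    congr 1
    rw [eq_iff_iff]
    refine and_congr_right fun hH => ?_
    rw [← forall_and]
    refine forall_congr' fun i => ?_
    rw [congrFun (sign_coron r Oc) (ms i)]
    have := congrFun hH (ms i)
    rw [simOracle_coron] at this
    dsimp only at this
    rw [this]
    cases badCoin (Oc (ms i)).2 <;> simp [eq_comm]
  have e2 : ∀ Oc : Bits (msgLen n) → Bits (F.domLen n) × Fin (p n),
      ind (∀ i, (F.coronReduction msgLen p hp).sign n Oc (ms i) (F.gen n r).1 ≠ none) =
      ind (∀ i, badCoin (Oc (ms i)).2 = false) := by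
    intro Oc
    congr 1
    rw [eq_iff_iff]
    refine forall_congr' fun i => ?_
    rw [congrFun (sign_coron r Oc) (ms i)]
    cases badCoin (Oc (ms i)).2 <;> simp
  simp only [e1, e2]
  rw [expect_coron r fun H' c => ind (H' = H) * (ind (∀ i, badCoin (c (ms i)) = false) * _),
    expect_coron (hp := hp) r fun H' c => ind (∀ i, badCoin (c (ms i)) = false),
    expect_coron (hp := hp) r fun H' c => ind (H' = H)]
  simp only [expect_const', ← Finset.mul_expect, ← Finset.expect_mul]
  ring

theorem coron_sign_valid (r : Bits (F.coinLen n))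
    (Oc : Bits (msgLen n) → Bits (F.domLen n) × Fin (p n)) (m : Bits (msgLen n))
    (σ : Bits (F.domLen n))
    (h : (F.coronReduction msgLen p hp).sign n Oc m (F.gen n r).1 = some σ) :
    F.f₁ n (F.gen n r).1 σ = (F.coronReduction msgLen p hp).simOracle Oc (F.gen n r).1 m := by
  rw [simOracle_coron]
  have h' := h
  by_cases hb : (Oc m).2.val = 0
  · simp [hb] at h'
  · simp [hb] at h'
    simp [badCoin, hb, h']

/-- The bounds on the abort and success probabilities, for fixed keys and coins of the adversary. -/
theorem coron_bounds (r : Bits (F.coinLen n)) {q : ℕ}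
    (A : Bits (F.pkLen n) → Strategy (msgLen n) (F.domLen n) (F.domLen n))
    (hA : ∀ pk, (A pk).SignBound q) :
    (1 - 1 / (p n : ℝ)) ^ q ≤ (𝔼 Oc : Bits (msgLen n) → Bits (F.domLen n) × Fin (p n),
      ind ((F.coronReduction msgLen p hp).simulate A (F.gen n r).1 Oc ≠ none)) ∧
    1 / (p n : ℝ) * (𝔼 Oc : Bits (msgLen n) → Bits (F.domLen n) × Fin (p n),
      ind (∃ m σ, (F.coronReduction msgLen p hp).Forges A (F.gen n r).1 Oc m σ)) ≤
    𝔼 Oc : Bits (msgLen n) → Bits (F.domLen n) × Fin (p n),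
      ind (∃ m σ, (F.coronReduction msgLen p hp).Forges A (F.gen n r).1 Oc m σ ∧
        F.clawProblem.accept n r
          ((F.coronReduction msgLen p hp).finish n Oc m σ (F.gen n r).1)) := by
  have : Nonempty (Fin (p n)) := ⟨⟨0, hp n⟩⟩
  choose τ m σ hlen hrun using fun H : Bits (msgLen n) → Bits (F.domLen n) =>
    Strategy.exists_run_eq H (fun x => F.inv₁ n (F.gen n r).2 (H x)) (A (F.gen n r).1)
  have hsim : ∀ Oc : Bits (msgLen n) → Bits (F.domLen n) × Fin (p n),
      (F.coronReduction msgLen p hp).simulate A (F.gen n r).1 Oc =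
        (A (F.gen n r).1).run ((F.coronReduction msgLen p hp).simOracle Oc (F.gen n r).1)
          (fun x => bif badCoin (Oc x).2 then none else some (F.inv₁ n (F.gen n r).2
            ((F.coronReduction msgLen p hp).simOracle Oc (F.gen n r).1 x))) [] := by
    intro Oc
    have := sign_coron (p := p) (hp := hp) r Oc
    rw [simOracle_coron]
    unfold HFReduction.simulate
    dsimp only at this ⊢
    rw [this, ← simOracle_coron (hp := hp)]
  set good : (Bits (msgLen n) → Bits (F.domLen n)) → (Bits (msgLen n) → Fin (p n)) → Prop :=
    fun H c => ∀ x ∈ τ H, ¬ badCoin (c x) = true with hgood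
  set wins : (Bits (msgLen n) → Bits (F.domLen n)) → Prop :=
    fun H => m H ∉ τ H ∧ F.f₁ n (F.gen n r).1 (σ H) = H (m H) with hwins
  have hforge : ∀ (Oc : Bits (msgLen n) → Bits (F.domLen n) × Fin (p n)) (m' σ'),
      (F.coronReduction msgLen p hp).Forges A (F.gen n r).1 Oc m' σ' ↔
        good ((F.coronReduction msgLen p hp).simOracle Oc (F.gen n r).1) (fun x => (Oc x).2) ∧
        wins ((F.coronReduction msgLen p hp).simOracle Oc (F.gen n r).1) ∧
        m' = m ((F.coronReduction msgLen p hp).simOracle Oc (F.gen n r).1) ∧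
        σ' = σ ((F.coronReduction msgLen p hp).simOracle Oc (F.gen n r).1) := by
    intro Oc m' σ'
    unfold HFReduction.Forges
    rw [hsim]
    set H := (F.coronReduction msgLen p hp).simOracle Oc (F.gen n r).1 with hH
    obtain ⟨h1, h2⟩ := hrun H (fun x => badCoin (Oc x).2) []
    by_cases hg : good H fun x => (Oc x).2
    · rw [h1 fun x hx => by simpa using hg x hx]
      constructor
      · rintro ⟨τ', h3, h4, h5⟩
        simp only [Option.some.injEq, Prod.mk.injEq, List.nil_append] at h3
        obtain ⟨rfl, rfl, rfl⟩ := h3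
        exact ⟨hg, ⟨h4, h5⟩, rfl, rfl⟩
      · rintro ⟨_, ⟨h4, h5⟩, rfl, rfl⟩
        exact ⟨τ H, by simp, h4, h5⟩
    · rw [h2 fun h => hg fun x hx => by simpa using h x hx]
      simp [hg]
  have e1 : ∀ Oc : Bits (msgLen n) → Bits (F.domLen n) × Fin (p n),
      ind ((F.coronReduction msgLen p hp).simulate A (F.gen n r).1 Oc ≠ none) =
        ind (good ((F.coronReduction msgLen p hp).simOracle Oc (F.gen n r).1)
          (fun x => (Oc x).2)) := by
    intro Oc
    rw [hsim]
    set H := (F.coronReduction msgLen p hp).simOracle Oc (F.gen n r).1 with hH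
    obtain ⟨h1, h2⟩ := hrun H (fun x => badCoin (Oc x).2) []
    by_cases hg : good H fun x => (Oc x).2
    · rw [h1 fun x hx => by simpa using hg x hx, ind_of_true hg, ind_of_true (by simp)]
    · rw [h2 fun h => hg fun x hx => by simpa using h x hx, ind_of_false hg, ind_of_false (by simp)]
  have e2 : ∀ Oc : Bits (msgLen n) → Bits (F.domLen n) × Fin (p n),
      ind (∃ m σ, (F.coronReduction msgLen p hp).Forges A (F.gen n r).1 Oc m σ) =
        ind (good ((F.coronReduction msgLen p hp).simOracle Oc (F.gen n r).1)
          (fun x => (Oc x).2)) *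
        ind (wins ((F.coronReduction msgLen p hp).simOracle Oc (F.gen n r).1)) := by
    intro Oc
    rw [← ind_and]
    congr 1
    rw [eq_iff_iff]
    simp only [hforge]
    exact ⟨fun ⟨_, _, h1, h2, _⟩ => ⟨h1, h2⟩, fun ⟨h1, h2⟩ => ⟨_, _, h1, h2, rfl, rfl⟩⟩
  have e3 : ∀ Oc : Bits (msgLen n) → Bits (F.domLen n) × Fin (p n),
      ind (wins ((F.coronReduction msgLen p hp).simOracle Oc (F.gen n r).1)) *
      ind (good ((F.coronReduction msgLen p hp).simOracle Oc (F.gen n r).1) (fun x => (Oc x).2) ∧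
        badCoin (Oc (m ((F.coronReduction msgLen p hp).simOracle Oc (F.gen n r).1))).2 = true) ≤
      ind (∃ m σ, (F.coronReduction msgLen p hp).Forges A (F.gen n r).1 Oc m σ ∧
        F.clawProblem.accept n r
          ((F.coronReduction msgLen p hp).finish n Oc m σ (F.gen n r).1)) := by
    intro Oc
    rw [← ind_and]
    refine ind_mono ?_
    rintro ⟨hw, hg, hb⟩
    refine ⟨_, _, (hforge Oc _ _).2 ⟨hg, hw, rfl, rfl⟩, ?_⟩
    -- on the forged message the simulated oracle is an image under `f₂`
    have h1 := hw.2
    set H := (F.coronReduction msgLen p hp).simOracle Oc (F.gen n r).1 with hH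
    have h2 := congrFun (hH.trans (simOracle_coron Oc _)) (m H)
    simp only [hb, cond_true] at h2
    change F.f₁ n (F.gen n r).1 (fstBits (Fin.append (σ H) (Oc (m H)).1)) =
      F.f₂ n (F.gen n r).1 (sndBits (Fin.append (σ H) (Oc (m H)).1))
    rw [fstBits_append, sndBits_append, h1, h2]
  have hρ := expect_badCoin (hp n)
  constructor
  · simp only [e1]
    rw [expect_coron r fun H c => ind (good H c), ← hρ]
    refine Finset.le_expect Finset.univ_nonempty fun H _ => ?_
    exact le_expect_ind_forall_not (fun b => badCoin b = true) (hlen H q (hA _))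
  · refine le_trans ?_ (expect_mono e3)
    simp only [e2]
    rw [expect_coron r fun H c => ind (good H c) * ind (wins H),
      expect_coron r fun H c => ind (wins H) * ind (good H c ∧ badCoin (c (m H)) = true),
      Finset.mul_expect]
    refine expect_mono fun H => ?_
    rw [← Finset.expect_mul, ← Finset.mul_expect]
    by_cases hw : wins H
    · rw [expect_ind_forall_not_and_list (fun b => badCoin b = true) hw.1, hρ, ind_of_true hw]
      apply le_of_eq
      ring
    · rw [ind_of_false hw]; simp

end TrapdoorPermutationPair

/-! ### Efficiency of the reduction -/

theorem Polynomial.monotone_eval_nat (P : Polynomial ℕ) : Monotone fun m : ℕ => P.eval m := by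
  intro a b hab
  simp only [Polynomial.eval_eq_sum_range]
  exact Finset.sum_le_sum fun i _ => Nat.mul_le_mul_left _ (Nat.pow_le_pow_left hab i)

namespace PolyBounded

variable {f g : ℕ → ℕ}

theorem of_le (hg : PolyBounded g) (h : ∀ n, f n ≤ g n) : PolyBounded f := by
  obtain ⟨P, hP⟩ := hg
  exact ⟨P, fun n => (h n).trans (hP n)⟩

theorem const (c : ℕ) : PolyBounded fun _ => c := ⟨Polynomial.C c, fun n => by simp⟩

theorem id : PolyBounded fun n => n := ⟨Polynomial.X, fun n => by simp⟩

theorem add (hf : PolyBounded f) (hg : PolyBounded g) : PolyBounded fun n => f n + g n := by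
  obtain ⟨P, hP⟩ := hf
  obtain ⟨Q, hQ⟩ := hg
  exact ⟨P + Q, fun n => by rw [Polynomial.eval_add]; exact Nat.add_le_add (hP n) (hQ n)⟩

theorem mul (hf : PolyBounded f) (hg : PolyBounded g) : PolyBounded fun n => f n * g n := by
  obtain ⟨P, hP⟩ := hf
  obtain ⟨Q, hQ⟩ := hg
  exact ⟨P * Q, fun n => by rw [Polynomial.eval_mul]; exact Nat.mul_le_mul (hP n) (hQ n)⟩

theorem pow (hf : PolyBounded f) (k : ℕ) : PolyBounded fun n => f n ^ k := by
  obtain ⟨P, hP⟩ := hf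
  exact ⟨P ^ k, fun n => by rw [Polynomial.eval_pow]; exact Nat.pow_le_pow_left (hP n) k⟩

theorem comp (hf : PolyBounded f) (hg : PolyBounded g) : PolyBounded fun n => f (g n) := by
  obtain ⟨P, hP⟩ := hf
  obtain ⟨Q, hQ⟩ := hg
  refine ⟨P.comp Q, fun n => (hP _).trans ?_⟩
  rw [Polynomial.eval_comp]
  exact P.monotone_eval_nat (hQ n)

end PolyBounded

theorem Efficient.exists_comp {a b : ℕ → ℕ} {f : ∀ n, Bits (a n) → Bits (b n)} (h : Efficient f) :
    ∃ s : ℕ → ℕ, PolyBounded s ∧ (∀ n, a n + b n ≤ s n) ∧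
      ∀ n i o, Comp i o (s n) (fun _ x => f n x) := by
  obtain ⟨C, hC, e⟩ := h
  refine ⟨fun n => (C n).size, hC, fun n => by simp only [ClassicalCircuit.size]; omega,
    fun n i o => ?_⟩
  exact ((Comp.of_circuit (C n)).mono (by simp only [ClassicalCircuit.size]; omega)).congr
    fun _ x => e n x

theorem OracleEfficient.of_comp {i o a b s : ℕ → ℕ} {R : ℕ → Type} {enc : ∀ n, R n → Bits (o n)}
    {f : ∀ n, (Bits (i n) → R n) → Bits (a n) → Bits (b n)}
    (f' : ∀ n, (Bits (i n) → Bits (o n)) → Bits (a n) → Bits (b n))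
    (hf : ∀ n, Comp (i n) (o n) (s n) (f' n))
    (e : ∀ n O x, f' n (fun r => enc n (O r)) x = f n O x)
    (hi : PolyBounded i) (ho : PolyBounded o) (ha : PolyBounded a) (hb : PolyBounded b)
    (hs : PolyBounded s) : OracleEfficient enc f := by
  choose C hC h using fun n => (hf n).exists_circuit
  refine ⟨C, PolyBounded.of_le ((((hi.add ho).add ha).add hb).add (hs.add (.const 2))) fun n => ?_,
    fun n O x => (h n _ x).trans (e n O x)⟩
  simp only [ClassicalCircuit.size]
  have := hC n
  omega

theorem Efficient.of_comp {a b s : ℕ → ℕ} {f : ∀ n, Bits (a n) → Bits (b n)}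
    (hf : ∀ n, Comp 0 0 (s n) (fun _ x => f n x))
    (ha : PolyBounded a) (hb : PolyBounded b) (hs : PolyBounded s) : Efficient f := by
  choose C hC h using fun n => (hf n).exists_circuit
  refine ⟨C, PolyBounded.of_le ((ha.add hb).add (hs.add (.const 2))) fun n => ?_,
    fun n x => h n _ x⟩
  simp only [ClassicalCircuit.size]
  have := hC n
  omega

namespace Comp

variable {i o a b c s : ℕ}

theorem fst {f : (Bits i → Bits o) → Bits a → Bits (b + c)} (hf : Comp i o s f) :
    Comp i o s (fun O x => fstBits (f O x)) :=
  (hf.comp (Comp.wire (Fin.castAdd c))).congr fun _ _ => rfl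

theorem snd {f : (Bits i → Bits o) → Bits a → Bits (b + c)} (hf : Comp i o s f) :
    Comp i o s (fun O x => sndBits (f O x)) :=
  (hf.comp (Comp.wire (Fin.natAdd b))).congr fun _ _ => rfl

theorem id : Comp i o 0 (fun _ (x : Bits a) => x) := Comp.wire (fun k => k)

end Comp

/-- The simulated hash value: the image under `f₂` or `f₁` of the random string in `u`, according
to the coins in `u`. -/
def programmedHash {d t : ℕ} (z : Bits t → Bool) (f₁ f₂ : Bits d → Bits d) (u : Bits (d + t)) :
    Bits d :=
  bif z (sndBits u) then f₂ (fstBits u) else f₁ (fstBits u)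

theorem comp_programmedHash {i o a d t P s₁ s₂ sz su : ℕ} {f₁ f₂ : Bits P → Bits d → Bits d}
    (h₁ : Comp i o s₁ fun _ (x : Bits (P + d)) => f₁ (fstBits x) (sndBits x))
    (h₂ : Comp i o s₂ fun _ (x : Bits (P + d)) => f₂ (fstBits x) (sndBits x))
    {z : Bits t → Bool} (hz : BitComp i o sz fun _ x => z x)
    {pk : (Bits i → Bits o) → Bits a → Bits P} (hpk : Comp i o 0 pk)
    {u : (Bits i → Bits o) → Bits a → Bits (d + t)} (hu : Comp i o su u) :
    Comp i o (3 * su + sz + s₁ + s₂ + 13 * d)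
      (fun O x => programmedHash z (f₁ (pk O x)) (f₂ (pk O x)) (u O x)) := by
  refine ((Comp.cond (hu.snd.comp_bit hz) ((hpk.pair hu.fst).comp h₂)
    ((hpk.pair hu.fst).comp h₁)).mono (by omega)).congr fun O x => ?_
  simp only [fstBits_append, sndBits_append]
  rfl

/-- The binary representation of zero. -/
def isZeroBits {t : ℕ} (y : Bits t) : Bool := decide (∀ k, (!y k) = true)

theorem bitComp_isZeroBits {i o t : ℕ} :
    BitComp i o (t * 5 + 1) (fun _ (y : Bits t) => isZeroBits y) :=
  BitComp.all (s := 2) (f := fun _ (y : Bits t) k => !y k) fun k => (BitComp.bit k).not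

theorem isZeroBits_encodePair {d p : ℕ} (u : Bits d × Fin p) :
    isZeroBits (sndBits (encodePair u)) = badCoin u.2 := by
  rw [encodePair, sndBits_append, isZeroBits, badCoin]
  congr 1
  rw [eq_iff_iff]
  constructor
  · intro h
    apply Nat.eq_of_testBit_eq
    intro k
    rw [Nat.zero_testBit]
    by_cases hk : k < Nat.size p
    · simpa using h ⟨k, hk⟩
    · exact Nat.testBit_lt_two_pow (u.2.isLt.trans_le
        ((Nat.lt_size_self p).le.trans (Nat.pow_le_pow_right (by norm_num) (not_lt.1 hk))))
  · intro h k
    simp [h]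

theorem fstBits_encodePair {d p : ℕ} (u : Bits d × Fin p) : fstBits (encodePair u) = u.1 :=
  fstBits_append _ _

namespace TrapdoorPermutationPair

variable (F : TrapdoorPermutationPair)

/-- A common polynomial bound on the lengths and on the sizes of the circuits for `f₁` and `f₂`. -/
theorem exists_bound : ∃ s : ℕ → ℕ, PolyBounded s ∧ (∀ n, F.pkLen n + F.domLen n ≤ s n) ∧
    (∀ n i o, Comp i o (s n) fun _ (x : Bits (F.pkLen n + F.domLen n)) =>
      F.f₁ n (fstBits x) (sndBits x)) ∧
    (∀ n i o, Comp i o (s n) fun _ (x : Bits (F.pkLen n + F.domLen n)) =>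
      F.f₂ n (fstBits x) (sndBits x)) := by
  obtain ⟨s₁, h1, h2, h3⟩ := F.f₁_efficient.exists_comp
  obtain ⟨s₂, h1', h2', h3'⟩ := F.f₂_efficient.exists_comp
  refine ⟨fun n => s₁ n + s₂ n, h1.add h1', fun n => ?_,
    fun n i o => (h3 n i o).mono (Nat.le_add_right _ _),
    fun n i o => (h3' n i o).mono (Nat.le_add_left _ _)⟩
  have := h2 n
  dsimp only
  omega

theorem coron_historyFreeWith {msgLen : ℕ → ℕ} (hmsg : PolyBounded msgLen) (q p : ℕ → ℕ)
    (hp : ∀ n, 0 < p n) (hpoly : PolyBounded p) :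
    (F.coronReduction msgLen p hp).HistoryFreeWith q
      (fun n => (1 - 1 / (p n : ℝ)) ^ q n) (fun n => 1 / (p n : ℝ)) := by
  have hne : ∀ n, Nonempty (Fin (p n)) := fun n => ⟨⟨0, hp n⟩⟩
  obtain ⟨s, hs, hlen, h₁, h₂⟩ := F.exists_bound
  have hpk : PolyBounded F.pkLen := hs.of_le fun n => by have := hlen n; omega
  have hdom : PolyBounded F.domLen := hs.of_le fun n => by have := hlen n; omega
  have hsize : PolyBounded fun n => Nat.size (p n) :=
    hpoly.of_le fun n => Nat.size_le.2 Nat.lt_two_pow_self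
  have hneg : Negligible fun _ => 0 := Asymptotics.superpolynomialDecay_zero _ _
  refine
    { start_efficient := ?_
      inst_efficient := ?_
      rand_efficient := ?_
      sign_efficient := ?_
      finish_efficient := ?_
      start_inst := fun _ _ => rfl
      inst_close := ?_
      rand_indistinguishable := ?_
      sign_valid := fun n r Oc m σ h => coron_sign_valid r Oc m σ h
      sign_close := ?_
      sign_no_abort := ?_
      finish_accepts := ?_ }
  · exact Efficient.of_comp (fun n => Comp.id.pair Comp.id) hpk (hpk.add hpk) (.const 0)
  · exact Efficient.of_comp (s := fun _ => 0) (fun n => Comp.id) hpk hpk (.const 0)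
  · refine OracleEfficient.of_comp (fun n O x => programmedHash isZeroBits
      (F.f₁ n (sndBits x)) (F.f₂ n (sndBits x)) (O (fstBits x)))
      (fun n => comp_programmedHash (h₁ n _ _) (h₂ n _ _) bitComp_isZeroBits Comp.id.snd
        (Comp.id.fst.comp Comp.query)) (fun n Oc x => ?_) hmsg (hdom.add hsize)
      (hmsg.add hpk) hdom
      (((((PolyBounded.const 3).add ((hsize.mul (.const 5)).add (.const 1))).add hs).add hs).add
        ((PolyBounded.const 13).mul hdom))
    change programmedHash isZeroBits _ _ (encodePair (Oc (fstBits x))) = _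
    rw [programmedHash, isZeroBits_encodePair, fstBits_encodePair]
    by_cases h : (Oc (fstBits x)).2.val = 0 <;> simp [badCoin, h]
  · refine OracleEfficient.of_comp (fun n O x => bif isZeroBits (sndBits (O (fstBits x)))
      then fun _ => false else Fin.append (fun _ : Fin 1 => true) (fstBits (O (fstBits x))))
      (fun n => Comp.cond ((Comp.id.fst.comp Comp.query).snd.comp_bit bitComp_isZeroBits) Comp.zero
        (Comp.pair (Comp.const _) (Comp.id.fst.comp Comp.query).fst)) (fun n Oc x => ?_) hmsg
      (hdom.add hsize) (hmsg.add hpk) ((PolyBounded.const 1).add hdom)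
      ((((PolyBounded.const 1).add ((hsize.mul (.const 5)).add (.const 1))).add (.const 2)).add
        (((PolyBounded.const 1).add hdom).mul (.const 13)))
    change (bif isZeroBits (sndBits (encodePair (Oc (fstBits x)))) then fun _ => false
      else Fin.append (fun _ : Fin 1 => true) (fstBits (encodePair (Oc (fstBits x))))) = _
    rw [isZeroBits_encodePair, fstBits_encodePair]
    by_cases h : (Oc (fstBits x)).2.val = 0 <;> simp [badCoin, h, encodeOption]
  · refine OracleEfficient.of_comp (fun n O x =>
      Fin.append (sndBits (fstBits x)) (fstBits (O (fstBits (fstBits x)))))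
      (fun n => Comp.id.fst.snd.pair (Comp.id.fst.fst.comp Comp.query).fst) (fun n Oc x => ?_) hmsg
      (hdom.add hsize) ((hmsg.add hdom).add hpk) (hdom.add hdom) (.const 1)
    exact congrArg (Fin.append _) (fstBits_encodePair _)
  · simpa using hneg
  · refine fun k D _ => ⟨fun _ => 0, hneg, fun n r => le_of_eq ?_⟩
    refine Finset.sum_eq_zero fun y _ => abs_eq_zero.2 (sub_eq_zero.2 ?_)
    exact (expect_coron (hp := hp) r fun H _ => (D n).prob H noOracle (nIn := 0) Fin.elim0
      (fun _ y' => y' = y)).trans (by simp only [expect_const'])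
  · refine ⟨fun _ => 0, hneg, fun n r k _ ms => ?_⟩
    rw [zero_mul]
    refine le_of_eq (Finset.sum_eq_zero fun H _ => Finset.sum_eq_zero fun σs _ => ?_)
    exact abs_eq_zero.2 (sub_eq_zero.2 (coron_sign_close r ms H σs))
  · intro n k A hA
    exact Finset.le_expect Finset.univ_nonempty fun r _ =>
      Finset.le_expect Finset.univ_nonempty fun ω _ =>
        (coron_bounds r (fun pk => A pk ω) fun pk => hA pk ω).1
  · intro n k A hA
    rw [Finset.mul_expect]
    refine expect_mono fun r => ?_
    rw [Finset.mul_expect]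
    exact expect_mono fun ω => (coron_bounds r (fun pk => A pk ω) fun pk => hA pk ω).2

end TrapdoorPermutationPair

/-- The optimal parameter: `(1 - 1/q) ^ q` is essentially constant. -/
theorem exp_neg_one_mul_le (q : ℕ) (hq : 2 ≤ q) :
    Real.exp (-1) * (1 - 1 / (q : ℝ)) ≤ (1 - 1 / (q : ℝ)) ^ q := by
  obtain ⟨k, rfl⟩ : ∃ k, q = k + 1 := ⟨q - 1, by omega⟩
  have hk : (0 : ℝ) < k := by exact_mod_cast (by omega : 0 < k)
  have e : 1 - 1 / ((k + 1 : ℕ) : ℝ) = (1 + 1 / (k : ℝ))⁻¹ := by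
    push_cast
    field_simp
    ring
  rw [pow_succ]
  refine mul_le_mul_of_nonneg_right ?_ (by rw [e]; positivity)
  rw [e, inv_pow, Real.exp_neg]
  refine inv_anti₀ (by positivity) ?_
  -- `(1 + 1/k) ^ k ≤ exp 1`
  calc (1 + 1 / (k : ℝ)) ^ k ≤ Real.exp (1 / (k : ℝ)) ^ k := by
        refine pow_le_pow_left₀ (by positivity) ?_ k
        rw [add_comm]
        exact Real.add_one_le_exp _
    _ = Real.exp 1 := by
        rw [← Real.exp_nat_mul, mul_one_div_cancel hk.ne']

/-- The overall loss of the reduction is at most a polynomial factor. -/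
theorem noticeable_bounds {q : ℕ → ℕ} (hq : ∀ n, 2 ≤ q n) (hpoly : PolyBounded q) :
    Noticeable (fun n => (1 - 1 / (q n : ℝ)) ^ q n) ∧ Noticeable fun n => 1 / (q n : ℝ) := by
  have hq0 : ∀ n, (2 : ℝ) ≤ q n := fun n => by exact_mod_cast hq n
  constructor
  · refine ⟨Polynomial.C 8, fun n => ⟨by simp, le_trans ?_ (exp_neg_one_mul_le _ (hq n))⟩⟩
    have h1 : (1 : ℝ) / 4 ≤ Real.exp (-1) := by
      rw [Real.exp_neg, one_div]
      exact inv_anti₀ (Real.exp_pos 1) (by have := Real.exp_one_lt_d9; linarith)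
    have h2 : (1 : ℝ) / 2 ≤ 1 - 1 / (q n : ℝ) := by
      have : 1 / (q n : ℝ) ≤ 1 / 2 := one_div_le_one_div_of_le (by norm_num) (hq0 n)
      linarith
    calc (1 : ℝ) / (((Polynomial.C 8).eval n : ℕ) : ℝ) = 1 / 4 * (1 / 2) := by simp; norm_num
      _ ≤ _ := mul_le_mul h1 h2 (by norm_num) (Real.exp_pos _).le
  · obtain ⟨P, hP⟩ := hpoly
    refine ⟨P, fun n => ?_⟩
    have h := hP n
    refine ⟨by have := hq n; omega, one_div_le_one_div_of_le (by linarith [hq0 n]) ?_⟩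
    exact_mod_cast h

/-! ### The reduction against quantum adversaries -/

section RunProb

variable {N a b c d : ℕ} {O : Bits a → Bits b} {S S' : Bits c → Bits d}

theorem runProb_mono {E E' : List (Bits c) → Bits N → Prop} (h : ∀ τ s, E τ s → E' τ s)
    (ops : List (QOp N a b c d)) (τ : List (Bits c)) (ψ : QState N) :
    runProb O S E ops τ ψ ≤ runProb O S E' ops τ ψ := by
  induction ops generalizing τ ψ with
  | nil =>
    exact Finset.sum_le_sum fun s _ =>
      mul_le_mul_of_nonneg_right (ind_mono (h τ s)) (by positivity)
  | cons op ops ih =>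
    cases op with
    | gate g => exact ih _ _
    | query reg => exact ih _ _
    | classicalQuery reg => exact Finset.sum_le_sum fun m _ => ih _ _

theorem runProb_nonneg {E : List (Bits c) → Bits N → Prop} (ops : List (QOp N a b c d))
    (τ : List (Bits c)) (ψ : QState N) : 0 ≤ runProb O S E ops τ ψ := by
  induction ops generalizing τ ψ with
  | nil => exact Finset.sum_nonneg fun s _ => mul_nonneg (ind_nonneg _) (by positivity)
  | cons op ops ih =>
    cases op with
    | gate g => exact ih _ _
    | query reg => exact ih _ _
    | classicalQuery reg => exact Finset.sum_nonneg fun m _ => ih _ _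

/-- After a measurement with outcome `m`, only the value of the oracle at `m` matters. -/
theorem applyOracle_projectQuery_congr (reg : Fin c ⊕ Fin d ↪ Fin N) {m : Bits c}
    (h : S m = S' m) (ψ : QState N) :
    applyOracle S reg (projectQuery reg m ψ) = applyOracle S' reg (projectQuery reg m ψ) := by
  funext s
  have hq : ∀ S : Bits c → Bits d, readQuery reg (xorAnswer S reg s) = readQuery reg s := by
    intro S
    funext k
    simp [readQuery, xorAnswer]
  simp only [applyOracle, projectQuery, hq]
  split_ifs with hm
  · have : xorAnswer S reg s = xorAnswer S' reg s := by
      funext p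
      simp only [xorAnswer, hm, h]
    rw [this]
  · rfl

/-- Replacing the classical oracle by one that agrees with it on all queries made. -/
theorem runProb_le_of_agree {E : List (Bits c) → Bits N → Prop} (ops : List (QOp N a b c d))
    (τ : List (Bits c)) (ψ : QState N) :
    runProb O S (fun τ s => (∀ m ∈ τ, S' m = S m) ∧ E τ s) ops τ ψ ≤
      runProb O S' E ops τ ψ := by
  by_cases hτ : ∀ m ∈ τ, S' m = S m
  · induction ops generalizing τ ψ with
    | nil =>
      exact Finset.sum_le_sum fun s _ =>
        mul_le_mul_of_nonneg_right (ind_mono And.right) (by positivity)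
    | cons op ops ih =>
      cases op with
      | gate g => exact ih _ _ hτ
      | query reg => exact ih _ _ hτ
      | classicalQuery reg =>
        refine Finset.sum_le_sum fun m _ => ?_
        by_cases hm : S' m = S m
        · rw [applyOracle_projectQuery_congr reg hm]
          refine ih _ _ fun x hx => ?_
          rcases List.mem_append.1 hx with h | h
          · exact hτ x h
          · rw [List.mem_singleton.1 h, hm]
        · refine le_trans (le_of_eq ?_) (runProb_nonneg (O := O) (S := S') _ _ _)
          exact zero (x := m) (by simp) hm _ _ _
  · push Not at hτ
    obtain ⟨x, hx, h⟩ := hτ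
    exact (zero hx h _ _ _).trans_le (runProb_nonneg _ _ _)
where
  /-- The event is impossible once a query with different answers has been made. -/
  zero {E : List (Bits c) → Bits N → Prop} {x : Bits c} {τ : List (Bits c)} (hx : x ∈ τ)
      (h : S' x ≠ S x) (T : Bits c → Bits d) (ops : List (QOp N a b c d)) (ψ : QState N) :
      runProb O T (fun τ s => (∀ m ∈ τ, S' m = S m) ∧ E τ s) ops τ ψ = 0 := by
    induction ops generalizing τ ψ with
    | nil =>
      exact Finset.sum_eq_zero fun s _ => by
        rw [ind_of_false fun h' => h (h'.1 x hx), zero_mul]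
    | cons op ops ih =>
      cases op with
      | gate g => exact ih hx _
      | query reg => exact ih hx _
      | classicalQuery reg =>
        exact Finset.sum_eq_zero fun m _ => ih (List.mem_append_left _ hx) _

/-- Averages over events may be taken inside. -/
theorem mul_runProb_le_expect {C : Type*} [Fintype C] {E : List (Bits c) → Bits N → Prop}
    {E' : C → List (Bits c) → Bits N → Prop} {κ : ℝ} {q : ℕ}
    (h : ∀ τ s, τ.length ≤ q → κ * ind (E τ s) ≤ 𝔼 y, ind (E' y τ s))
    (ops : List (QOp N a b c d)) (τ : List (Bits c)) (ψ : QState N)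
    (hτ : τ.length + ops.countP QOp.isClassicalQuery ≤ q) :
    κ * runProb O S E ops τ ψ ≤ 𝔼 y, runProb O S (E' y) ops τ ψ := by
  induction ops generalizing τ ψ with
  | nil =>
    simp only [runProb]
    rw [Finset.expect_sum_comm, Finset.mul_sum]
    refine Finset.sum_le_sum fun s _ => ?_
    rw [← Finset.expect_mul, ← mul_assoc]
    exact mul_le_mul_of_nonneg_right (h τ s (by simpa using hτ)) (by positivity)
  | cons op ops ih =>
    cases op with
    | gate g => exact ih _ _ (by simpa [QOp.isClassicalQuery] using hτ)
    | query reg => exact ih _ _ (by simpa [QOp.isClassicalQuery] using hτ)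
    | classicalQuery reg =>
      simp only [runProb]
      rw [Finset.expect_sum_comm, Finset.mul_sum]
      refine Finset.sum_le_sum fun m _ => ih _ _ ?_
      rw [List.countP_cons_of_pos (by rfl)] at hτ
      rw [List.length_append, List.length_singleton]
      omega

end RunProb

/-- The probability that a quantum forger, run with the programmed oracle and the simulated signer
given by `u`, leads to a claw. -/
noncomputable def simProb {l d t P : ℕ} (A : QCircuit l d l d (l + d)) (z : Bits t → Bool)
    (f₁ f₂ : Bits P → Bits d → Bits d) (pk : Bits P) (u : Bits l → Bits (d + t)) : ℝ :=
  A.prob (fun m => programmedHash z (f₁ pk) (f₂ pk) (u m)) (fun m => fstBits (u m)) pk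
    (fun _ y => f₁ pk (sndBits y) = f₂ pk (fstBits (u (fstBits y))))

/-- With a truly random `u`, a forgery leads to a claw if no message signed, but the message of the
forgery, has a coin with property `z`. -/
theorem mul_forge_le_expect_simProb {l d t P q : ℕ} (A : QCircuit l d l d (l + d))
    (hA : A.classicalQueries ≤ q) (z : Bits t → Bool) {f₁ f₂ : Bits P → Bits d → Bits d}
    {pk : Bits P} (h₁ : Function.Injective (f₁ pk)) (h₂ : Function.Injective (f₂ pk))
    {inv : Bits d → Bits d} (hinv : ∀ x, inv (f₁ pk x) = x) :
    (𝔼 y, ind (z y = true)) * (1 - 𝔼 y, ind (z y = true)) ^ q *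
      (𝔼 H : Bits l → Bits d, A.prob H (fun m => inv (H m)) pk
        (fun τ y => fstBits y ∉ τ ∧ f₁ pk (sndBits y) = H (fstBits y))) ≤
    𝔼 u : Bits l → Bits (d + t), simProb A z f₁ f₂ pk u := by
  set ρ := 𝔼 y, ind (z y = true) with hρ
  -- the strings `u m` as pairs
  have e : 𝔼 u : Bits l → Bits (d + t), simProb A z f₁ f₂ pk u =
      𝔼 u : Bits l → Bits d × Bits t,
        simProb A z f₁ f₂ pk (fun m => Fin.append (u m).1 (u m).2) := by
    symm
    exact Fintype.expect_equiv (Equiv.arrowCongr (Equiv.refl _) (Fin.appendEquiv d t)) _ _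
      fun u => rfl
  rw [e]
  set E : (Bits l → Bits d) → (Bits l → Bits t) → List (Bits l) → Bits (l + d) → Prop :=
    fun H c τ y => ((∀ m ∈ τ, ¬ z (c m) = true) ∧ z (c (fstBits y)) = true) ∧ fstBits y ∉ τ ∧
      f₁ pk (sndBits y) = H (fstBits y) with hE
  have h1 : ∀ u : Bits l → Bits d × Bits t,
      A.prob (fun x => bif z (u x).2 then f₂ pk (u x).1 else f₁ pk (u x).1)
        (fun m => inv (bif z (u m).2 then f₂ pk (u m).1 else f₁ pk (u m).1)) pk
        (E (fun x => bif z (u x).2 then f₂ pk (u x).1 else f₁ pk (u x).1) fun x => (u x).2) ≤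
      simProb A z f₁ f₂ pk (fun m => Fin.append (u m).1 (u m).2) := by
    intro u
    have e1 : (fun m => programmedHash z (f₁ pk) (f₂ pk) (Fin.append (u m).1 (u m).2)) =
        fun x => bif z (u x).2 then f₂ pk (u x).1 else f₁ pk (u x).1 := by
      funext m
      rw [programmedHash, sndBits_append, fstBits_append]
    have e2 : (fun m => fstBits (Fin.append (u m).1 (u m).2)) = fun m => (u m).1 := by
      funext m
      rw [fstBits_append]
    unfold simProb QCircuit.prob
    rw [e1, e2]
    refine le_trans (runProb_mono (fun τ s h => ?_) _ _ _)
      (runProb_le_of_agree (S := fun m => inv (bif z (u m).2 then f₂ pk (u m).1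
        else f₁ pk (u m).1)) _ _ _)
    obtain ⟨⟨h3, h4⟩, _, h5⟩ := h
    refine ⟨fun m hm => ?_, ?_⟩
    · have := h3 m hm
      rw [Bool.not_eq_true] at this
      dsimp only at this ⊢
      rw [this, cond_false, hinv]
    · beta_reduce
      rw [h5, fstBits_append]
      dsimp only at h4 ⊢
      rw [h4, cond_true]
  refine le_trans ?_ (expect_mono h1)
  rw [expect_programmed h₁ h₂ z fun H c => A.prob H (fun m => inv (H m)) pk (E H c),
    Finset.mul_expect]
  refine expect_mono fun H => ?_
  refine mul_runProb_le_expect (q := q) (E' := fun c τ s => E H c τ fun k => s (A.out k))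
    (fun τ s hτ => ?_) _ _ _ (by simpa [QCircuit.classicalQueries] using hA)
  simp only [hE]
  simp only [ind_and _ (_ ∧ _)]
  rw [← Finset.expect_mul]
  set y : Bits (l + d) := fun k => s (A.out k)
  by_cases hw : fstBits y ∉ τ ∧ f₁ pk (sndBits y) = H (fstBits y)
  · refine mul_le_mul_of_nonneg_right ?_ (ind_nonneg _)
    rw [expect_ind_forall_not_and_list (fun x => z x = true) hw.1, mul_comm]
    exact mul_le_mul_of_nonneg_right (le_expect_ind_forall_not (fun x => z x = true) hτ)
      (expect_ind_mem_unitInterval _).1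
  · rw [ind_of_false hw]; simp

/-- Between `1 / (q + 1)` and `1 / q` the success probability `ρ * (1 - ρ) ^ q` is at least its value
at `1 / q`, by Bernoulli's inequality. -/
theorem one_div_mul_pow_le {q : ℕ} (hq : 2 ≤ q) {ρ : ℝ} (h₁ : 1 / ((q : ℝ) + 1) ≤ ρ)
    (h₂ : ρ ≤ 1 / (q : ℝ)) : 1 / (q : ℝ) * (1 - 1 / (q : ℝ)) ^ q ≤ ρ * (1 - ρ) ^ q := by
  have hq' : (2 : ℝ) ≤ q := by exact_mod_cast hq
  set a := 1 / (q : ℝ) with ha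
  have haq : a * q = 1 := by rw [ha]; field_simp
  have ha2 : a ≤ 1 / 2 := one_div_le_one_div_of_le (by norm_num) hq'
  have hpos : 0 < 1 - a := by linarith
  have hρ : 0 < ρ := lt_of_lt_of_le (by positivity) h₁
  have hb := one_add_mul_le_pow (a := (a - ρ) / (1 - a))
    (le_trans (by norm_num : (-2 : ℝ) ≤ 0) (div_nonneg (by linarith) hpos.le)) q
  have e : (1 - ρ) ^ q = (1 + (a - ρ) / (1 - a)) ^ q * (1 - a) ^ q := by
    rw [← mul_pow]
    congr 1
    field_simp
    ring
  have hqρ : 1 - a ≤ q * ρ := by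
    have h3 : 1 ≤ ρ * (q + 1) := by rwa [div_le_iff₀ (by positivity)] at h₁
    linarith
  rw [e, ← mul_assoc]
  refine mul_le_mul_of_nonneg_right ?_ (pow_nonneg hpos.le q)
  refine le_trans ?_ (mul_le_mul_of_nonneg_left hb hρ.le)
  have : a * (1 - a) ≤ ρ * (1 - a) + ρ * (q * (a - ρ)) := by nlinarith
  calc a = a * (1 - a) / (1 - a) := by field_simp
    _ ≤ (ρ * (1 - a) + ρ * (q * (a - ρ))) / (1 - a) := by gcongr
    _ = ρ * (1 + q * ((a - ρ) / (1 - a))) := by field_simp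

/-- Coins with a suitable probability between `1 / (q + 1)` and `1 / q`; as `2 ^ (2 * q)` is at least
`q * (q + 1)`, rounding leaves the interval untouched. -/
theorem exists_coin (q : ℕ) (hq : 2 ≤ q) :
    ∃ z : Bits (2 * q) → Bool, (1 / ((q : ℝ) + 1) ≤ 𝔼 y, ind (z y = true)) ∧
      (𝔼 y, ind (z y = true) ≤ 1 / (q : ℝ)) ∧
      ∀ i o, BitComp i o (10 * q + 1) (fun _ y => z y) := by
  obtain ⟨z, hz, hc⟩ := exists_bitComp_card (2 * q) (2 ^ (2 * q) / q) (Nat.div_le_self _ _)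
  have hq' : (0 : ℝ) < q := by exact_mod_cast (by omega : 0 < q)
  have e : 𝔼 y, ind (z y = true) = ((2 ^ (2 * q) / q : ℕ) : ℝ) / 2 ^ (2 * q) := by
    rw [Fintype.expect_eq_sum_div_card, ← hz, Finset.card_filter]
    push_cast
    congr 1
    · refine Finset.sum_congr rfl fun y _ => ?_
      by_cases h : z y = true
      · rw [ind_of_true h, if_pos h]
      · rw [ind_of_false h, if_neg h]
    · simp
  refine ⟨z, ?_, ?_, fun i o => (hc i o).mono (by omega)⟩
  · have h1 : q * (q + 1) ≤ 2 ^ (2 * q) := by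
      have h2 : q + 1 ≤ 2 ^ q := Nat.lt_two_pow_self
      calc q * (q + 1) ≤ 2 ^ q * 2 ^ q := Nat.mul_le_mul (by omega) h2
        _ = 2 ^ (2 * q) := by rw [← pow_add, two_mul]
    have h3 : 2 ^ (2 * q) ≤ 2 ^ (2 * q) / q * (q + 1) := by
      have h4 := Nat.div_add_mod (2 ^ (2 * q)) q
      have h5 := Nat.mod_lt (2 ^ (2 * q)) (by omega : 0 < q)
      have h6 : q + 1 ≤ 2 ^ (2 * q) / q := (Nat.le_div_iff_mul_le (by omega)).2 (by
        rw [mul_comm]; exact h1)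
      have h7 : 2 ^ (2 * q) / q * (q + 1) = q * (2 ^ (2 * q) / q) + 2 ^ (2 * q) / q := by ring
      omega
    rw [e, div_le_div_iff₀ (by positivity) (by positivity), one_mul]
    exact_mod_cast h3
  · rw [e, div_le_div_iff₀ (by positivity) hq', one_mul]
    exact_mod_cast Nat.div_mul_le_self _ _

/-! ### Efficient simulation -/

/-- Truncation, or padding with zeros, to length `b`. -/
def resizeBits {a : ℕ} (b : ℕ) (x : Bits a) : Bits b := resBits b (extBits x)

theorem Comp.resizeBits {i o a b : ℕ} : Comp i o 0 (fun _ (x : Bits a) => resizeBits b x) := by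
  intro len z p hz hp
  refine ⟨[], 0, fun k => if h : (k : ℕ) < a then p ⟨k, h⟩ else z, le_rfl, fun k => ?_,
    fun O w _ hwz => ⟨[], rfl, (List.append_nil w).symm, fun k => ?_⟩⟩
  · dsimp only
    split_ifs with h
    exacts [hp _, hz]
  · rw [List.append_nil]
    dsimp only
    by_cases h : (k : ℕ) < a
    · rw [dif_pos h]
      exact (extBits_of_lt (fun k => w.getD (p k) false) h).symm
    · rw [dif_neg h, hwz]
      exact (extBits_of_le (fun k => w.getD (p k) false) (not_lt.1 h)).symm

/-- A random function on long strings restricts to a random function on short strings. -/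
theorem expect_resizeBits {l b N : ℕ} (hl : l ≤ N) (hb : b ≤ N) (Φ : (Bits l → Bits b) → ℝ) :
    𝔼 g : Bits N → Bits N, Φ (fun m => resizeBits b (g (resizeBits N m))) =
      𝔼 u : Bits l → Bits b, Φ u := by
  have hι : Function.Injective fun v : Bits l × Fin b =>
      ((resizeBits N v.1 : Bits N), Fin.castLE hb v.2) := by
    rintro ⟨m, j⟩ ⟨m', j'⟩ h
    have h' := Prod.mk.inj h
    refine Prod.ext (funext fun k => ?_) (Fin.castLE_injective hb h'.2)
    have := congrFun h'.1 (Fin.castLE hl k)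
    simpa [resizeBits, resBits, extBits] using this
  rw [Fintype.expect_equiv (Equiv.curry (Bits l) (Fin b) Bool).symm Φ
      (fun v => Φ fun m j => v (m, j)) fun u => rfl,
    ← expect_comp_injective hι fun v => Φ fun m j => v (m, j)]
  refine Fintype.expect_equiv (Equiv.curry (Bits N) (Fin N) Bool).symm _ _ fun g => ?_
  congr 1
  funext m j
  exact extBits_of_lt _ (lt_of_lt_of_le j.2 hb)

section Simulation

variable {l d t P i o T : ℕ} {f₁ f₂ : Bits P → Bits d → Bits d} {z : Bits t → Bool}

/-- The run of a forger against the simulated oracles, followed by a computation `W` on the public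
key and the output of the forger, as one circuit. The string `Q g m` may depend on an oracle. -/
theorem exists_simulated_run
    (h₁ : Comp i o T fun _ (x : Bits (P + d)) => f₁ (fstBits x) (sndBits x))
    (h₂ : Comp i o T fun _ (x : Bits (P + d)) => f₂ (fstBits x) (sndBits x))
    (hz : BitComp i o T fun _ x => z x)
    {Q : (Bits i → Bits o) → Bits l → Bits (d + t)} (hQ : Comp i o T Q)
    (A : QCircuit l d l d (l + d)) (hA : A.size ≤ T) {k : ℕ}
    (hlen : i + o + l + d + P + k ≤ T)
    {W : (Bits i → Bits o) → Bits (P + (l + d)) → Bits k} (hW : Comp i o (21 * T + 1) W) :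
    ∃ B : QCircuit i o 0 0 k, B.size ≤ 1000 * (100 * (T + 1)) ^ 3 ∧
      ∀ g (pk : Bits P) (E : Bits k → Prop),
      B.prob g noOracle pk (fun _ y => E y) =
        A.prob (fun m => programmedHash z (f₁ pk) (f₂ pk) (Q g m)) (fun m => fstBits (Q g m)) pk
          (fun _ y => E (W g (Fin.append pk y))) := by
  obtain ⟨CO, s1, e1⟩ := (comp_programmedHash (a := P + l) h₁ h₂ hz Comp.id.fst
    (Comp.id.snd.comp hQ)).exists_circuit
  obtain ⟨CS, s2, e2⟩ := ((Comp.id (a := P + l)).snd.comp hQ).fst.exists_circuit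
  obtain ⟨CP, s3, e3⟩ := hW.exists_circuit
  obtain ⟨B, hB, e⟩ := A.exists_simulation CO CS CP
  refine ⟨B, hB.trans (Nat.mul_le_mul_left _ (Nat.pow_le_pow_left ?_ 3)), fun g pk E => ?_⟩
  · simp only [ClassicalCircuit.size]
    omega
  · rw [e]
    simp only [e1, e2, e3, fstBits_append, sndBits_append]

theorem exists_clawFinder
    (h₁ : Comp i o T fun _ (x : Bits (P + d)) => f₁ (fstBits x) (sndBits x))
    (h₂ : Comp i o T fun _ (x : Bits (P + d)) => f₂ (fstBits x) (sndBits x))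
    (hz : BitComp i o T fun _ x => z x)
    {Q : (Bits i → Bits o) → Bits l → Bits (d + t)} (hQ : Comp i o T Q)
    (A : QCircuit l d l d (l + d)) (hA : A.size ≤ T) (hlen : i + o + l + d + P + (d + d) ≤ T) :
    ∃ B : QCircuit i o 0 0 (d + d), B.size ≤ 1000 * (100 * (T + 1)) ^ 3 ∧
      ∀ g (pk : Bits P), B.prob g noOracle pk
        (fun _ y => f₁ pk (fstBits y) = f₂ pk (sndBits y)) = simProb A z f₁ f₂ pk (Q g) := by
  obtain ⟨B, hB, e⟩ := exists_simulated_run h₁ h₂ hz hQ A hA hlen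
    (((Comp.id.snd.snd).pair (Comp.id.snd.fst.comp hQ).fst).mono (by omega))
  refine ⟨B, hB, fun g pk => ?_⟩
  rw [e g pk fun y => f₁ pk (fstBits y) = f₂ pk (sndBits y)]
  simp only [fstBits_append, sndBits_append]
  rfl

/-- The simulation together with a check of its success, for a fixed public key. -/
theorem exists_distinguisher
    (h₁ : Comp i o T fun _ (x : Bits (P + d)) => f₁ (fstBits x) (sndBits x))
    (h₂ : Comp i o T fun _ (x : Bits (P + d)) => f₂ (fstBits x) (sndBits x))
    (hz : BitComp i o T fun _ x => z x)
    {Q : (Bits i → Bits o) → Bits l → Bits (d + t)} (hQ : Comp i o T Q)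
    (A : QCircuit l d l d (l + d)) (hA : A.size ≤ T) (hlen : i + o + l + d + P + 1 ≤ T)
    (pk : Bits P) :
    ∃ D : QCircuit i o 0 0 1, D.size ≤ 43 * (1000 * (100 * (T + 1)) ^ 3) ∧
      ∀ g, D.prob g noOracle (nIn := 0) Fin.elim0 (fun _ y => y 0 = true) =
        simProb A z f₁ f₂ pk (Q g) := by
  have hW : BitComp i o (a := P + (l + d)) (21 * T + 1) fun g x =>
      decide (f₁ (fstBits x) (sndBits (sndBits x)) =
        f₂ (fstBits x) (fstBits (Q g (fstBits (sndBits x))))) := by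
    refine (BitComp.mono (Comp.decide_eq ((Comp.id.fst.pair Comp.id.snd.snd).comp h₁)
      ((Comp.id.fst.pair (Comp.id.snd.fst.comp hQ).fst).comp h₂)) (by omega)).congr fun O x => ?_
    simp only [fstBits_append, sndBits_append]
  obtain ⟨B, hB, e⟩ := exists_simulated_run h₁ h₂ hz hQ A hA hlen hW
  obtain ⟨D, hD, e'⟩ := B.exists_hardwired pk
  refine ⟨D, hD.trans (Nat.mul_le_mul_left _ hB), fun g => ?_⟩
  rw [e' g noOracle fun _ y => y 0 = true, e g pk fun y => y 0 = true]
  simp only [fstBits_append, sndBits_append, decide_eq_true_eq]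
  rfl

end Simulation

/-! ### Pseudorandom functions -/

/-- The advantage of `D` in telling a random member of the family `G` from a random function. -/
noncomputable def prfAdvantage (G : ∀ n, Bits n → Bits n → Bits n) {n : ℕ}
    (D : QCircuit n n 0 0 1) : ℝ :=
  |(𝔼 k : Bits n, D.prob (G n k) noOracle (nIn := 0) Fin.elim0 (fun _ y => y 0 = true)) -
    (𝔼 O : Bits n → Bits n, D.prob O noOracle (nIn := 0) Fin.elim0 (fun _ y => y 0 = true))|

theorem Negligible.comp {μ : ℕ → ℝ} (hμ : Negligible μ) (h0 : ∀ n, 0 ≤ μ n) {N : ℕ → ℕ}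
    (hN : ∀ n, n ≤ N n) : Negligible fun n => μ (N n) := by
  intro c
  have hN' : Filter.Tendsto N Filter.atTop Filter.atTop :=
    Filter.tendsto_atTop_mono hN Filter.tendsto_id
  refine squeeze_zero (fun n => mul_nonneg (by positivity) (h0 _)) (fun n => ?_)
    ((hμ c).comp hN')
  have : (n : ℝ) ≤ N n := by exact_mod_cast hN n
  exact mul_le_mul_of_nonneg_right (pow_le_pow_left₀ (Nat.cast_nonneg n) this c) (h0 _)

/-- Security of a pseudorandom function is uniform over finite families of distinguishers, and
carries over to a key length `N n ≥ n`: distinguishers are non-uniform, so for each key length the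
best one may be taken. -/
theorem IsQuantumPRF.exists_negligible {G : ∀ n, Bits n → Bits n → Bits n} (hG : IsQuantumPRF G)
    {N : ℕ → ℕ} (hN : ∀ n, n ≤ N n) {ι : ℕ → Type} [∀ n, Finite (ι n)]
    (D : ∀ n, ι n → QCircuit (N n) (N n) 0 0 1) {U : ℕ → ℕ} (hU : PolyBounded U)
    (hD : ∀ n r, (D n r).size ≤ U n) :
    ∃ ν : ℕ → ℝ, Negligible ν ∧ ∀ n r, prfAdvantage G (D n r) ≤ ν n := by
  obtain ⟨P, hP⟩ := hU
  have key : ∀ M, ∃ D' : QCircuit M M 0 0 1, D'.size ≤ P.eval M + 2 ∧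
      ∀ n r, N n = M → prfAdvantage G (D n r) ≤ prfAdvantage G D' := by
    intro M
    by_cases h : Nonempty (Σ n : {n // N n = M}, ι n)
    · have : Finite {n // N n = M} := ((Set.finite_Iic M).subset fun n hn => by
        exact (hN n).trans_eq hn : {n | N n = M}.Finite)
      obtain ⟨⟨⟨n₀, h0⟩, r₀⟩, hmax⟩ := Finite.exists_max
        fun x : Σ n : {n // N n = M}, ι n => prfAdvantage G (D x.1 x.2)
      subst h0
      refine ⟨D n₀ r₀, ?_, fun n r h => hmax ⟨⟨n, h⟩, r⟩⟩
      exact ((hD _ _).trans ((hP _).trans (P.monotone_eval_nat (hN _)))).trans (Nat.le_add_right _ 2)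
    · exact ⟨⟨1, [], fun _ => 0⟩, by simp [QCircuit.size],
        fun n r h' => absurd ⟨⟨⟨n, h'⟩, r⟩⟩ h⟩
  choose D' hs hle using key
  exact ⟨fun n => prfAdvantage G (D' (N n)),
    (hG.2 D' ⟨P + 2, fun n => by simpa using hs n⟩).comp (fun n => abs_nonneg _) hN,
    fun n r => hle _ n r rfl⟩

/-! ### Security of full domain hash -/

namespace TrapdoorPermutationPair

variable (F : TrapdoorPermutationPair)

/-- A quantum forger yields a quantum claw finder. The simulated oracle is programmed with a
pseudorandom function; its key is hardwired, and is chosen such that the claw finder is at least as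
good as for a random key. -/
theorem exists_clawFinder_of_forger {msgLen : ℕ → ℕ} (hmsg : PolyBounded msgLen)
    (hprf : QuantumPRFExists) {q : ℕ → ℕ} (hq : ∀ n, 2 ≤ q n) (hpoly : PolyBounded q)
    (A : ∀ n, (F.fdh msgLen).QAdversary n) (hA : PolyBounded fun n => (A n).size)
    (hAq : ∀ n, (A n).classicalQueries ≤ q n) :
    ∃ B : ∀ n, QCircuit 0 0 0 0 (F.clawProblem.ansLen n), PolyBounded (fun n => (B n).size) ∧
      ∃ ν : ℕ → ℝ, Negligible ν ∧ ∀ n,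
        1 / (q n : ℝ) * (1 - 1 / (q n : ℝ)) ^ q n * (F.fdh msgLen).advantage (A n) - ν n ≤
          F.clawProblem.advantage (B n) := by
  obtain ⟨G, hG⟩ := hprf
  obtain ⟨sG, hsG, hlG, hcG⟩ := hG.1.exists_comp
  obtain ⟨s, hs, hlen, hf₁, hf₂⟩ := F.exists_bound
  choose z hz1 hz2 hz using fun n => exists_coin (q n) (hq n)
  have hdom : PolyBounded F.domLen := hs.of_le fun n => by have := hlen n; omega
  -- a key length for which the inputs and outputs are long enough
  set N : ℕ → ℕ := fun n => n + msgLen n + F.domLen n + 2 * q n with hNdef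
  have hN : PolyBounded N :=
    ((PolyBounded.id.add hmsg).add hdom).add ((PolyBounded.const 2).mul hpoly)
  set T : ℕ → ℕ := fun n => (A n).size + 3 * s n + (10 * q n + 1) + 3 * N n + sG (N n) with hTdef
  have hT : PolyBounded T := (((hA.add ((PolyBounded.const 3).mul hs)).add
    (((PolyBounded.const 10).mul hpoly).add (.const 1))).add ((PolyBounded.const 3).mul hN)).add
      (hsG.comp hN)
  have hU : PolyBounded fun n => 1000 * (100 * (T n + 1)) ^ 3 :=
    (PolyBounded.const 1000).mul (((PolyBounded.const 100).mul (hT.add (.const 1))).pow 3)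
  -- the function that replaces the random oracle of the reduction
  let V : ∀ n, (Bits (N n) → Bits (N n)) → Bits (msgLen n) → Bits (F.domLen n + 2 * q n) :=
    fun n g m => resizeBits _ (g (resizeBits (N n) m))
  have hV : ∀ n k, Comp 0 0 (T n) fun _ => V n (G (N n) k) := fun n k => by
    refine (((((Comp.const k).pair Comp.resizeBits).comp (hcG (N n) 0 0)).comp
      Comp.resizeBits).mono ?_).congr fun _ m => ?_
    · simp only [hTdef]; omega
    · simp only [fstBits_append, sndBits_append]
      rfl
  have hV' : ∀ n, Comp (N n) (N n) (T n) (V n) := fun n =>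
    ((Comp.resizeBits.comp Comp.query).comp Comp.resizeBits).mono (by simp only [hTdef]; omega)
  have hD : ∀ n (r : Bits (F.coinLen n)), ∃ D : QCircuit (N n) (N n) 0 0 1,
      D.size ≤ 43 * (1000 * (100 * (T n + 1)) ^ 3) ∧
      ∀ g, D.prob g noOracle (nIn := 0) Fin.elim0 (fun _ y => y 0 = true) =
        simProb (A n) (z n) (F.f₁ n) (F.f₂ n) (F.gen n r).1 (V n g) := fun n r =>
    exists_distinguisher ((hf₁ n _ _).mono (by simp only [hTdef]; omega))
      ((hf₂ n _ _).mono (by simp only [hTdef]; omega))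
      ((hz n _ _).mono (by simp only [hTdef]; omega)) (hV' n) (A n)
      (by simp only [hTdef]; omega)
      (by have := hlen n; have := hq n; simp only [hTdef, hNdef]; omega) _
  choose D hDs hDe using hD
  obtain ⟨ν, hν, hDν⟩ := hG.exists_negligible (N := N)
    (fun n => by simp only [hNdef]; omega) D ((PolyBounded.const 43).mul hU) hDs
  have hB : ∀ n (k : Bits (N n)), ∃ B : QCircuit 0 0 0 0 (F.domLen n + F.domLen n),
      B.size ≤ 1000 * (100 * (T n + 1)) ^ 3 ∧ ∀ g (pk : Bits (F.pkLen n)), B.prob g noOracle pk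
        (fun _ y => F.f₁ n pk (fstBits y) = F.f₂ n pk (sndBits y)) =
          simProb (A n) (z n) (F.f₁ n) (F.f₂ n) pk (V n (G (N n) k)) := fun n k =>
    exists_clawFinder ((hf₁ n _ _).mono (by simp only [hTdef]; omega))
      ((hf₂ n _ _).mono (by simp only [hTdef]; omega))
      ((hz n _ _).mono (by simp only [hTdef]; omega)) (hV n k) (A n)
      (by simp only [hTdef]; omega)
      (by have := hlen n; simp only [hTdef, hNdef]; omega)
  choose B hBs hBe using hB
  choose k hk using fun n => Finite.exists_max fun k : Bits (N n) =>
    F.clawProblem.advantage (B n k)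
  refine ⟨fun n => B n (k n), hU.of_le fun n => hBs n _, ν, hν, fun n => ?_⟩
  have hadv : 0 ≤ (F.fdh msgLen).advantage (A n) :=
    Finset.expect_nonneg fun r _ => Finset.expect_nonneg fun O _ => runProb_nonneg _ _ _
  calc 1 / (q n : ℝ) * (1 - 1 / (q n : ℝ)) ^ q n * (F.fdh msgLen).advantage (A n) - ν n
      ≤ (𝔼 y, ind (z n y = true)) * (1 - 𝔼 y, ind (z n y = true)) ^ q n *
          (F.fdh msgLen).advantage (A n) - ν n :=
        sub_le_sub_right (mul_le_mul_of_nonneg_right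
          (one_div_mul_pow_le (hq n) (hz1 n) (hz2 n)) hadv) _
    _ ≤ (𝔼 r : Bits (F.coinLen n), 𝔼 g : Bits (N n) → Bits (N n),
          simProb (A n) (z n) (F.f₁ n) (F.f₂ n) (F.gen n r).1 (V n g)) - ν n := by
        refine sub_le_sub_right ?_ _
        rw [ROSignature.advantage, Finset.mul_expect]
        refine expect_mono fun r => ?_
        rw [expect_resizeBits (N := N n) (by simp only [hNdef]; omega)
          (by simp only [hNdef]; omega)
          fun u => simProb (A n) (z n) (F.f₁ n) (F.f₂ n) (F.gen n r).1 u]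
        exact mul_forge_le_expect_simProb (A n) (hAq n) (z n) (F.f₁_injective n r)
          (F.f₂_injective n r) (F.inv₁_f₁ n r)
    _ ≤ 𝔼 r : Bits (F.coinLen n), 𝔼 k : Bits (N n),
          simProb (A n) (z n) (F.f₁ n) (F.f₂ n) (F.gen n r).1 (V n (G (N n) k)) := by
        rw [← expect_const' (X := Bits (F.coinLen n)) (ν n), ← Finset.expect_sub_distrib]
        refine expect_mono fun r => ?_
        have h := (abs_le.1 (hDν n r)).1
        simp only [hDe] at h
        linarith
    _ = 𝔼 k : Bits (N n), F.clawProblem.advantage (B n k) := by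
        rw [Finset.expect_comm]
        refine Finset.expect_congr rfl fun k _ => Finset.expect_congr rfl fun r _ => ?_
        exact (hBe n k noOracle _).symm
    _ ≤ F.clawProblem.advantage (B n (k n)) :=
        Finset.expect_le Finset.univ_nonempty fun k _ => hk n k

/-- Claw-freeness gives security: the loss in the reduction is polynomial. -/
theorem fdh_quantumSecure {msgLen : ℕ → ℕ} (hmsg : PolyBounded msgLen)
    (hprf : QuantumPRFExists) (hF : F.QuantumClawFree) : (F.fdh msgLen).QuantumSecure := by
  intro A hA
  have hq : ∀ n, 2 ≤ (A n).size + 2 := fun n => Nat.le_add_left _ _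
  have hpoly : PolyBounded fun n => (A n).size + 2 := hA.add (.const 2)
  obtain ⟨B, hB, ν, hν, h⟩ := F.exists_clawFinder_of_forger hmsg hprf hq hpoly A hA fun n => by
    have : (A n).classicalQueries ≤ (A n).ops.length := List.countP_le_length
    simp only [QCircuit.size]
    omega
  obtain ⟨⟨P, hP⟩, Q, hQ⟩ := noticeable_bounds hq hpoly
  have hadv : ∀ n, 0 ≤ (F.fdh msgLen).advantage (A n) := fun n =>
    Finset.expect_nonneg fun r _ => Finset.expect_nonneg fun O _ => runProb_nonneg _ _ _
  have hsum := ((hF B hB).add hν).polynomial_mul ((P * Q).map (Nat.castRingHom ℝ))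
  refine hsum.trans_abs_le fun n => ?_
  have e : ((P * Q).map (Nat.castRingHom ℝ)).eval (n : ℝ) =
      ((P.eval n : ℕ) : ℝ) * ((Q.eval n : ℕ) : ℝ) := by
    rw [Polynomial.eval_natCast_map]
    simp
  have hp0 : (0 : ℝ) < ((P.eval n : ℕ) : ℝ) := by exact_mod_cast (hP n).1
  have hq0 : (0 : ℝ) < ((Q.eval n : ℕ) : ℝ) := by exact_mod_cast (hQ n).1
  have h1 : 1 / (((P.eval n : ℕ) : ℝ) * ((Q.eval n : ℕ) : ℝ)) ≤
      1 / (((A n).size + 2 : ℕ) : ℝ) * (1 - 1 / (((A n).size + 2 : ℕ) : ℝ)) ^ ((A n).size + 2) := by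
    rw [mul_comm, ← one_div_mul_one_div]
    exact mul_le_mul (hQ n).2 (hP n).2 (by positivity) (by positivity)
  have h2 := (mul_le_mul_of_nonneg_right h1 (hadv n)).trans (sub_le_iff_le_add.1 (h n))
  rw [abs_of_nonneg (hadv n), e, Pi.add_apply]
  refine le_trans ?_ (le_abs_self _)
  rwa [one_div, inv_mul_le_iff₀ (mul_pos hp0 hq0)] at h2

end TrapdoorPermutationPair

theorem mainTheorem7 (F : TrapdoorPermutationPair) (msgLen : ℕ → ℕ) (hmsg : PolyBounded msgLen) :
    -- the bounds for a general choice of `p`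
    (∀ (q p : ℕ → ℕ) (hp : ∀ n, 0 < p n), PolyBounded p →
      (F.coronReduction msgLen p hp).HistoryFreeWith q
        (fun n => (1 - 1 / (p n : ℝ)) ^ q n) (fun n => 1 / (p n : ℝ))) ∧
    -- for `p = q` the reduction is in history-free form
    (∀ (q : ℕ → ℕ) (hq : ∀ n, 2 ≤ q n), PolyBounded q →
      (F.coronReduction msgLen q (fun n => lt_of_lt_of_le Nat.zero_lt_two (hq n))).IsHistoryFree q ∧
      ∀ n, Real.exp (-1) * (1 - 1 / (q n : ℝ)) ≤ (1 - 1 / (q n : ℝ)) ^ q n) ∧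
    -- a quantum forger with `q` signing queries yields a quantum claw finder, with a loss of
    -- about a factor of `q`
    (QuantumPRFExists → ∀ q : ℕ → ℕ, (∀ n, 2 ≤ q n) → PolyBounded q →
      ∀ A : ∀ n, (F.fdh msgLen).QAdversary n, PolyBounded (fun n => (A n).size) →
        (∀ n, (A n).classicalQueries ≤ q n) →
        ∃ B : ∀ n, QCircuit 0 0 0 0 (F.clawProblem.ansLen n), PolyBounded (fun n => (B n).size) ∧
          ∃ ν : ℕ → ℝ, Negligible ν ∧ ∀ n,
            1 / (q n : ℝ) * (1 - 1 / (q n : ℝ)) ^ q n * (F.fdh msgLen).advantage (A n) - ν n ≤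
              F.clawProblem.advantage (B n)) ∧
    -- security of full domain hash
    (QuantumPRFExists → F.QuantumClawFree → (F.fdh msgLen).QuantumSecure) := by
  refine ⟨fun q p hp hpoly => F.coron_historyFreeWith hmsg q p hp hpoly,
    fun q hq hpoly => ⟨⟨_, _, (noticeable_bounds hq hpoly).1, (noticeable_bounds hq hpoly).2,
      F.coron_historyFreeWith hmsg q q _ hpoly⟩, fun n => exp_neg_one_mul_le _ (hq n)⟩,
    fun hprf q hq hpoly A hA hAq => F.exists_clawFinder_of_forger hmsg hprf hq hpoly A hA hAq,
    fun hprf hF => F.fdh_quantumSecure hmsg hprf hF⟩
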